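/- Let $p$ be a prime, let $K$ be a finite extension of $\mathbb{Q}_p$, and let $\mathbb{F}$ be the residue field of $K$, that is, the quotient of the ring of integers of $K$ by its maximal ideal. For a non-negative integer $r$, let $\beta(r;K)$ denote the least integer $m$ such that every system of $r$ quadratic forms over $K$ in more than $m$ variables has a non-trivial common zero in $K$ (with $\beta(r;K)=\infty$ if there is no such $m$). If $$\#\mathbb{F}>(2r)^r,$$ then any $r$ quadratic forms over $K$ in more than $4r$ variables have a non-trivial common zero in $K$, and moreover $$\beta(r;K)=4r.$$ -/

import Mathlib

/-- Every system of `r` quadratic forms over `K` in exactly `n` variables has a common zero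
in `K ^ n` other than the origin. -/
def HasCommonZeros (K : Type*) [Field K] (r n : ℕ) : Prop :=
  ∀ Q : Fin r → QuadraticForm K (Fin n → K), ∃ x : Fin n → K, x ≠ 0 ∧ ∀ i, Q i x = 0

/-- `β(r; K)`: the least integer `m` such that every system of `r` quadratic forms over `K` in
more than `m` variables has a non-trivial common zero in `K`. It is `⊤` if there is no such
integer. -/
noncomputable def quadraticBeta (r : ℕ) (K : Type*) [Field K] : ℕ∞ :=
  sInf ((fun m : ℕ => (m : ℕ∞)) '' {m : ℕ | ∀ n : ℕ, m < n → HasCommonZeros K r n})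

/-- The ring of integers of a finite extension `K` of `ℚ_[p]`: the elements of absolute value at
most `1`. Here `spectralNorm ℚ_[p] K` is the unique absolute value on `K` that extends the
`p`-adic absolute value. -/
noncomputable def padicRingOfIntegers (p : ℕ) [Fact p.Prime] (K : Type*) [Field K]
    [Algebra ℚ_[p] K] [FiniteDimensional ℚ_[p] K] : ValuationSubring K where
  carrier := {x | spectralNorm ℚ_[p] K x ≤ 1}
  zero_mem' := by
    rw [Set.mem_ofPred_eq, spectralNorm_zero]
    exact zero_le_one
  one_mem' := (spectralNorm_one (K := ℚ_[p]) (L := K)).le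
  neg_mem' := fun {x} hx => by
    rw [Set.mem_ofPred_eq, spectralNorm_neg (Algebra.IsAlgebraic.isAlgebraic x)]
    exact hx
  add_mem' := fun {x y} hx hy =>
    (isNonarchimedean_spectralNorm (K := ℚ_[p]) x y).trans (max_le hx hy)
  mul_mem' := fun {x y} hx hy => by
    have h : spectralNorm ℚ_[p] K (x * y) = spectralNorm ℚ_[p] K x * spectralNorm ℚ_[p] K y :=
      map_mul (spectralMulAlgNorm ℚ_[p] K) x y
    rw [Set.mem_ofPred_eq, h]
    exact mul_le_one₀ hx (spectralNorm_nonneg y) hy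
  mem_or_inv_mem' := fun x => by
    rcases eq_or_ne x 0 with rfl | hx
    · left
      rw [Set.mem_ofPred_eq, spectralNorm_zero]
      exact zero_le_one
    · have h : spectralNorm ℚ_[p] K x⁻¹ = (spectralNorm ℚ_[p] K x)⁻¹ := by
        have h1 : spectralNorm ℚ_[p] K (x⁻¹ * x) =
            spectralNorm ℚ_[p] K x⁻¹ * spectralNorm ℚ_[p] K x :=
          map_mul (spectralMulAlgNorm ℚ_[p] K) x⁻¹ x
        rw [inv_mul_cancel₀ hx, spectralNorm_one] at h1
        exact eq_inv_of_mul_eq_one_left h1.symm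
      rw [Set.mem_ofPred_eq, Set.mem_ofPred_eq, h]
      rcases le_total (spectralNorm ℚ_[p] K x) 1 with h1 | h1
      · exact Or.inl h1
      · exact Or.inr (inv_le_one_of_one_le₀ h1)

/-- The residue field of a finite extension `K` of `ℚ_[p]`: its ring of integers modulo the
maximal ideal. -/
abbrev PadicResidueField (p : ℕ) [Fact p.Prime] (K : Type*) [Field K]
    [Algebra ℚ_[p] K] [FiniteDimensional ℚ_[p] K] : Type _ :=
  IsLocalRing.ResidueField (padicRingOfIntegers p K)

/-!
# Systems of quadratic forms over `p`-adic fields with large residue field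

Let `O` be the ring of integers of `K`, with uniformizer `π` and residue field of `q` elements. The
upper bound for `β(r; K)` is proved by Heath-Brown's method: an anisotropic system of `r` forms in
`4 r + 1` variables is brought into a minimal integral shape, minimality is translated into a
condition on the reduced system over the residue field, a count of points produces a nonsingular
zero of the reduced system when `q > (2 r) ^ r`, and Hensel's lemma lifts it to a contradiction.

*Minimization* (`exists_minimal_system`). A substitution `g` in the variables and a linear change
`h` of the forms are weighed by `-(4 r + 1) v(det h) - 2 r v(det g)`. Among the pairs keeping the
system integral this weight is bounded: after a Smith normal form of `g` and `h`, a large weight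
would make some of the forms highly divisible on the last coordinates, where the remaining forms
have a common zero by induction on `r` (`le_of_diagonal_integral`); for an anisotropic system this
is excluded by compactness (`hasPrimitiveBound_of_properSpace`). For a pair of maximal weight, no
`t ≥ 1` independent forms of the reduced pencil vanish on a subspace of codimension at most `2 t`
(`stablePencil_reduceForm`).

*Counting* (`exists_nonsingular_zero`). The number of zeros of a single form `Q` deviates from
`q ^ (n - 1)` by an amount governed by the rank of its polar form, and only if `Q` vanishes on the
radical of that form (`abs_card_mul_zeroCount_sub_le`). Summing over the pencil `∑ b i • Q i` gives
the number of common zeros, provided that members of small rank are rare. They are: a stratum of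
given rank has an explicit supply of polynomial equations, found by Cramer's rule, whose gradients
bound its tangent space by the space of forms vanishing on the radical, which is small by stability.
A Bézout inequality for nondegenerate zeros (`card_le_prod_of_nondegenerate`), completed by the
equations `X ^ q = X`, turns this into bounds for the number of points (`card_polarRank_stratum_le`,
`card_quad_stratum_le`). A singular zero lies in the radical of some nonzero member of the pencil;
the same estimates, applied to the restrictions to subspaces of these radicals, show that there are
fewer singular zeros than zeros.

Everything is independent of the characteristic of the residue field, which may be `2`: a quadratic
form is represented by a bilinear form `A` that is not assumed symmetric, as `x ↦ A x x`.

The lower bound comes from `r` disjoint copies of the form `N(x, y) + π N(z, w)`, where the binary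
form `N` is anisotropic modulo `π` (`exists_anisotropic_quaternary`).
-/


/-! ### Counting nondegenerate common zeros of polynomials -/

section Bezout

open MvPolynomial

/-- First order Taylor expansion of a polynomial, modulo the square of an ideal containing the
increments. -/
theorem aeval_add_sub_mem_sq {k A σ : Type*} [Field k] [CommRing A] [Algebra k A] [Fintype σ]
    (I : Ideal A) (η : σ → k) (z : σ → A) (hz : ∀ j, z j ∈ I) (f : MvPolynomial σ k) :
    aeval (fun j => algebraMap k A (η j) + z j) f - (algebraMap k A (eval η f) +
      ∑ j, algebraMap k A (eval η (pderiv j f)) * z j) ∈ I ^ 2 := by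
  classical
  induction f using MvPolynomial.induction_on with
  | C a => simp
  | add p q hp hq =>
    convert add_mem hp hq using 1
    simp only [map_add, add_mul, Finset.sum_add_distrib]
    ring
  | mul_X p m hp =>
    have h1 : (∑ j, algebraMap k A (eval η (pderiv j p)) * z j) ∈ I :=
      sum_mem fun j _ => Ideal.mul_mem_left _ _ (hz j)
    have h2 : (∑ j, algebraMap k A (eval η (pderiv j p)) * z j) * z m ∈ I ^ 2 := by
      rw [pow_two]; exact Ideal.mul_mem_mul h1 (hz m)
    convert add_mem (Ideal.mul_mem_right (algebraMap k A (η m) + z m) _ hp) h2 using 1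
    have h3 : ∀ j, algebraMap k A (eval η (pderiv j (p * X m))) * z j =
        algebraMap k A (η m) * (algebraMap k A (eval η (pderiv j p)) * z j) +
        (if j = m then algebraMap k A (eval η p) * z m else 0) := by
      intro j
      rw [pderiv_mul, pderiv_X]
      by_cases hj : j = m
      · subst hj
        simp
        ring
      · simp [hj, Ne.symm hj]
        ring
    simp only [h3, Finset.sum_add_distrib, ← Finset.mul_sum, Finset.sum_ite_eq', Finset.mem_univ,
      if_true, map_mul, aeval_X, eval_X]
    ring

/-- If `a i` and `b i` agree to first order along an ideal, then so do their products. -/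
theorem prod_pow_sub_prod_pow_mem {A τ : Type*} [CommRing A] (I : Ideal A) (a b : τ → A)
    (hb : ∀ i, b i ∈ I) (hab : ∀ i, a i - b i ∈ I ^ 2) (α : τ → ℕ) (s : Finset τ) :
    ∏ i ∈ s, a i ^ α i - ∏ i ∈ s, b i ^ α i ∈ I ^ (∑ i ∈ s, α i + 1) ∧
      ∏ i ∈ s, b i ^ α i ∈ I ^ (∑ i ∈ s, α i) := by
  classical
  have key : ∀ (m n : ℕ) (x x' y y' : A), x - x' ∈ I ^ (m + 1) → x' ∈ I ^ m →
      y - y' ∈ I ^ (n + 1) → y' ∈ I ^ n →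
      x * y - x' * y' ∈ I ^ (m + n + 1) ∧ x' * y' ∈ I ^ (m + n) := by
    intro m n x x' y y' h1 h2 h3 h4
    refine ⟨?_, ?_⟩
    · have e : x * y - x' * y' = (x - x') * y' + x' * (y - y') + (x - x') * (y - y') := by ring
      rw [e]
      refine add_mem (add_mem ?_ ?_) ?_
      · have := Ideal.mul_mem_mul h1 h4
        rw [← pow_add] at this
        convert this using 2; ring
      · have := Ideal.mul_mem_mul h2 h3
        rwa [← pow_add, ← add_assoc] at this
      · have := Ideal.mul_mem_mul h1 h3
        rw [← pow_add] at this
        exact Ideal.pow_le_pow_right (by lia) this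
    · rw [pow_add]; exact Ideal.mul_mem_mul h2 h4
  have hpow : ∀ i (n : ℕ), a i ^ n - b i ^ n ∈ I ^ (n + 1) ∧ b i ^ n ∈ I ^ n := by
    intro i n
    induction n with
    | zero => simp
    | succ n ih =>
      rw [pow_succ (a i), pow_succ (b i)]
      exact key n 1 _ _ _ _ ih.1 ih.2 (hab i) (by simpa using hb i)
  induction s using Finset.induction_on with
  | empty => simp
  | insert i s hi ih =>
    rw [Finset.prod_insert hi, Finset.prod_insert hi, Finset.sum_insert hi]
    exact key _ _ _ _ _ _ (hpow i _).1 (hpow i _).2 ih.1 ih.2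

/-- Interpolation: a polynomial that is `1` at one point of a finite set and `0` at the others. -/
theorem exists_eval_eq_ite {k σ : Type*} [Field k] [DecidableEq (σ → k)] (X : Finset (σ → k))
    (ξ : σ → k) : ∃ e : MvPolynomial σ k, ∀ η ∈ X, eval η e = if η = ξ then 1 else 0 := by
  have h : ∀ η : σ → k, ∃ l : MvPolynomial σ k, eval ξ l = 1 ∧ (η ≠ ξ → eval η l = 0) := by
    intro η
    by_cases h : η = ξ
    · exact ⟨1, by simp, fun h' => absurd h h'⟩
    · obtain ⟨j, hj⟩ := Function.ne_iff.mp h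
      refine ⟨C (ξ j - η j)⁻¹ * (MvPolynomial.X j - C (η j)), ?_, fun _ => by simp⟩
      simp [inv_mul_cancel₀ (sub_ne_zero.mpr (Ne.symm hj))]
  choose l hl1 hl2 using h
  refine ⟨∏ η ∈ X, l η, fun η hη => ?_⟩
  rw [map_prod]
  split_ifs with h
  · subst h; exact Finset.prod_eq_one fun i _ => hl1 i
  · exact Finset.prod_eq_zero hη (hl2 η h)

/-- The polynomials `e_ξ * f_ξ ^ α` are linearly independent, where `e_ξ` interpolates and `f_ξ` is
a system of polynomials vanishing on `X` with invertible Jacobian at `ξ`. In a linear relation, let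
`(η, β)` be an index of least degree `N` with nonzero coefficient. In local coordinates at `η` the
member `(η, α)` starts with the monomial `X ^ α`, and the members `(ξ, α)` with `ξ ≠ η` vanish to
order larger than `N`, so that the coefficient of `X ^ β` shows a contradiction. -/
theorem linearIndependent_mul_prod_pow {k σ : Type*} [Field k] [Fintype σ] [DecidableEq (σ → k)]
    (X : Finset (σ → k)) (f : (σ → k) → σ → MvPolynomial σ k)
    (hvan : ∀ ξ ∈ X, ∀ i, ∀ η ∈ X, eval η (f ξ i) = 0)
    (hjac : ∀ ξ ∈ X, LinearIndependent k fun i => fun j => eval ξ (pderiv j (f ξ i)))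
    (e : (σ → k) → MvPolynomial σ k)
    (he : ∀ ξ, ∀ η ∈ X, eval η (e ξ) = if η = ξ then 1 else 0) (S : Finset (σ →₀ ℕ)) :
    LinearIndependent k fun x : X × S => e x.1 * ∏ i, f x.1 i ^ ((x.2 : σ →₀ ℕ) i) := by
  classical
  rw [Fintype.linearIndependent_iff]
  intro g hg
  suffices H : ∀ N : ℕ, ∀ x : X × S, (x.2 : σ →₀ ℕ).degree = N → g x = 0 from
    fun x => H _ x rfl
  intro N
  induction N using Nat.strong_induction_on with
  | _ N ih =>
  rintro ⟨⟨η, hη⟩, ⟨β, hβ⟩⟩ hN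
  simp only at hN
  -- linear change of coordinates at `η` in which `f η i` starts with the `i`-th variable
  have hunit : IsUnit (Matrix.of fun i j => eval η (pderiv j (f η i))) :=
    Matrix.linearIndependent_rows_iff_isUnit.mp (hjac η hη)
  obtain ⟨u, hu⟩ := hunit
  set J := Matrix.of fun i j => eval η (pderiv j (f η i)) with hJ
  have hJinv : J * (↑u⁻¹ : Matrix σ σ k) = 1 := by rw [← hu]; exact u.mul_inv
  set P : Matrix σ σ k := ↑u⁻¹ with hP
  set I := idealOfVars σ k with hI
  let z : σ → MvPolynomial σ k := fun j => ∑ i, C (P j i) * MvPolynomial.X i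
  have hX : ∀ i, (MvPolynomial.X i : MvPolynomial σ k) ∈ I :=
    fun i => Ideal.subset_span ⟨i, rfl⟩
  have hz : ∀ j, z j ∈ I := fun j => sum_mem fun i _ => Ideal.mul_mem_left _ _ (hX i)
  let φ : MvPolynomial σ k →ₐ[k] MvPolynomial σ k :=
    aeval fun j => algebraMap k (MvPolynomial σ k) (η j) + z j
  have hφ := fun p => aeval_add_sub_mem_sq I η z hz p
  have hφ1 : ∀ p, φ p - algebraMap k _ (eval η p) ∈ I := by
    intro p
    have h1 := Ideal.pow_le_self two_ne_zero (hφ p)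
    have h2 : (∑ j, algebraMap k (MvPolynomial σ k) (eval η (pderiv j p)) * z j) ∈ I :=
      sum_mem fun j _ => Ideal.mul_mem_left _ _ (hz j)
    convert add_mem h1 h2 using 1
    ring
  have hφf : ∀ i, φ (f η i) - MvPolynomial.X i ∈ I ^ 2 := by
    intro i
    convert hφ (f η i) using 2
    rw [hvan η hη i η hη, map_zero, zero_add]
    simp only [z, Finset.mul_sum]
    rw [Finset.sum_comm]
    have h4 : ∀ i', ∑ j, algebraMap k (MvPolynomial σ k) (eval η (pderiv j (f η i))) *
        (C (P j i') * MvPolynomial.X i') = C ((J * P) i i') * MvPolynomial.X i' := by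
      intro i'
      simp only [Matrix.mul_apply, hJ, Matrix.of_apply, map_sum, Finset.sum_mul, map_mul,
        MvPolynomial.algebraMap_eq, mul_assoc]
    simp only [h4, hJinv, Matrix.one_apply]
    simp
  have hcoeff := congrArg (fun p => coeff β (φ p)) hg
  simp only [map_sum, map_smul, map_zero, coeff_zero, coeff_sum, coeff_smul, smul_eq_mul] at hcoeff
  rw [Finset.sum_eq_single ((⟨η, hη⟩, ⟨β, hβ⟩) : X × S)] at hcoeff
  · have h5 := (prod_pow_sub_prod_pow_mem I (fun i => φ (f η i)) MvPolynomial.X hX hφf β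
      Finset.univ).1
    have h6 : φ (e η) - 1 ∈ I := by simpa [he η η hη] using hφ1 (e η)
    have h7 := (prod_pow_sub_prod_pow_mem I (fun i => φ (f η i)) MvPolynomial.X hX hφf β
      Finset.univ).2
    have hdeg : ∑ i, β i = N := by rw [← hN, Finsupp.degree_eq_sum]
    rw [hdeg] at h5 h7
    have h8 : φ (e η * ∏ i, f η i ^ β i) - ∏ i, (MvPolynomial.X i : MvPolynomial σ k) ^ β i ∈
        I ^ (N + 1) := by
      rw [map_mul, map_prod]
      simp only [map_pow]
      have e1 : φ (e η) * ∏ i, φ (f η i) ^ β i - ∏ i, (MvPolynomial.X i : MvPolynomial σ k) ^ β i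
        = φ (e η) * (∏ i, φ (f η i) ^ β i - ∏ i, (MvPolynomial.X i : MvPolynomial σ k) ^ β i) +
          (φ (e η) - 1) * ∏ i, (MvPolynomial.X i : MvPolynomial σ k) ^ β i := by ring
      rw [e1]
      refine add_mem (Ideal.mul_mem_left _ _ h5) ?_
      rw [pow_succ']
      exact Ideal.mul_mem_mul h6 h7
    have h9 := (mem_pow_idealOfVars_iff' _ _).mp h8 β (by rw [hN]; lia)
    have h10 : (∏ i, (MvPolynomial.X i : MvPolynomial σ k) ^ β i) = monomial β 1 := by
      rw [monomial_eq, Finsupp.prod_fintype _ _ (by simp)]; simp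
    rw [coeff_sub, h10, coeff_monomial, if_pos rfl, sub_eq_zero] at h9
    rw [h9, mul_one] at hcoeff
    exact hcoeff
  · rintro ⟨⟨ξ, hξ⟩, ⟨α, hα⟩⟩ - hne
    simp only
    by_cases hlt : α.degree < N
    · rw [ih _ hlt (⟨ξ, hξ⟩, ⟨α, hα⟩) rfl, zero_mul]
    push Not at hlt
    have hdeg : ∑ i, α i = α.degree := by rw [Finsupp.degree_eq_sum]
    by_cases hξη : ξ = η
    · subst hξη
      have hαβ : α ≠ β := by rintro rfl; exact hne rfl
      have h5 := prod_pow_sub_prod_pow_mem I (fun i => φ (f ξ i)) MvPolynomial.X hX hφf α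
        Finset.univ
      rw [hdeg] at h5
      have h6 : φ (e ξ) - 1 ∈ I := by simpa [he ξ ξ hξ] using hφ1 (e ξ)
      have h8 : φ (e ξ * ∏ i, f ξ i ^ α i) - ∏ i, (MvPolynomial.X i : MvPolynomial σ k) ^ α i ∈
          I ^ (α.degree + 1) := by
        rw [map_mul, map_prod]
        simp only [map_pow]
        have e1 : φ (e ξ) * ∏ i, φ (f ξ i) ^ α i - ∏ i, (MvPolynomial.X i : MvPolynomial σ k) ^ α i
          = φ (e ξ) * (∏ i, φ (f ξ i) ^ α i - ∏ i, (MvPolynomial.X i : MvPolynomial σ k) ^ α i) +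
            (φ (e ξ) - 1) * ∏ i, (MvPolynomial.X i : MvPolynomial σ k) ^ α i := by ring
        rw [e1]
        refine add_mem (Ideal.mul_mem_left _ _ h5.1) ?_
        rw [pow_succ']
        exact Ideal.mul_mem_mul h6 h5.2
      have h9 := (mem_pow_idealOfVars_iff' _ _).mp h8 β (by rw [hN]; lia)
      have h10 : (∏ i, (MvPolynomial.X i : MvPolynomial σ k) ^ α i) = monomial α 1 := by
        rw [monomial_eq, Finsupp.prod_fintype _ _ (by simp)]; simp
      rw [coeff_sub, h10, coeff_monomial, if_neg hαβ, sub_zero] at h9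
      rw [h9, mul_zero]
    · have h6 : φ (e ξ) ∈ I := by simpa [he ξ η hη, Ne.symm hξη] using hφ1 (e ξ)
      have h7 : ∀ i, φ (f ξ i) ∈ I := fun i => by simpa [hvan ξ hξ i η hη] using hφ1 (f ξ i)
      have h5 := (prod_pow_sub_prod_pow_mem I (fun i => φ (f ξ i)) (fun i => φ (f ξ i)) h7
        (by simp) α Finset.univ).2
      rw [hdeg] at h5
      have h8 : φ (e ξ * ∏ i, f ξ i ^ α i) ∈ I ^ (α.degree + 1) := by
        rw [map_mul, map_prod, pow_succ']
        simp only [map_pow]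
        exact Ideal.mul_mem_mul h6 h5
      rw [(mem_pow_idealOfVars_iff' _ _).mp h8 β (by rw [hN]; lia), mul_zero]
  · intro h; exact absurd (Finset.mem_univ _) h

/-- The number of exponent vectors `α` of weighted degree `∑ w i * α i` at most `M`. -/
noncomputable def exponentCount {σ : Type*} [Fintype σ] (w : σ → ℕ) (M : ℕ) : ℕ :=
  Nat.card {α : σ → ℕ // ∑ i, w i * α i ≤ M}

theorem finite_exponents {σ : Type*} [Fintype σ] (w : σ → ℕ) (hw : ∀ i, 0 < w i) (M : ℕ) :
    Finite {α : σ → ℕ // ∑ i, w i * α i ≤ M} := by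
  refine Finite.of_injective (β := σ → Fin (M + 1)) (fun α i => ⟨α.1 i, ?_⟩) ?_
  · have h1 := Finset.single_le_sum (f := fun i => w i * α.1 i) (fun _ _ => Nat.zero_le _)
      (Finset.mem_univ i)
    have h2 := Nat.le_mul_of_pos_left (α.1 i) (hw i)
    have h3 := α.2
    lia
  · intro α β h
    ext i
    exact Fin.mk.inj_iff.mp (congrFun h i)

theorem exponentCount_one_le {σ : Type*} [Fintype σ] (M : ℕ) :
    exponentCount (fun _ : σ => 1) M ≤ (M + 1) ^ Fintype.card σ := by
  have h : Nat.card (σ → Fin (M + 1)) = (M + 1) ^ Fintype.card σ := by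
    rw [Nat.card_fun, Nat.card_eq_fintype_card, Fintype.card_fin, Nat.card_eq_fintype_card]
  rw [← h]
  refine Nat.card_le_card_of_injective (fun α i => ⟨α.1 i, ?_⟩) ?_
  · have h1 := Finset.single_le_sum (f := fun i => 1 * α.1 i) (fun _ _ => Nat.zero_le _)
      (Finset.mem_univ i)
    have h3 := α.2
    lia
  · intro α β h
    ext i
    exact Fin.mk.inj_iff.mp (congrFun h i)

/-- Division with remainder of the exponents by the weights. -/
theorem exponentCount_one_le_prod_mul {σ : Type*} [Fintype σ] (w : σ → ℕ) (hw : ∀ i, 0 < w i)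
    (M : ℕ) : exponentCount (fun _ : σ => 1) M ≤ (∏ i, w i) * exponentCount w M := by
  have := finite_exponents w hw M
  have h : Nat.card ((∀ i, Fin (w i)) × {α : σ → ℕ // ∑ i, w i * α i ≤ M}) =
      (∏ i, w i) * exponentCount w M := by
    rw [Nat.card_prod, Nat.card_pi]; simp [exponentCount]
  rw [← h]
  refine Nat.card_le_card_of_injective (fun α => (fun i => ⟨α.1 i % w i, Nat.mod_lt _ (hw i)⟩,
    ⟨fun i => α.1 i / w i, ?_⟩)) ?_
  · refine le_trans (Finset.sum_le_sum fun i _ => ?_) α.2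
    simpa using Nat.mul_div_le (α.1 i) (w i)
  · intro α β h
    simp only [Prod.mk.injEq, Subtype.mk.injEq] at h
    ext i
    have h1 := congrFun h.1 i
    have h2 := congrFun h.2 i
    simp only [Fin.mk.injEq] at h1 h2
    rw [← Nat.div_add_mod (α.1 i) (w i), ← Nat.div_add_mod (β.1 i) (w i), h1, h2]

theorem totalDegree_mul_prod_pow_le {k σ : Type*} [Field k] [Fintype σ] (e : MvPolynomial σ k)
    (f : σ → MvPolynomial σ k) (w : σ → ℕ) (hf : ∀ i, (f i).totalDegree ≤ w i) (α : σ → ℕ) :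
    (e * ∏ i, f i ^ α i).totalDegree ≤ ∑ i, w i * α i + e.totalDegree := by
  refine (totalDegree_mul _ _).trans ?_
  rw [add_comm]
  gcongr
  refine (totalDegree_finsetProd _ _).trans (Finset.sum_le_sum fun i _ => ?_)
  refine (totalDegree_pow _ _).trans ?_
  rw [mul_comm]
  gcongr
  exact hf i

/-- Comparison of dimensions: for `w α ≤ M` the members `e_ξ * f_ξ ^ α` of the independent family
have degree at most `M + c`, where `c` bounds the degrees of the interpolating polynomials. -/
theorem card_mul_exponentCount_le {k σ : Type*} [Field k] [Fintype σ]
    (X : Finset (σ → k)) (w : σ → ℕ) (hw : ∀ i, 0 < w i) (f : (σ → k) → σ → MvPolynomial σ k)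
    (hdeg : ∀ ξ ∈ X, ∀ i, (f ξ i).totalDegree ≤ w i)
    (hvan : ∀ ξ ∈ X, ∀ i, ∀ η ∈ X, eval η (f ξ i) = 0)
    (hjac : ∀ ξ ∈ X, LinearIndependent k fun i => fun j => eval ξ (pderiv j (f ξ i))) :
    ∃ c, ∀ M, X.card * exponentCount w M ≤ exponentCount (fun _ : σ => 1) (M + c) := by
  classical
  choose e he using fun ξ => exists_eval_eq_ite X ξ
  refine ⟨X.sup fun ξ => (e ξ).totalDegree, fun M => ?_⟩
  set c := X.sup fun ξ => (e ξ).totalDegree with hc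
  have := finite_exponents w hw M
  let S : Finset (σ →₀ ℕ) := Set.Finite.toFinset (s := {α : σ →₀ ℕ | ∑ i, w i * α i ≤ M}) (by
    refine Set.Finite.of_injOn (f := fun α : σ →₀ ℕ => (α : σ → ℕ))
      (t := {α : σ → ℕ | ∑ i, w i * α i ≤ M}) (fun α hα => hα) DFunLike.coe_injective.injOn ?_
    exact Set.finite_coe_iff.mp this)
  have hS : ∀ α, α ∈ S ↔ ∑ i, w i * α i ≤ M := by simp [S]
  have hcard : S.card = exponentCount w M := by
    rw [exponentCount, ← Nat.card_eq_finsetCard]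
    exact Nat.card_congr ((Finsupp.equivFunOnFinite).subtypeEquiv fun α => hS α)
  have hli := linearIndependent_mul_prod_pow X f hvan hjac e (fun ξ η hη => he ξ η hη) S
  have hmem : ∀ x : X × S, e x.1 * ∏ i, f x.1 i ^ ((x.2 : σ →₀ ℕ) i) ∈
      restrictTotalDegree σ k (M + c) := by
    rintro ⟨⟨ξ, hξ⟩, ⟨α, hα⟩⟩
    rw [mem_restrictTotalDegree]
    refine (totalDegree_mul_prod_pow_le _ _ w (hdeg ξ hξ) _).trans ?_
    have h1 := (hS α).mp hα
    have h2 : (e ξ).totalDegree ≤ c := Finset.le_sup (f := fun ξ => (e ξ).totalDegree) hξ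
    exact Nat.add_le_add h1 h2
  have hli' : LinearIndependent k
      fun x : X × S => (⟨_, hmem x⟩ : restrictTotalDegree σ k (M + c)) :=
    LinearIndependent.of_comp (Submodule.subtype _) hli
  have h3 := hli'.fintype_card_le_finrank
  rw [Fintype.card_prod, Fintype.card_coe, Fintype.card_coe, hcard] at h3
  refine h3.trans (le_of_eq ?_)
  have hb : Module.finrank k (restrictTotalDegree σ k (M + c)) =
      Nat.card {n : σ →₀ ℕ | n.degree ≤ M + c} :=
    Module.finrank_eq_nat_card_basis (basisRestrictSupport k _)
  rw [hb, exponentCount]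
  exact Nat.card_congr ((Finsupp.equivFunOnFinite).subtypeEquiv fun α => by
    simp [Finsupp.degree_eq_sum])

/-- Bézout's inequality for nondegenerate zeros: if at each point `ξ` of a finite set `X` there is
a system of polynomials of degrees at most `w i`, vanishing on `X` and with invertible Jacobian at
`ξ`, then `X` has at most `∏ w i` points. The system may depend on the point. The comparison of
dimensions, iterated, makes `(#X / ∏ w i) ^ j` grow at most polynomially in `j`. -/
theorem card_le_prod_of_nondegenerate {k σ : Type*} [Field k] [Fintype σ]
    (X : Finset (σ → k)) (w : σ → ℕ) (hw : ∀ i, 0 < w i) (f : (σ → k) → σ → MvPolynomial σ k)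
    (hdeg : ∀ ξ ∈ X, ∀ i, (f ξ i).totalDegree ≤ w i)
    (hvan : ∀ ξ ∈ X, ∀ i, ∀ η ∈ X, eval η (f ξ i) = 0)
    (hjac : ∀ ξ ∈ X, LinearIndependent k fun i => fun j => eval ξ (pderiv j (f ξ i))) :
    X.card ≤ ∏ i, w i := by
  obtain ⟨c, hc⟩ := card_mul_exponentCount_le X w hw f hdeg hvan hjac
  by_contra! hlt
  set W := ∏ i, w i with hW
  have hWpos : 0 < W := Finset.prod_pos fun i _ => hw i
  set N := exponentCount (fun _ : σ => 1) with hN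
  have hstep : ∀ M, X.card * N M ≤ W * N (M + c) := by
    intro M
    calc X.card * N M ≤ X.card * (W * exponentCount w M) :=
          Nat.mul_le_mul_left _ (exponentCount_one_le_prod_mul w hw M)
      _ = W * (X.card * exponentCount w M) := by ring
      _ ≤ W * N (M + c) := Nat.mul_le_mul_left _ (hc M)
  have h0 : 1 ≤ N 0 := by
    have := finite_exponents (fun _ : σ => 1) (fun _ => one_pos) 0
    have : Nonempty {α : σ → ℕ // ∑ i, (fun _ : σ => 1) i * α i ≤ 0} := ⟨⟨0, by simp⟩⟩
    exact Nat.one_le_iff_ne_zero.mpr Nat.card_pos.ne'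
  have hpow : ∀ j, X.card ^ j ≤ W ^ j * N (j * c) := by
    intro j
    induction j with
    | zero => simpa using h0
    | succ j ih =>
      calc X.card ^ (j + 1) = X.card * X.card ^ j := pow_succ' _ _
        _ ≤ X.card * (W ^ j * N (j * c)) := Nat.mul_le_mul_left _ ih
        _ = W ^ j * (X.card * N (j * c)) := by ring
        _ ≤ W ^ j * (W * N (j * c + c)) := Nat.mul_le_mul_left _ (hstep _)
        _ = W ^ (j + 1) * N ((j + 1) * c) := by ring_nf
  set s := Fintype.card σ
  -- exponential growth on the left, polynomial growth on the right
  have hbound : ∀ j : ℕ,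
      ((X.card : ℝ) / W) ^ j ≤ ((c + 1 : ℕ) : ℝ) ^ s * ((j + 1 : ℕ) : ℝ) ^ s := by
    intro j
    have h1 : X.card ^ j ≤ W ^ j * ((c + 1) * (j + 1)) ^ s := by
      refine (hpow j).trans (Nat.mul_le_mul_left _ ((exponentCount_one_le _).trans ?_))
      exact Nat.pow_le_pow_left (by nlinarith) _
    rw [div_pow, div_le_iff₀ (by positivity)]
    rw [← mul_pow]
    have h2 : ((X.card ^ j : ℕ) : ℝ) ≤ ((W ^ j * ((c + 1) * (j + 1)) ^ s : ℕ) : ℝ) := by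
      exact_mod_cast h1
    push_cast at h2 ⊢
    linarith
  have hr : 1 < (X.card : ℝ) / W := by
    rw [one_lt_div (by positivity)]
    exact_mod_cast hlt
  have hlim := tendsto_pow_const_div_const_pow_of_one_lt s hr
  have hlim2 := (hlim.comp (Filter.tendsto_add_atTop_nat 1)).const_mul
    (((c + 1 : ℕ) : ℝ) ^ s * ((X.card : ℝ) / W))
  rw [mul_zero] at hlim2
  obtain ⟨j, hj⟩ := (hlim2.eventually (gt_mem_nhds one_pos)).exists
  have h3 := hbound j
  simp only [Function.comp_apply] at hj
  have hrpos : 0 < ((X.card : ℝ) / W) ^ j := by positivity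
  rw [pow_succ, ← mul_div_assoc, div_lt_one (by positivity)] at hj
  have hr0 : 0 < (X.card : ℝ) / W := by positivity
  have h4 := mul_le_mul_of_nonneg_right h3 hr0.le
  nlinarith

/-- A finite set in `F ^ r` with tangent spaces of dimension at most `d` has about `q ^ d` points:
if at each `ξ` there are polynomials of degree at most `D` vanishing on `X`, whose gradients at
`ξ` have an annihilator of dimension at most `d`, then `X` has at most `D ^ (r - d) * q ^ d`
points. -/
theorem card_le_of_tangent_finrank_le {F σ : Type*} [Field F] [Fintype F] [Fintype σ]
    (X : Finset (σ → F)) (D d : ℕ) (hD : 0 < D) (hd : d ≤ Fintype.card σ)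
    (H : ∀ ξ ∈ X, ∃ (ι : Type*) (f : ι → MvPolynomial σ F) (T : Submodule F (σ → F)),
      (∀ i, (f i).totalDegree ≤ D) ∧ (∀ i, ∀ η ∈ X, eval η (f i) = 0) ∧
      (∀ b, (∀ i, ∑ j, b j * eval ξ (pderiv j (f i)) = 0) → b ∈ T) ∧ Module.finrank F T ≤ d) :
    X.card ≤ D ^ (Fintype.card σ - d) * Fintype.card F ^ d := by
  classical
  set r := Fintype.card σ with hr
  set q := Fintype.card F with hq
  let w' : Fin (r - d) ⊕ Fin d → ℕ := Sum.elim (fun _ => D) (fun _ => q)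
  have hcard : Fintype.card σ = Fintype.card (Fin (r - d) ⊕ Fin d) := by simp; lia
  let ε : σ ≃ Fin (r - d) ⊕ Fin d := Fintype.equivOfCardEq hcard
  have key : ∀ ξ ∈ X, ∃ f : Fin (r - d) ⊕ Fin d → MvPolynomial σ F,
      (∀ i, (f i).totalDegree ≤ w' i) ∧ (∀ i, ∀ η ∈ X, eval η (f i) = 0) ∧
      LinearIndependent F fun i => fun j => eval ξ (pderiv j (f i)) := by
    intro ξ hξ
    obtain ⟨ι, f, T, hdeg, hvan, hT, hTd⟩ := H ξ hξ
    let grad : ι → σ → F := fun i j => eval ξ (pderiv j (f i))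
    obtain ⟨s, g, hgmem, hgspan, hgli⟩ : ∃ (s : ℕ) (g : Fin s → σ → F),
        (∀ i, g i ∈ Set.range grad) ∧
        Submodule.span F (Set.range g) = Submodule.span F (Set.range grad) ∧
        LinearIndependent F g :=
      ⟨_, Submodule.exists_fun_fin_finrank_span_eq F (Set.range grad)⟩
    -- the gradients span a subspace of dimension at least `r - d`
    have hsd : r - d ≤ s := by
      let L : (σ → F) →ₗ[F] (Fin s → F) := LinearMap.pi fun i => Fintype.linearCombination F (g i)
      have hL : ∀ b i, L b i = ∑ j, b j * g i j := by
        intro b i; simp [L, Fintype.linearCombination_apply]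
      have hker : LinearMap.ker L ≤ T := by
        intro b hb
        refine hT b fun i => ?_
        have hi : grad i ∈ Submodule.span F (Set.range g) := by
          rw [hgspan]; exact Submodule.subset_span ⟨i, rfl⟩
        have hall : ∀ x ∈ Submodule.span F (Set.range g), ∑ j, b j * x j = 0 := by
          intro x hx
          induction hx using Submodule.span_induction with
          | mem x hx =>
            obtain ⟨i, rfl⟩ := hx
            rw [← hL, LinearMap.mem_ker.mp hb]; rfl
          | zero => simp
          | add x y _ _ hx hy => simp [mul_add, Finset.sum_add_distrib, hx, hy]
          | smul c x _ hx =>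
            have : ∑ j, b j * (c • x) j = c * ∑ j, b j * x j := by
              rw [Finset.mul_sum]
              exact Finset.sum_congr rfl fun j _ => by simp; ring
            rw [this, hx, mul_zero]
        exact hall _ hi
      have h1 := LinearMap.finrank_range_add_finrank_ker L
      have h2 := (Submodule.finrank_mono hker).trans hTd
      have h3 : Module.finrank F (LinearMap.range L) ≤ s := by
        simpa using Submodule.finrank_le (LinearMap.range L)
      rw [Module.finrank_fintype_fun_eq_card] at h1
      lia
    let g' : Fin (r - d) → σ → F := g ∘ Fin.castLE hsd
    have hg' : LinearIndependent F g' := hgli.comp _ (Fin.castLE_injective hsd)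
    have hg'mem : ∀ i, ∃ i', grad i' = g' i := fun i => hgmem _
    choose idx hidx using hg'mem
    obtain ⟨S, hS⟩ := Submodule.exists_isCompl (Submodule.span F (Set.range g'))
    have hSd : Module.finrank F S = d := by
      have h1 := Submodule.finrank_add_eq_of_isCompl hS
      rw [finrank_span_eq_card hg', Module.finrank_fintype_fun_eq_card, Fintype.card_fin] at h1
      lia
    let c : Fin d → σ → F := fun i => (Module.finBasisOfFinrankEq F S hSd i : σ → F)
    have hc : LinearIndependent F c :=
      (Module.finBasisOfFinrankEq F S hSd).linearIndependent.map' S.subtype S.ker_subtype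
    have hcS : Submodule.span F (Set.range c) ≤ S := by
      rw [Submodule.span_le]; rintro _ ⟨i, rfl⟩; exact Subtype.coe_prop _
    have hli := hg'.sum_type hc (hS.disjoint.mono_right hcS)
    -- the polynomials `X j - X j ^ q` vanish everywhere and supply the missing gradients
    let h : Fin d → MvPolynomial σ F := fun i => ∑ j, C (c i j) * (MvPolynomial.X j -
      MvPolynomial.X j ^ q)
    refine ⟨Sum.elim (fun i => f (idx i)) h, ?_, ?_, ?_⟩
    · rintro (i | i)
      · exact hdeg _
      · refine totalDegree_finsetSum_le fun j _ => ?_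
        refine (totalDegree_mul _ _).trans ?_
        rw [totalDegree_C, zero_add]
        refine (totalDegree_sub _ _).trans (max_le ?_ ?_)
        · rw [totalDegree_X]; exact Fintype.card_pos
        · exact (totalDegree_X_pow _ _).le
    · rintro (i | i) η hη
      · exact hvan _ η hη
      · simp [h, hq, FiniteField.pow_card]
    · suffices e : (fun i => fun j => eval ξ (pderiv j (Sum.elim (fun i => f (idx i)) h i))) =
          Sum.elim g' c by rw [e]; exact hli
      funext i
      rcases i with i | i
      · exact hidx i
      · funext j
        have hq0 : (q : MvPolynomial σ F) = 0 := by
          rw [← map_natCast (C : F →+* MvPolynomial σ F), hq, FiniteField.cast_card_eq_zero,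
            map_zero]
        simp only [Sum.elim_inr, h, map_sum, pderiv_mul, pderiv_C, map_sub, pderiv_pow, hq0,
          zero_mul, sub_zero, zero_add, pderiv_X, map_mul, eval_C]
        rw [Finset.sum_eq_single j]
        · simp
        · intro j' _ hj'
          simp [hj']
        · simp
  choose! f hf1 hf2 hf3 using key
  have := card_le_prod_of_nondegenerate X (w' ∘ ε)
    (fun i => by
      rcases h : ε i with j | j <;> simp [w', h, hD, Fintype.card_pos, hq])
    (fun ξ i => f ξ (ε i)) (fun ξ hξ i => hf1 ξ hξ _) (fun ξ hξ i η hη => hf2 ξ hξ _ η hη)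
    (fun ξ hξ => (hf3 ξ hξ).comp _ ε.injective)
  refine this.trans (le_of_eq ?_)
  rw [← Equiv.prod_comp ε.symm]
  simp [w', Fintype.prod_sum_type]

end Bezout

/-! ### Zeros of one quadratic form over a finite field -/

section SingleForm

open LinearMap (BilinForm)

section Polar

variable {R V : Type*} [CommRing R] [AddCommGroup V] [Module R V]

/-- The polar form `B(x, y) = A(x, y) + A(y, x)` of the quadratic form `Q(x) = A(x, x)`. Quadratic
forms are represented by (not necessarily symmetric) bilinear forms, so that the characteristic
may be `2`. -/
def polarForm (A : BilinForm R V) : BilinForm R V := A + A.flip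

@[simp] theorem polarForm_apply (A : BilinForm R V) (x y : V) :
    polarForm A x y = A x y + A y x := rfl

theorem polarForm_comm (A : BilinForm R V) (x y : V) : polarForm A x y = polarForm A y x := by
  simp [add_comm]

/-- The radical of the polar form. -/
def polarRad (A : BilinForm R V) : Submodule R V := LinearMap.ker (polarForm A)

theorem mem_polarRad {A : BilinForm R V} {x : V} : x ∈ polarRad A ↔ ∀ y, polarForm A x y = 0 := by
  rw [polarRad, LinearMap.mem_ker]
  exact ⟨fun h y => by rw [h]; rfl, fun h => LinearMap.ext h⟩

theorem quad_add (A : BilinForm R V) (x y : V) :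
    A (x + y) (x + y) = A x x + A y y + polarForm A x y := by
  simp only [map_add, LinearMap.add_apply, polarForm_apply]; ring

theorem quad_smul (A : BilinForm R V) (c : R) (x : V) : A (c • x) (c • x) = c ^ 2 * A x x := by
  simp only [map_smul, LinearMap.smul_apply, smul_eq_mul]; ring

theorem quad_add_smul (A : BilinForm R V) (x v : V) (t : R) :
    A (x + t • v) (x + t • v) = A x x + t * polarForm A x v + t ^ 2 * A v v := by
  rw [quad_add, quad_smul, map_smul, smul_eq_mul]; ring

end Polar

variable {F V : Type*} [Field F] [AddCommGroup V] [Module F V]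

/-- The rank of the polar form. -/
noncomputable def polarRank (A : BilinForm F V) : ℕ :=
  Module.finrank F (LinearMap.range (polarForm A))

theorem polarRank_add_finrank_polarRad [FiniteDimensional F V] (A : BilinForm F V) :
    polarRank A + Module.finrank F (polarRad A) = Module.finrank F V :=
  LinearMap.finrank_range_add_finrank_ker _

/-- The number of zeros of the quadratic form. -/
noncomputable def zeroCount (A : BilinForm F V) : ℕ := Nat.card {x : V // A x x = 0}

/-- Counting the zeros of a quadratic form along the lines of a fixed direction. -/
theorem card_mul_zeroCount_eq_sum [Finite F] (A : BilinForm F V) [Fintype V] (v : V) :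
    Nat.card F * zeroCount A = ∑ x : V, Nat.card {t : F // A (x + t • v) (x + t • v) = 0} := by
  rw [zeroCount, ← Nat.card_prod, ← Nat.card_sigma]
  refine Nat.card_congr
    { toFun := fun p => ⟨p.2.1 - p.1 • v, p.1, by simpa using p.2.2⟩
      invFun := fun p => (p.2.1, ⟨p.1 + p.2.1 • v, p.2.2⟩)
      left_inv := fun p => by ext <;> simp
      right_inv := fun p => by
        obtain ⟨x, t, h⟩ := p
        exact Sigma.subtype_ext (by simp) rfl }

/-- In the presence of a vector of the radical where the form does not vanish, each line in its
direction contains exactly one zero. This only happens in characteristic two. -/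
theorem card_mul_zeroCount_of_polarRad_ne [Finite F] [FiniteDimensional F V]
    (A : BilinForm F V) (y : V) (hy : y ∈ polarRad A) (hAy : A y y ≠ 0) :
    Nat.card F * zeroCount A = Nat.card V := by
  have := Module.finite_of_finite F (M := V)
  have := Fintype.ofFinite V
  have h2 : (2 : F) = 0 := by
    have h := mem_polarRad.mp hy y
    rw [polarForm_apply, ← two_mul] at h
    exact (mul_eq_zero.mp h).resolve_right hAy
  have hsq : ∀ a : F, IsSquare a := fun a => FiniteField.isSquare_of_char_two (by
    have h3 := CharP.cast_eq_zero_iff F (ringChar F) 2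
    have h4 : ringChar F ∣ 2 := h3.mp (by exact_mod_cast h2)
    exact ((Nat.dvd_prime Nat.prime_two).mp h4).resolve_left (CharP.ringChar_ne_one)) a
  rw [card_mul_zeroCount_eq_sum A y, Nat.card_eq_fintype_card, ← Finset.card_univ,
    Finset.card_eq_sum_ones]
  refine Finset.sum_congr rfl fun x _ => ?_
  rw [Nat.card_eq_one_iff_unique]
  have hline : ∀ t : F, A (x + t • y) (x + t • y) = A x x + t ^ 2 * A y y := by
    intro t
    rw [quad_add_smul, polarForm_comm, mem_polarRad.mp hy, mul_zero, add_zero]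
  constructor
  · refine ⟨fun s t => Subtype.ext ?_⟩
    have hs := s.2
    have ht := t.2
    rw [hline] at hs ht
    have h5 : (s.1 - t.1) ^ 2 * A y y = 0 := by
      linear_combination hs - ht + (t.1 ^ 2 - s.1 * t.1) * A y y * h2
    have h6 := (mul_eq_zero.mp h5).resolve_right hAy
    exact sub_eq_zero.mp (pow_eq_zero_iff two_ne_zero |>.mp h6)
  · obtain ⟨s, hs⟩ := hsq (-A x x / A y y)
    refine ⟨s, ?_⟩
    rw [hline, pow_two, ← hs]
    field_simp
    ring

/-- The hyperplane orthogonal to `v`. -/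
def perp (A : BilinForm F V) (v : V) : Submodule F V := LinearMap.ker (polarForm A v)

theorem mem_perp {A : BilinForm F V} {v x : V} : x ∈ perp A v ↔ polarForm A v x = 0 := Iff.rfl

theorem finrank_perp_add_one [FiniteDimensional F V] (A : BilinForm F V) (v : V)
    (hv : v ∉ polarRad A) :
    Module.finrank F (perp A v) + 1 = Module.finrank F V :=
  Module.Dual.finrank_ker_add_one_of_ne_zero (f := polarForm A v) hv

/-- Passing to the hyperplane orthogonal to an isotropic vector `v` does not
change `q * #zeros - #V`: a line in direction `v` outside the hyperplane contains exactly one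
zero. -/
theorem card_mul_zeroCount_perp [Finite F] [FiniteDimensional F V] (A : BilinForm F V) (v : V)
    (hAv : A v v = 0) : Nat.card F * zeroCount A + Nat.card (perp A v) =
      Nat.card F * zeroCount (A.restrict (perp A v)) + Nat.card V := by
  classical
  have := Module.finite_of_finite F (M := V)
  have := Fintype.ofFinite V
  have hline : ∀ (x : V) (t : F), A (x + t • v) (x + t • v) = A x x + t * polarForm A v x := by
    intro x t
    rw [quad_add_smul, hAv, mul_zero, add_zero, polarForm_comm]
  have h1 : ∀ x : V, Nat.card {t : F // A (x + t • v) (x + t • v) = 0} =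
      if polarForm A v x = 0 then (if A x x = 0 then Nat.card F else 0) else 1 := by
    intro x
    simp only [hline]
    split_ifs with h2 h3
    · simp [h2, h3]
    · simp [h2, h3]
    · rw [Nat.card_eq_one_iff_unique]
      refine ⟨⟨fun s t => Subtype.ext ?_⟩, ⟨-A x x / polarForm A v x, ?_⟩⟩
      · have hs := s.2
        have ht := t.2
        have h5 : (s.1 - t.1) * polarForm A v x = 0 := by linear_combination hs - ht
        exact sub_eq_zero.mp ((mul_eq_zero.mp h5).resolve_right h2)
      · field_simp
        ring
  have e1 : Nat.card (perp A v) = ∑ x : V, if polarForm A v x = 0 then 1 else 0 := by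
    rw [Finset.sum_boole, Nat.cast_id]
    rw [← Fintype.card_subtype, ← Nat.card_eq_fintype_card]
    rfl
  have e2 : Nat.card V = ∑ x : V, 1 := by simp
  have e3 : zeroCount (A.restrict (perp A v)) =
      ∑ x : V, if polarForm A v x = 0 then (if A x x = 0 then 1 else 0) else 0 := by
    simp only [← ite_and]
    rw [Finset.sum_boole, Nat.cast_id, ← Fintype.card_subtype, ← Nat.card_eq_fintype_card,
      zeroCount]
    exact Nat.card_congr (Equiv.subtypeSubtypeEquivSubtypeInter (fun x : V => polarForm A v x = 0)
      (fun x => A x x = 0))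
  rw [card_mul_zeroCount_eq_sum A v, e1, e2, e3, Finset.mul_sum, ← Finset.sum_add_distrib,
    ← Finset.sum_add_distrib]
  refine Finset.sum_congr rfl fun x _ => ?_
  rw [h1]
  split_ifs <;> simp

/-- The radical of the restriction to the hyperplane orthogonal to `v` is spanned by the radical
and `v`. -/
theorem mem_polarRad_restrict_perp (A : BilinForm F V) (v : V) (x : perp A v) :
    x ∈ polarRad (A.restrict (perp A v)) → ∃ c : F, (x : V) - c • v ∈ polarRad A := by
  intro hx
  rw [mem_polarRad] at hx
  have h1 : ⨅ _ : Unit, LinearMap.ker (polarForm A v) ≤ LinearMap.ker (polarForm A (x : V)) := by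
    rw [iInf_const]
    intro y hy
    exact hx ⟨y, hy⟩
  have h2 := mem_span_of_iInf_ker_le_ker h1
  rw [Set.range_const, Submodule.mem_span_singleton] at h2
  obtain ⟨c, hc⟩ := h2
  refine ⟨c, ?_⟩
  rw [polarRad, LinearMap.mem_ker, map_sub, map_smul, hc, sub_self]

theorem finrank_polarRad_restrict_perp [FiniteDimensional F V] (A : BilinForm F V) (v : V)
    (hv : v ∉ polarRad A) (hAv : A v v = 0) : Module.finrank F (polarRad (A.restrict (perp A v))) =
      Module.finrank F (polarRad A) + 1 := by
  have hvp : v ∈ perp A v := by rw [mem_perp, polarForm_apply, hAv, add_zero]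
  have h1 : (polarRad (A.restrict (perp A v))).map (perp A v).subtype =
      polarRad A ⊔ Submodule.span F {v} := by
    apply le_antisymm
    · rintro _ ⟨x, hx, rfl⟩
      obtain ⟨c, hc⟩ := mem_polarRad_restrict_perp A v x hx
      rw [Submodule.mem_sup]
      exact ⟨_, hc, c • v, Submodule.smul_mem _ _ (Submodule.mem_span_singleton_self v), by simp⟩
    · refine sup_le ?_ ?_
      · intro x hx
        have hxp : x ∈ perp A v := by
          rw [mem_perp, polarForm_comm]; exact mem_polarRad.mp hx v
        exact ⟨⟨x, hxp⟩, mem_polarRad.mpr fun y => mem_polarRad.mp hx y, rfl⟩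
      · rw [Submodule.span_le, Set.singleton_subset_iff]
        exact ⟨⟨v, hvp⟩, mem_polarRad.mpr fun y => y.2, rfl⟩
  have h2 := Submodule.finrank_map_subtype_eq (perp A v) (polarRad (A.restrict (perp A v)))
  rw [← h2, h1]
  have h3 := Submodule.finrank_sup_add_finrank_inf_eq (polarRad A) (Submodule.span F {v})
  have h4 : polarRad A ⊓ Submodule.span F {v} = ⊥ := by
    rw [← disjoint_iff]
    exact (Submodule.disjoint_span_singleton' (by rintro rfl; exact hv (zero_mem _))).mpr hv
  rw [h4, finrank_bot, finrank_span_singleton (by rintro rfl; exact hv (zero_mem _))] at h3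
  lia

/-- By the Chevalley–Warning theorem, a quadratic form of rank at least three has a zero outside
the radical. -/
theorem exists_isotropic_notMem_polarRad [Finite F] [FiniteDimensional F V] (A : BilinForm F V)
    (h : 3 ≤ polarRank A) :
    ∃ v, A v v = 0 ∧ v ∉ polarRad A := by
  classical
  have := Fintype.ofFinite F
  obtain ⟨S, hS⟩ := Submodule.exists_isCompl (polarRad A)
  have hSd : Module.finrank F S = polarRank A := by
    have h1 := Submodule.finrank_add_eq_of_isCompl hS
    have h2 := polarRank_add_finrank_polarRad A
    lia
  let b := Module.finBasisOfFinrankEq F S hSd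
  let f : MvPolynomial (Fin (polarRank A)) F :=
    ∑ i, ∑ j, MvPolynomial.C (A (b i) (b j)) * (MvPolynomial.X i * MvPolynomial.X j)
  have hf : ∀ x : Fin (polarRank A) → F, MvPolynomial.eval x f =
      A (∑ i, x i • (b i : V)) (∑ i, x i • (b i : V)) := by
    intro x
    simp only [f, map_sum, map_mul, MvPolynomial.eval_C, MvPolynomial.eval_X,
      LinearMap.sum_apply, map_smul, LinearMap.smul_apply, smul_eq_mul, Finset.mul_sum]
    rw [Finset.sum_comm]
    refine Finset.sum_congr rfl fun i _ => Finset.sum_congr rfl fun j _ => by ring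
  have hdeg : f.totalDegree < Fintype.card (Fin (polarRank A)) := by
    rw [Fintype.card_fin]
    refine lt_of_le_of_lt ?_ (Nat.lt_of_succ_le h)
    refine MvPolynomial.totalDegree_finsetSum_le fun i _ =>
      MvPolynomial.totalDegree_finsetSum_le fun j _ => ?_
    refine (MvPolynomial.totalDegree_mul _ _).trans ?_
    rw [MvPolynomial.totalDegree_C, zero_add]
    refine (MvPolynomial.totalDegree_mul _ _).trans ?_
    rw [MvPolynomial.totalDegree_X, MvPolynomial.totalDegree_X]
  have hdvd := char_dvd_card_solutions (ringChar F) hdeg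
  have hp : 1 < ringChar F := (CharP.char_is_prime F (ringChar F)).one_lt
  have h0 : 0 < Fintype.card {x : Fin (polarRank A) → F // MvPolynomial.eval x f = 0} :=
    Fintype.card_pos_iff.mpr ⟨⟨0, by rw [hf]; simp⟩⟩
  have h1 := hp.trans_le (Nat.le_of_dvd h0 hdvd)
  obtain ⟨x, hx⟩ := Fintype.exists_ne_of_one_lt_card h1 ⟨0, by rw [hf]; simp⟩
  have hx0 : x.1 ≠ 0 := fun h => hx (Subtype.ext h)
  refine ⟨∑ i, x.1 i • (b i : V), by rw [← hf]; exact x.2, fun hmem => hx0 ?_⟩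
  have hS' : (∑ i, x.1 i • (b i : V)) ∈ S := sum_mem fun i _ => S.smul_mem _ (b i).2
  have h2 := (Submodule.disjoint_def.mp hS.disjoint) _ hmem hS'
  have h3 : ∑ i, x.1 i • b i = 0 := by
    apply Subtype.ext
    simpa using h2
  funext i
  exact Fintype.linearIndependent_iff.mp b.linearIndependent x.1 h3 i

/-- The number of zeros of a quadratic form over a finite field. If the form does not vanish on
the radical of its polar form, or if the rank is odd, then exactly one vector in `q` is a zero on
average; otherwise the deviation is controlled by the rank. The rank is lowered by two by passing to
the hyperplanes orthogonal to isotropic vectors, down to forms whose zeros form the radical. -/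
theorem abs_card_mul_zeroCount_sub_le [Finite F] [FiniteDimensional F V] (A : BilinForm F V) :
    (((∃ y ∈ polarRad A, A y y ≠ 0) ∨ Odd (polarRank A)) →
      ((Nat.card F * zeroCount A : ℕ) : ℤ) - Nat.card V = 0) ∧
    (∀ e, polarRank A = 2 * e → |((Nat.card F * zeroCount A : ℕ) : ℤ) - Nat.card V| *
      (Nat.card F : ℤ) ^ e ≤ (Nat.card F - 1) * (Nat.card F : ℤ) ^ Module.finrank F V) := by
  by_cases hrad : ∃ y ∈ polarRad A, A y y ≠ 0
  · obtain ⟨y, hy, hAy⟩ := hrad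
    have hE := card_mul_zeroCount_of_polarRad_ne A y hy hAy
    have hq : (1 : ℤ) ≤ Nat.card F := by exact_mod_cast Nat.card_pos
    refine ⟨fun _ => by rw [hE, sub_self], fun e _ => ?_⟩
    rw [hE, sub_self, abs_zero, zero_mul]
    exact mul_nonneg (by linarith) (by positivity)
  have hrad' : ¬ ∃ y ∈ polarRad A, A y y ≠ 0 := hrad
  push Not at hrad
  suffices H : ((Odd (polarRank A)) →
      ((Nat.card F * zeroCount A : ℕ) : ℤ) - Nat.card V = 0) ∧
    (∀ e, polarRank A = 2 * e → |((Nat.card F * zeroCount A : ℕ) : ℤ) - Nat.card V| *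
      (Nat.card F : ℤ) ^ e ≤ (Nat.card F - 1) * (Nat.card F : ℤ) ^ Module.finrank F V) from
    ⟨fun h => H.1 (h.resolve_left hrad'), H.2⟩
  clear hrad'
  induction hn : Module.finrank F V using Nat.strong_induction_on generalizing V with
  | _ n ih =>
  have hsum := polarRank_add_finrank_polarRad A
  have hqpos : 0 < Nat.card F := Nat.card_pos
  by_cases hiso : ∃ v, A v v = 0 ∧ v ∉ polarRad A
  · obtain ⟨v, hAv, hv⟩ := hiso
    have h1 := finrank_perp_add_one A v hv
    have h2 := finrank_polarRad_restrict_perp A v hv hAv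
    have h3 := card_mul_zeroCount_perp A v hAv
    have h4 := polarRank_add_finrank_polarRad (A.restrict (perp A v))
    have h5 : ∀ y ∈ polarRad (A.restrict (perp A v)), A.restrict (perp A v) y y = 0 := by
      intro y hy
      obtain ⟨c, hc⟩ := mem_polarRad_restrict_perp A v y hy
      change A (y : V) y = 0
      have e1 : (y : V) = (y - c • v) + c • v := by simp
      rw [e1, quad_add_smul, hrad _ hc, mem_polarRad.mp hc, hAv]
      simp
    have hrk : polarRank A = polarRank (A.restrict (perp A v)) + 2 := by lia
    obtain ⟨i1, i2⟩ := ih _ (by lia) (A.restrict (perp A v)) h5 rfl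
    have hE : ((Nat.card F * zeroCount A : ℕ) : ℤ) - Nat.card V =
        ((Nat.card F * zeroCount (A.restrict (perp A v)) : ℕ) : ℤ) - Nat.card (perp A v) := by
      have h3' : ((Nat.card F * zeroCount A + Nat.card (perp A v) : ℕ) : ℤ) =
        ((Nat.card F * zeroCount (A.restrict (perp A v)) + Nat.card V : ℕ) : ℤ) := by rw [h3]
      push_cast at h3' ⊢
      linarith
    rw [hE]
    refine ⟨fun h => i1 (by rw [hrk] at h; grind), fun e he => ?_⟩
    obtain ⟨e', rfl⟩ : ∃ e', e = e' + 1 := ⟨e - 1, by lia⟩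
    have := i2 e' (by lia)
    rw [← hn, ← h1, pow_succ, pow_succ, ← mul_assoc, ← mul_assoc]
    exact mul_le_mul_of_nonneg_right this (by positivity)
  · push Not at hiso
    have hm : polarRank A ≤ 2 := by
      by_contra! h
      obtain ⟨v, hv1, hv2⟩ := exists_isotropic_notMem_polarRad A h
      exact hv2 (hiso v hv1)
    have hZ : zeroCount A = Nat.card F ^ Module.finrank F (polarRad A) := by
      rw [← Module.natCard_eq_pow_finrank, zeroCount]
      exact Nat.card_congr (Equiv.subtypeEquivRight fun x => ⟨fun h => hiso x h, fun h => hrad x h⟩)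
    rw [hZ, Module.natCard_eq_pow_finrank (K := F) (V := V), hn, ← hn, ← hsum]
    set q := Nat.card F
    set k := Module.finrank F (polarRad A)
    have hq1 : (1 : ℤ) ≤ q := by exact_mod_cast hqpos
    refine ⟨fun h => ?_, fun e he => ?_⟩
    · have : polarRank A = 1 := by
        rcases h with ⟨j, hj⟩; lia
      rw [this]
      push_cast
      ring
    · obtain rfl | rfl : e = 0 ∨ e = 1 := by lia
      · rw [he]
        push_cast
        rw [show (q : ℤ) * q ^ k - q ^ (2 * 0 + k) = (q - 1) * q ^ k by ring,
          abs_of_nonneg (mul_nonneg (by linarith) (by positivity))]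
        simp
      · rw [he]
        push_cast
        rw [show (q : ℤ) * q ^ k - q ^ (2 * 1 + k) = -((q - 1) * q ^ (k + 1)) by ring, abs_neg,
          abs_of_nonneg (mul_nonneg (by linarith) (by positivity))]
        exact le_of_eq (by ring)

/-- The member `∑ i, b i • A i` of the pencil spanned by the system `A`. -/
def pencil {r : ℕ} (A : Fin r → BilinForm F V) (b : Fin r → F) : BilinForm F V := ∑ i, b i • A i

theorem pencil_apply {r : ℕ} (A : Fin r → BilinForm F V) (b : Fin r → F) (x y : V) :
    pencil A b x y = ∑ i, b i * A i x y := by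
  simp [pencil]

theorem pencil_restrict {r : ℕ} (A : Fin r → BilinForm F V) (W : Submodule F V) (b : Fin r → F) :
    pencil (fun i => (A i).restrict W) b = (pencil A b).restrict W := by
  ext x y
  rw [pencil_apply]
  exact (pencil_apply A b (x : V) y).symm

/-- The number of common zeros of a system of quadratic forms. -/
noncomputable def commonZeroCount {r : ℕ} (A : Fin r → BilinForm F V) : ℕ :=
  Nat.card {x : V // ∀ i, A i x x = 0}

/-- The number of members of the pencil that vanish at a given vector. -/
theorem card_mul_card_pencil_eq_zero [Finite F] {r : ℕ} (A : Fin r → BilinForm F V) (x : V)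
    [Decidable (∀ i, A i x x = 0)] :
    Nat.card F * Nat.card {b : Fin r → F // pencil A b x x = 0} =
      if ∀ i, A i x x = 0 then Nat.card F * Nat.card F ^ r else Nat.card F ^ r := by
  have hV : Nat.card (Fin r → F) = Nat.card F ^ r := by rw [Nat.card_fun, Nat.card_fin]
  split_ifs with h
  · rw [← hV]
    congr 1
    exact Nat.card_congr (Equiv.subtypeUnivEquiv fun b => by simp [pencil_apply, h])
  · let φ : (Fin r → F) →ₗ[F] F := Fintype.linearCombination F fun i => A i x x
    have hφ : ∀ b, φ b = pencil A b x x := fun b => by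
      simp [φ, Fintype.linearCombination_apply, pencil_apply]
    have hφ0 : φ ≠ 0 := by
      push Not at h
      obtain ⟨i, hi⟩ := h
      intro h0
      apply hi
      have := LinearMap.congr_fun h0 (Pi.single i 1)
      simpa [φ, Fintype.linearCombination_apply, Pi.single_apply] using this
    have h1 := Module.Dual.finrank_ker_add_one_of_ne_zero hφ0
    have h2 : Nat.card {b : Fin r → F // pencil A b x x = 0} = Nat.card (LinearMap.ker φ) :=
      Nat.card_congr (Equiv.subtypeEquivRight fun b => by rw [LinearMap.mem_ker, hφ])
    rw [h2, Module.natCard_eq_pow_finrank (K := F) (V := LinearMap.ker φ), ← pow_succ', h1,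
      Module.finrank_fintype_fun_eq_card, Fintype.card_fin]

/-- The number of common zeros in terms of the numbers of zeros of the members of the pencil, by
counting the pairs of a member and one of its zeros. -/
theorem sum_card_mul_zeroCount_sub [Fintype F] [FiniteDimensional F V] {r : ℕ}
    (A : Fin r → BilinForm F V) :
    ∑ b : Fin r → F, (((Nat.card F * zeroCount (pencil A b) : ℕ) : ℤ) - Nat.card V) =
      (Nat.card F : ℤ) ^ r * (Nat.card F - 1) * commonZeroCount A := by
  classical
  have := Module.finite_of_finite F (M := V)
  have := Fintype.ofFinite V
  have h1 : ∑ b : Fin r → F, Nat.card F * zeroCount (pencil A b) =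
      ∑ x : V, if ∀ i, A i x x = 0 then Nat.card F * Nat.card F ^ r else Nat.card F ^ r := by
    simp only [← card_mul_card_pencil_eq_zero, ← Finset.mul_sum]
    congr 1
    simp only [zeroCount, Nat.card_eq_fintype_card, Fintype.card_subtype, Finset.card_filter]
    exact Finset.sum_comm
  have h2 : (commonZeroCount A : ℤ) = ∑ x : V, if ∀ i, A i x x = 0 then 1 else 0 := by
    rw [Finset.sum_boole, commonZeroCount, Nat.card_eq_fintype_card, Fintype.card_subtype]
  have h3 : ∑ _b : Fin r → F, (Nat.card V : ℤ) = ∑ _x : V, (Nat.card F : ℤ) ^ r := by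
    simp [mul_comm]
  rw [Finset.sum_sub_distrib, ← Nat.cast_sum, h1, h3, h2, Nat.cast_sum, ← Finset.sum_sub_distrib,
    Finset.mul_sum]
  refine Finset.sum_congr rfl fun x _ => ?_
  split_ifs <;> push_cast <;> ring

end SingleForm

/-! ### Tangent spaces to the strata of a pencil of quadratic forms -/

section Strata

open LinearMap (BilinForm)
open MvPolynomial

variable {F V : Type*} [Field F] [AddCommGroup V] [Module F V] {r : ℕ}

theorem polarForm_pencil_apply (A : Fin r → BilinForm F V) (b : Fin r → F) (x y : V) :
    polarForm (pencil A b) x y = ∑ i, b i * polarForm (A i) x y := by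
  simp only [polarForm_apply, pencil_apply, ← Finset.sum_add_distrib, mul_add]

theorem totalDegree_det_le {σ ι R : Type*} [CommRing R] [Fintype ι] [DecidableEq ι]
    (M : Matrix ι ι (MvPolynomial σ R)) (hM : ∀ i j, (M i j).totalDegree ≤ 1) :
    M.det.totalDegree ≤ Fintype.card ι := by
  rw [Matrix.det_apply]
  refine totalDegree_finsetSum_le fun τ _ => ?_
  have h1 : (∏ i, M (τ i) i).totalDegree ≤ Fintype.card ι := by
    refine (totalDegree_finsetProd _ _).trans ?_
    refine (Finset.sum_le_card_nsmul _ _ 1 fun i _ => hM _ _).trans ?_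
    simp
  rcases Int.units_eq_one_or (Equiv.Perm.sign τ) with h | h <;> rw [h]
  · simpa using h1
  · simpa [Units.smul_def] using h1

/-- The linear polynomial in the parameter of the pencil with values `B_a(x, y)`. -/
noncomputable def polarPoly (A : Fin r → BilinForm F V) (x y : V) : MvPolynomial (Fin r) F :=
  ∑ l, X l * C (polarForm (A l) x y)

theorem eval_polarPoly (A : Fin r → BilinForm F V) (x y : V) (a : Fin r → F) :
    eval a (polarPoly A x y) = polarForm (pencil A a) x y := by
  simp only [polarPoly, map_sum, map_mul, eval_X, eval_C, polarForm_pencil_apply]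

theorem totalDegree_polarPoly_le (A : Fin r → BilinForm F V) (x y : V) :
    (polarPoly A x y).totalDegree ≤ 1 := by
  refine totalDegree_finsetSum_le fun l _ => (totalDegree_mul _ _).trans ?_
  rw [totalDegree_C, totalDegree_X]

theorem pderiv_polarPoly (A : Fin r → BilinForm F V) (x y : V) (l : Fin r) :
    pderiv l (polarPoly A x y) = C (polarForm (A l) x y) := by
  rw [polarPoly, map_sum, Finset.sum_eq_single l]
  · rw [pderiv_mul, pderiv_X_self, pderiv_C, one_mul, mul_zero, add_zero]
  · intro j _ hj
    rw [pderiv_mul, pderiv_X_of_ne hj, pderiv_C, zero_mul, mul_zero, add_zero]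
  · simp

/-- A vector in the radical of a member of the pencil extends to a polynomial family of vectors in
the radicals of all members of the same rank, by Cramer's rule. -/
theorem exists_polynomial_section [FiniteDimensional F V] (A : Fin r → BilinForm F V) {m : ℕ}
    (ξ : Fin r → F) (hm : polarRank (pencil A ξ) = m) (w : V)
    (hw : w ∈ polarRad (pencil A ξ)) :
    ∃ (u : Fin (m + 1) → V) (p : Fin (m + 1) → MvPolynomial (Fin r) F),
      (∀ j, (p j).totalDegree ≤ m) ∧
      (∀ a, polarRank (pencil A a) ≤ m → ∑ j, eval a (p j) • u j ∈ polarRad (pencil A a)) ∧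
      ∑ j, eval ξ (p j) • u j = w := by
  classical
  obtain ⟨S, hS⟩ := Submodule.exists_isCompl (polarRad (pencil A ξ))
  have hrk := polarRank_add_finrank_polarRad (pencil A ξ)
  have hSd : Module.finrank F S = m := by
    have h1 := Submodule.finrank_add_eq_of_isCompl hS
    lia
  let b := Module.finBasisOfFinrankEq F S hSd
  let L : V →ₗ[F] (Fin m → F) := LinearMap.pi fun i => polarForm (pencil A ξ) (b i : V)
  have hLker : LinearMap.ker L ≤ polarRad (pencil A ξ) := by
    intro v hv
    rw [mem_polarRad]
    intro y
    obtain ⟨y1, hy1, y2, hy2, rfl⟩ := Submodule.mem_sup.mp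
      (show y ∈ polarRad (pencil A ξ) ⊔ S by rw [hS.sup_eq_top]; trivial)
    rw [map_add, polarForm_comm, mem_polarRad.mp hy1, zero_add, polarForm_comm]
    have h1 : (⟨y2, hy2⟩ : S) = ∑ i, b.repr ⟨y2, hy2⟩ i • b i := (b.sum_repr _).symm
    have h2 : y2 = ∑ i, b.repr ⟨y2, hy2⟩ i • (b i : V) := by
      have h3 := congrArg S.subtype h1
      rw [map_sum] at h3
      exact h3
    rw [h2, map_sum, LinearMap.sum_apply]
    refine Finset.sum_eq_zero fun i _ => ?_
    rw [map_smul, LinearMap.smul_apply]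
    have h3 : L v i = 0 := by rw [LinearMap.mem_ker.mp hv]; rfl
    rw [show polarForm (pencil A ξ) (b i : V) v = 0 from h3, smul_zero]
  have hLsurj : Function.Surjective L := by
    rw [← LinearMap.range_eq_top]
    apply Submodule.eq_top_of_finrank_eq
    have h1 := LinearMap.finrank_range_add_finrank_ker L
    have h2 := Submodule.finrank_mono hLker
    have h3 := Submodule.finrank_le (LinearMap.range L)
    rw [Module.finrank_fintype_fun_eq_card, Fintype.card_fin] at h3 ⊢
    lia
  choose v hv using fun k : Fin m => hLsurj (Pi.single k 1)
  -- the coefficients are the signed `m × m` minors of the matrix of values of `B_a` at `u i` and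
  -- `v k`; bordered by a column of values at any `y`, this matrix is singular where the rank is at
  -- most `m`
  let u : Fin (m + 1) → V := Fin.cons w fun i => (b i : V)
  let M : Fin (m + 1) → Matrix (Fin m) (Fin m) (MvPolynomial (Fin r) F) := fun j =>
    Matrix.of fun i k => polarPoly A (u (j.succAbove i)) (v k)
  have hM : ∀ j a, eval a (M j).det =
      (Matrix.of fun i k => polarForm (pencil A a) (u (j.succAbove i)) (v k)).det := by
    intro j a
    rw [RingHom.map_det]
    congr 1
    ext i k
    simp [M, eval_polarPoly]
  refine ⟨u, fun j => C ((-1) ^ (j : ℕ)) * (M j).det, fun j => ?_, fun a ha => ?_, ?_⟩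
  · refine (totalDegree_mul _ _).trans ?_
    rw [totalDegree_C, zero_add]
    refine (totalDegree_det_le _ fun i k => ?_).trans (by simp)
    exact totalDegree_polarPoly_le _ _ _
  · rw [mem_polarRad]
    intro y
    let N : Matrix (Fin (m + 1)) (Fin (m + 1)) F := Matrix.of fun i k =>
      polarForm (pencil A a) (u i) ((Fin.cons y v : Fin (m + 1) → V) k)
    have hN : N.det = 0 := by
      rw [← Matrix.exists_vecMul_eq_zero_iff]
      have hdep : ¬ LinearIndependent F fun i => polarForm (pencil A a) (u i) := by
        intro hli
        have h1 := finrank_span_eq_card hli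
        have h2 : Submodule.span F (Set.range fun i => polarForm (pencil A a) (u i)) ≤
            LinearMap.range (polarForm (pencil A a)) := by
          rw [Submodule.span_le]
          rintro _ ⟨i, rfl⟩
          exact LinearMap.mem_range_self _ _
        have h3 := Submodule.finrank_mono h2
        rw [h1, Fintype.card_fin] at h3
        have h4 : Module.finrank F (LinearMap.range (polarForm (pencil A a))) ≤ m := ha
        lia
      rw [Fintype.not_linearIndependent_iff] at hdep
      obtain ⟨c, hc, i, hi⟩ := hdep
      refine ⟨c, fun h => hi (congrFun h i), ?_⟩
      funext k
      have h3 := LinearMap.congr_fun hc ((Fin.cons y v : Fin (m + 1) → V) k)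
      rw [LinearMap.sum_apply] at h3
      exact h3
    rw [Matrix.det_succ_column_zero] at hN
    rw [map_sum, LinearMap.sum_apply, ← hN]
    refine Finset.sum_congr rfl fun j _ => ?_
    rw [map_smul, LinearMap.smul_apply, map_mul, eval_C, hM, smul_eq_mul]
    have e1 : N j 0 = polarForm (pencil A a) (u j) y := rfl
    have e2 : N.submatrix j.succAbove Fin.succ =
      Matrix.of fun i k => polarForm (pencil A a) (u (j.succAbove i)) (v k) := by
      ext i k; rfl
    rw [e1, e2]
    ring
  · rw [Fin.sum_univ_succ, Finset.sum_eq_zero, add_zero]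
    · rw [map_mul, eval_C, hM]
      have e1 : (Matrix.of fun i k => polarForm (pencil A ξ) (u ((0 : Fin (m + 1)).succAbove i))
          (v k)) = 1 := by
        ext i k
        have h1 := congrFun (hv k) i
        rw [Matrix.one_apply, Matrix.of_apply]
        simpa [u, L, Pi.single_apply] using h1
      rw [e1]
      simp [u]
    · intro j _
      rw [map_mul, hM]
      obtain ⟨m', rfl⟩ : ∃ m', m = m' + 1 := ⟨m - 1, by have := j.pos; lia⟩
      rw [Matrix.det_eq_zero_of_row_eq_zero 0, mul_zero, zero_smul]
      intro k
      rw [Matrix.of_apply, Fin.succ_succAbove_zero]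
      exact mem_polarRad.mp hw _

/-- Equations for the stratum of given rank whose gradients at `ξ` are the values of the polar
forms on the radical at `ξ`. -/
theorem exists_polynomial_gradient_polarForm [FiniteDimensional F V] (A : Fin r → BilinForm F V)
    {m : ℕ} (ξ : Fin r → F) (hm : polarRank (pencil A ξ) = m) (w v : V)
    (hw : w ∈ polarRad (pencil A ξ)) (hv : v ∈ polarRad (pencil A ξ)) :
    ∃ f : MvPolynomial (Fin r) F, f.totalDegree ≤ m + 1 ∧
      (∀ a, polarRank (pencil A a) ≤ m → eval a f = 0) ∧
      ∀ l, eval ξ (pderiv l f) = polarForm (A l) w v := by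
  obtain ⟨u, p, hdeg, hrad, hξ⟩ := exists_polynomial_section A ξ hm w hw
  refine ⟨∑ j, p j * polarPoly A (u j) v, ?_, ?_, ?_⟩
  · refine totalDegree_finsetSum_le fun j _ => (totalDegree_mul _ _).trans ?_
    exact Nat.add_le_add (hdeg j) (totalDegree_polarPoly_le _ _ _)
  · intro a ha
    have h1 := mem_polarRad.mp (hrad a ha) v
    rw [map_sum, LinearMap.sum_apply] at h1
    rw [map_sum, ← h1]
    simp only [map_mul, eval_polarPoly, map_smul, LinearMap.smul_apply, smul_eq_mul]
  · intro l
    rw [← hξ, map_sum, map_sum, map_sum, LinearMap.sum_apply]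
    refine Finset.sum_congr rfl fun j _ => ?_
    rw [pderiv_mul, map_add, map_mul, map_mul, eval_polarPoly, pderiv_polarPoly, eval_C,
      polarForm_comm, mem_polarRad.mp hv, mul_zero, zero_add, map_smul, LinearMap.smul_apply,
      smul_eq_mul]

/-- Equations for the stratum of forms of given rank which vanish on their radical; the gradients
at `ξ` are the values of the quadratic forms on the radical at `ξ`. -/
theorem exists_polynomial_gradient_quad [FiniteDimensional F V] (A : Fin r → BilinForm F V)
    {m : ℕ} (ξ : Fin r → F) (hm : polarRank (pencil A ξ) = m) (w : V)
    (hw : w ∈ polarRad (pencil A ξ)) :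
    ∃ f : MvPolynomial (Fin r) F, f.totalDegree ≤ 2 * m + 1 ∧
      (∀ a, polarRank (pencil A a) ≤ m → (∀ y ∈ polarRad (pencil A a), pencil A a y y = 0) →
        eval a f = 0) ∧
      ∀ l, eval ξ (pderiv l f) = A l w w := by
  obtain ⟨u, p, hdeg, hrad, hξ⟩ := exists_polynomial_section A ξ hm w hw
  let G : Fin r → MvPolynomial (Fin r) F := fun l => ∑ j, ∑ k, p j * p k * C (A l (u j) (u k))
  have hG : ∀ l a, eval a (G l) = A l (∑ j, eval a (p j) • u j) (∑ j, eval a (p j) • u j) := by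
    intro l a
    simp only [G, map_sum, map_mul, eval_C, LinearMap.sum_apply, map_smul, LinearMap.smul_apply,
      smul_eq_mul, Finset.mul_sum]
    rw [Finset.sum_comm]
    exact Finset.sum_congr rfl fun i _ => Finset.sum_congr rfl fun j _ => by ring
  refine ⟨∑ l, X l * G l, ?_, ?_, ?_⟩
  · refine totalDegree_finsetSum_le fun l _ => (totalDegree_mul _ _).trans ?_
    have h1 : (G l).totalDegree ≤ 2 * m := by
      refine totalDegree_finsetSum_le fun j _ => totalDegree_finsetSum_le fun k _ => ?_
      refine (totalDegree_mul _ _).trans ?_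
      rw [totalDegree_C, add_zero]
      refine (totalDegree_mul _ _).trans ?_
      have := hdeg j
      have := hdeg k
      lia
    rw [totalDegree_X]
    lia
  · intro a ha hq
    have h1 := hq _ (hrad a ha)
    rw [pencil_apply] at h1
    rw [map_sum, ← h1]
    simp only [map_mul, eval_X, hG]
  · intro l
    have hGd : ∀ i, eval ξ (pderiv l (G i)) =
        polarForm (A i) (∑ j, eval ξ (pderiv l (p j)) • u j) w := by
      intro i
      have h3 : ∀ j k, eval ξ (pderiv l (p j * p k * C (A i (u j) (u k)))) =
          eval ξ (pderiv l (p j)) * eval ξ (p k) * A i (u j) (u k) +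
          eval ξ (p j) * eval ξ (pderiv l (p k)) * A i (u j) (u k) := by
        intro j k
        simp only [pderiv_mul, pderiv_C, map_add, map_mul, eval_C, mul_zero, add_zero, add_mul]
      rw [← hξ]
      simp only [G, map_sum, h3, polarForm_apply, LinearMap.sum_apply, map_smul,
        LinearMap.smul_apply, smul_eq_mul, mul_add, Finset.sum_add_distrib, Finset.mul_sum]
      congr 1
      · rw [Finset.sum_comm]
        exact Finset.sum_congr rfl fun i _ => Finset.sum_congr rfl fun j _ => by ring
      · exact Finset.sum_congr rfl fun i _ => Finset.sum_congr rfl fun j _ => by ring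
    have h2 := mem_polarRad.mp hw (∑ j, eval ξ (pderiv l (p j)) • u j)
    rw [polarForm_comm, polarForm_pencil_apply] at h2
    rw [map_sum, map_sum]
    simp only [pderiv_mul, map_add, map_mul, eval_X, hGd]
    rw [Finset.sum_add_distrib, h2, add_zero, Finset.sum_eq_single l]
    · rw [pderiv_X_self, map_one, one_mul, hG, hξ]
    · intro j _ hj
      rw [pderiv_X_of_ne hj, map_zero, zero_mul]
    · simp

/-- The members of the pencil whose polar form vanishes on the subspace `U`. -/
def polarVanishing (A : Fin r → BilinForm F V) (U : Submodule F V) : Submodule F (Fin r → F) where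
  carrier := {b | ∀ w ∈ U, ∀ v ∈ U, polarForm (pencil A b) w v = 0}
  zero_mem' := fun w _ v _ => by rw [polarForm_pencil_apply]; simp
  add_mem' := fun {a b} ha hb w hw v hv => by
    have h1 := ha w hw v hv
    have h2 := hb w hw v hv
    rw [polarForm_pencil_apply] at h1 h2 ⊢
    simp only [Pi.add_apply, add_mul, Finset.sum_add_distrib, h1, h2, add_zero]
  smul_mem' := fun c b hb w hw v hv => by
    have h1 := hb w hw v hv
    rw [polarForm_pencil_apply] at h1 ⊢
    simp only [Pi.smul_apply, smul_eq_mul, mul_assoc, ← Finset.mul_sum, h1, mul_zero]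

/-- The members of the pencil whose quadratic form vanishes on the subspace `U`. -/
def quadVanishing (A : Fin r → BilinForm F V) (U : Submodule F V) : Submodule F (Fin r → F) where
  carrier := {b | ∀ w ∈ U, pencil A b w w = 0}
  zero_mem' := fun w _ => by simp [pencil_apply]
  add_mem' := fun {a b} ha hb w hw => by
    have h1 := ha w hw
    have h2 := hb w hw
    rw [pencil_apply] at h1 h2 ⊢
    simp only [Pi.add_apply, add_mul, Finset.sum_add_distrib, h1, h2, add_zero]
  smul_mem' := fun c b hb w hw => by
    have h1 := hb w hw
    rw [pencil_apply] at h1 ⊢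
    simp only [Pi.smul_apply, smul_eq_mul, mul_assoc, ← Finset.mul_sum, h1, mul_zero]

/-- The size of a stratum of given rank of the pencil, in terms of the dimension of the tangent
spaces. -/
theorem card_polarRank_stratum_le [Finite F] [FiniteDimensional F V] (A : Fin r → BilinForm F V)
    (X : Finset (Fin r → F)) (m d : ℕ) (hd : d ≤ r)
    (hX : ∀ ξ ∈ X, polarRank (pencil A ξ) = m ∧
      Module.finrank F (polarVanishing A (polarRad (pencil A ξ))) ≤ d) :
    X.card ≤ (m + 1) ^ (r - d) * Nat.card F ^ d := by
  have := Fintype.ofFinite F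
  have h := card_le_of_tangent_finrank_le X (m + 1) d (Nat.succ_pos m) (by simpa using hd) ?_
  · rwa [Fintype.card_fin, ← Nat.card_eq_fintype_card] at h
  intro ξ hξ
  obtain ⟨hm, hT⟩ := hX ξ hξ
  choose f hf1 hf2 hf3 using fun x : polarRad (pencil A ξ) × polarRad (pencil A ξ) =>
    exists_polynomial_gradient_polarForm A ξ hm x.1 x.2 x.1.2 x.2.2
  refine ⟨_, f, polarVanishing A (polarRad (pencil A ξ)), hf1,
    fun i η hη => hf2 i η (hX η hη).1.le, fun b hb w hw v hv => ?_, hT⟩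
  have := hb (⟨w, hw⟩, ⟨v, hv⟩)
  simp only [hf3] at this
  rw [polarForm_pencil_apply]
  exact this

/-- The size of a stratum of given rank of forms vanishing on their radical, in terms of the
dimension of the tangent spaces. -/
theorem card_quad_stratum_le [Finite F] [FiniteDimensional F V] (A : Fin r → BilinForm F V)
    (X : Finset (Fin r → F)) (m d : ℕ) (hd : d ≤ r)
    (hX : ∀ ξ ∈ X, polarRank (pencil A ξ) = m ∧
      (∀ y ∈ polarRad (pencil A ξ), pencil A ξ y y = 0) ∧
      Module.finrank F (quadVanishing A (polarRad (pencil A ξ))) ≤ d) :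
    X.card ≤ (2 * m + 1) ^ (r - d) * Nat.card F ^ d := by
  have := Fintype.ofFinite F
  have h := card_le_of_tangent_finrank_le X (2 * m + 1) d (Nat.succ_pos _) (by simpa using hd) ?_
  · rwa [Fintype.card_fin, ← Nat.card_eq_fintype_card] at h
  intro ξ hξ
  obtain ⟨hm, hq, hT⟩ := hX ξ hξ
  choose f hf1 hf2 hf3 using fun x : polarRad (pencil A ξ) =>
    exists_polynomial_gradient_quad A ξ hm x.1 x.2
  refine ⟨_, f, quadVanishing A (polarRad (pencil A ξ)), hf1,
    fun i η hη => hf2 i η (hX η hη).1.le (hX η hη).2.1, fun b hb w hw => ?_, hT⟩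
  have := hb ⟨w, hw⟩
  simp only [hf3] at this
  rw [pencil_apply]
  exact this

end Strata

/-! ### Numerical estimates -/

section Numerics

/-- The constant in the estimate of a sum over the strata `e₀ ≤ e` of a pencil. -/
def strataConst (e₀ R : ℕ) : ℕ := 1 + ∑ e ∈ Finset.Ico e₀ R, (4 * e + 1) ^ (R - e)

/-- The constant in the estimate of the number of singular zeros. -/
def singularConst (r : ℕ) : ℕ :=
  1 + ∑ c ∈ Finset.Icc 3 (2 * r), ∑ m ∈ Finset.range (c + 1), (m + 1) ^ (r - (c - 1) / 2)

theorem strataConst_mono (e₀ : ℕ) {R R' : ℕ} (h : R ≤ R') :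
    strataConst e₀ R ≤ strataConst e₀ R' := by
  unfold strataConst
  gcongr
  calc ∑ e ∈ Finset.Ico e₀ R, (4 * e + 1) ^ (R - e)
      ≤ ∑ e ∈ Finset.Ico e₀ R, (4 * e + 1) ^ (R' - e) := by
        gcongr with e
        exact Nat.le_add_left _ _
    _ ≤ _ := Finset.sum_le_sum_of_subset (Finset.Ico_subset_Ico_right h)

theorem strataConst_succ_le (e₀ R : ℕ) (h : e₀ ≤ R) :
    strataConst e₀ (R + 1) + 4 * R ≤ 4 * R * strataConst e₀ R + 4 * R + 2 := by
  unfold strataConst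
  rw [Finset.sum_Ico_succ_top h]
  have h1 : ∑ e ∈ Finset.Ico e₀ R, (4 * e + 1) ^ (R + 1 - e) ≤
      4 * R * ∑ e ∈ Finset.Ico e₀ R, (4 * e + 1) ^ (R - e) := by
    rw [Finset.mul_sum]
    refine Finset.sum_le_sum fun e he => ?_
    have he' := (Finset.mem_Ico.mp he).2
    rw [show R + 1 - e = (R - e) + 1 by lia, pow_succ']
    exact Nat.mul_le_mul_right _ (by lia)
  rw [show R + 1 - R = 1 by lia, pow_one]
  nlinarith

/-- The growth of the bound `(2 * r) ^ r`, from Bernoulli's inequality. It dominates the growth of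
`strataConst` and `singularConst`. -/
theorem mul_two_mul_pow_le (r : ℕ) (hr : 0 < r) :
    (4 * r + 4) * (2 * r) ^ r ≤ (2 * (r + 1)) ^ (r + 1) := by
  have h1 : 2 * (2 * r) ^ r ≤ (2 * (r + 1)) ^ r := by
    have hr' : (0 : ℝ) < r := by exact_mod_cast hr
    have h2 := one_add_mul_le_pow (a := 1 / (r : ℝ)) (by
      have : (0 : ℝ) < 1 / r := by positivity
      linarith) r
    have h3 : (2 : ℝ) * (2 * r) ^ r ≤ (2 * (r + 1)) ^ r := by
      have h4 : (2 * ((r : ℝ) + 1)) ^ r = (2 * r) ^ r * (1 + 1 / r) ^ r := by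
        rw [← mul_pow]
        congr 1
        field_simp
      rw [h4, mul_comm]
      refine mul_le_mul_of_nonneg_left ?_ (by positivity)
      rw [mul_one_div_cancel hr'.ne'] at h2
      linarith
    exact_mod_cast h3
  rw [pow_succ]
  calc (4 * r + 4) * (2 * r) ^ r = 2 * (2 * r) ^ r * (2 * (r + 1)) := by ring
    _ ≤ _ := Nat.mul_le_mul_right _ h1

theorem strataConst_two_le (r : ℕ) (hr : 2 ≤ r) :
    16 * (strataConst 2 (r + 1) + 1) ≤ 11 * (2 * r) ^ r := by
  induction r, hr using Nat.le_induction with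
  | base => decide
  | succ r hr ih =>
    have h1 := strataConst_succ_le 2 (r + 1) (by lia)
    have h2 := mul_two_mul_pow_le r (by lia)
    have h3 : strataConst 2 (r + 1 + 1) + 1 ≤ (4 * r + 4) * (strataConst 2 (r + 1) + 1) := by
      nlinarith
    calc 16 * (strataConst 2 (r + 1 + 1) + 1)
        ≤ (4 * r + 4) * (16 * (strataConst 2 (r + 1) + 1)) := by nlinarith
      _ ≤ (4 * r + 4) * (11 * (2 * r) ^ r) := Nat.mul_le_mul_left _ ih
      _ ≤ 11 * (2 * (r + 1)) ^ (r + 1) := by nlinarith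

theorem strataConst_zero_le (r : ℕ) (hr : 2 ≤ r) : 8 * strataConst 0 (r - 1) ≤ (2 * r) ^ r := by
  induction r, hr using Nat.le_induction with
  | base => decide
  | succ r hr ih =>
    have h1 := strataConst_succ_le 0 (r - 1) (by lia)
    have h2 := mul_two_mul_pow_le r (by lia)
    have h0 : 1 ≤ strataConst 0 (r - 1) := Nat.le_add_right _ _
    obtain ⟨s, rfl⟩ : ∃ s, r = s + 1 := ⟨r - 1, by lia⟩
    simp only [Nat.add_sub_cancel] at *
    have h3 : strataConst 0 (s + 1) ≤ (4 * (s + 1) + 4) * strataConst 0 s := by nlinarith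
    calc 8 * strataConst 0 (s + 1) ≤ (4 * (s + 1) + 4) * (8 * strataConst 0 s) := by nlinarith
      _ ≤ (4 * (s + 1) + 4) * (2 * (s + 1)) ^ (s + 1) := Nat.mul_le_mul_left _ ih
      _ ≤ _ := h2

theorem singularConst_le (r : ℕ) (hr : 2 ≤ r) :
    4 * (singularConst r + 2 * r + 4) ≤ 9 * (2 * r) ^ r := by
  induction r, hr using Nat.le_induction with
  | base => decide
  | succ r hr ih =>
    have h2 := mul_two_mul_pow_le r (by lia)
    have h3 : singularConst (r + 1) ≤
        (2 * r + 1) * singularConst r + (2 * r + 2) ^ 2 + (2 * r + 3) ^ 2 := by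
      unfold singularConst
      rw [show 2 * (r + 1) = 2 * r + 1 + 1 by ring, Finset.sum_Icc_succ_top (by lia),
        Finset.sum_Icc_succ_top (by lia)]
      have e1 : ∑ c ∈ Finset.Icc 3 (2 * r), ∑ m ∈ Finset.range (c + 1),
          (m + 1) ^ (r + 1 - (c - 1) / 2) ≤ (2 * r + 1) * ∑ c ∈ Finset.Icc 3 (2 * r),
            ∑ m ∈ Finset.range (c + 1), (m + 1) ^ (r - (c - 1) / 2) := by
        rw [Finset.mul_sum]
        refine Finset.sum_le_sum fun c hc => ?_
        rw [Finset.mul_sum]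
        refine Finset.sum_le_sum fun m hm => ?_
        have hc' := Finset.mem_Icc.mp hc
        have hm' := Finset.mem_range.mp hm
        rw [show r + 1 - (c - 1) / 2 = (r - (c - 1) / 2) + 1 by lia, pow_succ']
        exact Nat.mul_le_mul_right _ (by lia)
      have e2 : ∑ m ∈ Finset.range (2 * r + 1 + 1), (m + 1) ^ (r + 1 - (2 * r + 1 - 1) / 2) ≤
          (2 * r + 2) ^ 2 := by
        rw [show r + 1 - (2 * r + 1 - 1) / 2 = 1 by lia]
        refine (Finset.sum_le_card_nsmul _ _ (2 * r + 2) fun m hm => ?_).trans ?_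
        · have := Finset.mem_range.mp hm; lia
        · rw [Finset.card_range, smul_eq_mul, pow_two]
      have e3 : ∑ m ∈ Finset.range (2 * r + 1 + 1 + 1),
          (m + 1) ^ (r + 1 - (2 * r + 1 + 1 - 1) / 2) ≤ (2 * r + 3) ^ 2 := by
        rw [show r + 1 - (2 * r + 1 + 1 - 1) / 2 = 1 by lia]
        refine (Finset.sum_le_card_nsmul _ _ (2 * r + 3) fun m hm => ?_).trans ?_
        · have := Finset.mem_range.mp hm; lia
        · rw [Finset.card_range, smul_eq_mul, pow_two]
      nlinarith
    calc 4 * (singularConst (r + 1) + 2 * (r + 1) + 4)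
        ≤ (4 * r + 4) * (4 * (singularConst r + 2 * r + 4)) := by nlinarith
      _ ≤ (4 * r + 4) * (9 * (2 * r) ^ r) := Nat.mul_le_mul_left _ ih
      _ ≤ 9 * (2 * (r + 1)) ^ (r + 1) := by nlinarith

/-- The numerical inequality which makes the number of all zeros exceed the number of singular
zeros. -/
theorem singularConst_mul_strataConst_lt (r q : ℕ) (hr : 0 < r) (hq : (2 * r) ^ r < q) :
    (singularConst r * strataConst 0 (r - 1) : ℤ) < (q - 1) * (q - strataConst 2 (r + 1)) := by
  obtain rfl | hr2 : r = 1 ∨ 2 ≤ r := by lia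
  · have h1 : singularConst 1 = 1 := by decide
    have h2 : strataConst 0 (1 - 1) = 1 := by decide
    have h3 : strataConst 2 (1 + 1) = 1 := by decide
    rw [h1, h2, h3]
    have : (3 : ℤ) ≤ q := by exact_mod_cast (by simpa using hq : 2 < q)
    push_cast
    nlinarith
  · have h1 := strataConst_two_le r hr2
    have h2 := strataConst_zero_le r hr2
    have h3 := singularConst_le r hr2
    zify at h1 h2 h3 hq
    set D : ℤ := (2 * (r : ℤ)) ^ r
    have hD : 0 < D := by positivity
    -- the left side is at most `9 D ^ 2 / 32`, the right side exceeds `5 D ^ 2 / 16`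
    have h4 : (32 : ℤ) * (singularConst r * strataConst 0 (r - 1)) ≤ 9 * D * D := by
      have : (4 * (singularConst r : ℤ)) * (8 * strataConst 0 (r - 1)) ≤ (9 * D) * D := by
        refine mul_le_mul (by linarith) h2 (by positivity) (by positivity)
      linarith
    have h5 : D * (D + 1 - strataConst 2 (r + 1)) ≤ (q - 1) * (q - strataConst 2 (r + 1)) := by
      refine mul_le_mul (by linarith) (by linarith) (by linarith) (by linarith)
    nlinarith

end Numerics

/-! ### Nonsingular zeros over a finite field -/

section FiniteFieldZeros

open LinearMap (BilinForm)

theorem sum_le_of_forall_mul_le {β : Type*} (B : Finset β) (g : β → ℕ) (n M : ℕ) (hn : B.card ≤ n)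
    (h : ∀ b ∈ B, n * g b ≤ M) : ∑ b ∈ B, g b ≤ M := by
  rcases Nat.eq_zero_or_pos n with rfl | hpos
  · rw [Finset.card_eq_zero.mp (Nat.le_zero.mp hn)]; simp
  · refine Nat.le_of_mul_le_mul_left ?_ hpos
    rw [Finset.mul_sum]
    refine (Finset.sum_le_card_nsmul _ _ M h).trans ?_
    rw [smul_eq_mul]
    exact Nat.mul_le_mul_right _ hn

/-- A sum is estimated on the fibres of a map `f` over `J`, where the fibre over `j` is small in
terms of its largest terms, and on the rest, where all terms are small. -/
theorem sum_le_of_fiberwise {β γ : Type*} [DecidableEq γ] (B : Finset β) (f : β → γ) (J : Finset γ)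
    (g : β → ℕ) (K : γ → ℕ) (n M : ℕ) (hn : B.card ≤ n)
    (h1 : ∀ j ∈ J, ∀ b ∈ B, f b = j → (B.filter fun b => f b = j).card * g b ≤ K j * M)
    (h2 : ∀ b ∈ B, f b ∉ J → n * g b ≤ M) : ∑ b ∈ B, g b ≤ (1 + ∑ j ∈ J, K j) * M := by
  rw [← Finset.sum_filter_add_sum_filter_not B (fun b => f b ∈ J), add_mul, one_mul, add_comm M,
    Finset.sum_mul]
  refine Nat.add_le_add ?_ ?_
  · rw [← Finset.sum_fiberwise_of_maps_to (t := J) (g := f)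
      (fun b hb => (Finset.mem_filter.mp hb).2)]
    refine Finset.sum_le_sum fun j hj => ?_
    have h3 : ((B.filter fun b => f b ∈ J).filter fun b => f b = j) =
        B.filter fun b => f b = j := by
      ext b
      simp only [Finset.mem_filter]
      refine ⟨fun h => ⟨h.1.1, h.2⟩, fun h => ⟨⟨h.1, by rw [h.2]; exact hj⟩, h.2⟩⟩
    rw [h3]
    refine sum_le_of_forall_mul_le _ _ _ _ le_rfl fun b hb => ?_
    have hb' := Finset.mem_filter.mp hb
    exact h1 j hj b hb'.1 hb'.2
  · refine sum_le_of_forall_mul_le _ _ n _ ((Finset.card_filter_le _ _).trans hn) fun b hb => ?_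
    have hb' := Finset.mem_filter.mp hb
    exact h2 b hb'.1 hb'.2

variable {F V : Type*} [Field F] [AddCommGroup V] [Module F V] {r : ℕ}

/-- The deviation `q * #zeros - #V` for a quadratic form. -/
noncomputable def zeroDev (A : BilinForm F V) : ℤ :=
  ((Nat.card F * zeroCount A : ℕ) : ℤ) - Nat.card V

/-- Estimate of the deviations in a pencil, by strata of given even rank `2 * e`, under a bound for
the dimensions of the tangent spaces. -/
theorem sum_natAbs_zeroDev_le [Finite F] [FiniteDimensional F V] (A : Fin r → BilinForm F V)
    (B : Finset (Fin r → F)) (e₀ s k : ℕ)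
    (hB : ∀ b ∈ B, ∀ e, polarRank (pencil A b) = 2 * e →
      (∀ y ∈ polarRad (pencil A b), pencil A b y y = 0) →
      e₀ ≤ e ∧ Module.finrank F (quadVanishing A (polarRad (pencil A b))) + s ≤ e + k) :
    (∑ b ∈ B, (zeroDev (pencil A b)).natAbs) * Nat.card F ^ s ≤
      strataConst e₀ (r + s - k) *
        ((Nat.card F - 1) * Nat.card F ^ (Module.finrank F V + k)) := by
  classical
  have := Fintype.ofFinite F
  set q := Nat.card F with hq
  have hq1 : 1 ≤ q := Nat.card_pos
  let P : (Fin r → F) → Prop := fun b => Even (polarRank (pencil A b)) ∧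
    ∀ y ∈ polarRad (pencil A b), pencil A b y y = 0
  have hzero : ∀ b ∈ B, (zeroDev (pencil A b)).natAbs ≠ 0 → P b := by
    intro b _ hb
    by_contra hP
    apply hb
    rw [Int.natAbs_eq_zero]
    refine (abs_card_mul_zeroCount_sub_le (pencil A b)).1 ?_
    by_contra! h
    refine hP ⟨Nat.not_odd_iff_even.mp h.2, h.1⟩
  rw [← Finset.sum_filter_of_ne hzero, Finset.sum_mul]
  have hdev : ∀ b, ∀ e, polarRank (pencil A b) = 2 * e →
      (zeroDev (pencil A b)).natAbs * q ^ e ≤ (q - 1) * q ^ Module.finrank F V := by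
    intro b e he
    have h := (abs_card_mul_zeroCount_sub_le (pencil A b)).2 e he
    zify [hq1]
    exact h
  refine sum_le_of_fiberwise (B.filter P) (fun b => polarRank (pencil A b) / 2)
    (Finset.Ico e₀ (r + s - k)) _ (fun e => (4 * e + 1) ^ (r + s - k - e)) (q ^ r) _ ?_ ?_ ?_
  · refine (Finset.card_le_univ _).trans (le_of_eq ?_)
    rw [← Nat.card_eq_fintype_card, Nat.card_fun, Nat.card_fin]
  · intro e he b hb hbe
    have he' := Finset.mem_Ico.mp he
    obtain ⟨hbB, hbP⟩ := Finset.mem_filter.mp hb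
    have hrk : ∀ b', P b' → polarRank (pencil A b') / 2 = e → polarRank (pencil A b') = 2 * e := by
      intro b' hb' h'
      have := Nat.even_iff.mp hb'.1
      lia
    have hB1 := hB b hbB e (hrk b hbP hbe) hbP.2
    have hcard := card_quad_stratum_le A
      ((B.filter P).filter fun b => polarRank (pencil A b) / 2 = e) (2 * e) (e + k - s) (by lia) (by
        intro ξ hξ
        obtain ⟨hξ1, hξ2⟩ := Finset.mem_filter.mp hξ
        obtain ⟨hξB, hξP⟩ := Finset.mem_filter.mp hξ1
        have h2 := hB ξ hξB e (hrk ξ hξP hξ2) hξP.2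
        exact ⟨hrk ξ hξP hξ2, hξP.2, by lia⟩)
    have hd := hdev b e (hrk b hbP hbe)
    rw [← hq, show 2 * (2 * e) + 1 = 4 * e + 1 by ring,
      show r - (e + k - s) = r + s - k - e by lia] at hcard
    set c := ((B.filter P).filter fun b => polarRank (pencil A b) / 2 = e).card
    set z := (zeroDev (pencil A b)).natAbs
    calc c * (z * q ^ s) ≤ ((4 * e + 1) ^ (r + s - k - e) * q ^ (e + k - s)) * (z * q ^ s) :=
          Nat.mul_le_mul_right _ hcard
      _ = (4 * e + 1) ^ (r + s - k - e) * (z * q ^ (e + k - s + s)) := by rw [pow_add]; ring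
      _ = (4 * e + 1) ^ (r + s - k - e) * ((z * q ^ e) * q ^ k) := by
          rw [show e + k - s + s = e + k by lia, pow_add]; ring
      _ ≤ (4 * e + 1) ^ (r + s - k - e) * (((q - 1) * q ^ Module.finrank F V) * q ^ k) := by gcongr
      _ = _ := by rw [pow_add]; ring
  · intro b hb hbe
    obtain ⟨hbB, hbP⟩ := Finset.mem_filter.mp hb
    obtain ⟨e, he⟩ := even_iff_exists_two_mul.mp hbP.1
    have hB1 := hB b hbB e he hbP.2
    have hd := hdev b e he
    have hle : r + s ≤ e + k := by
      rw [he, Nat.mul_div_cancel_left _ two_pos, Finset.mem_Ico] at hbe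
      lia
    set z := (zeroDev (pencil A b)).natAbs
    calc q ^ r * (z * q ^ s) = z * q ^ (r + s) := by rw [pow_add]; ring
      _ ≤ z * q ^ (e + k) := Nat.mul_le_mul_left _ (Nat.pow_le_pow_right hq1 hle)
      _ = (z * q ^ e) * q ^ k := by rw [pow_add]; ring
      _ ≤ ((q - 1) * q ^ Module.finrank F V) * q ^ k := Nat.mul_le_mul_right _ hd
      _ = _ := by rw [pow_add]; ring

/-- A system of quadratic forms is stable, with defect `c`, if no `s ≥ 1` independent members of
the pencil vanish on a subspace of codimension at most `2 * s - c`. -/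
def StablePencil (A : Fin r → BilinForm F V) (c : ℕ) : Prop :=
  ∀ (T : Submodule F (Fin r → F)) (U : Submodule F V), T ≠ ⊥ →
    (∀ b ∈ T, ∀ x ∈ U, pencil A b x x = 0) →
    2 * Module.finrank F T + Module.finrank F U < Module.finrank F V + c

theorem StablePencil.restrict [FiniteDimensional F V] {A : Fin r → BilinForm F V}
    (hA : StablePencil A 0) (W : Submodule F V) :
    StablePencil (fun i => (A i).restrict W) (Module.finrank F V - Module.finrank F W) := by
  intro T U hT hTU
  have h1 := hA T (U.map W.subtype) hT (by
    rintro b hb _ ⟨x, hx, rfl⟩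
    have := hTU b hb x hx
    rw [pencil_restrict] at this
    exact this)
  rw [Submodule.finrank_map_subtype_eq] at h1
  have h2 := Submodule.finrank_le W
  lia

/-- Upper bound for the number of zeros of a system which is stable with defect at least three. -/
theorem commonZeroCount_le [Finite F] [FiniteDimensional F V] {A : Fin r → BilinForm F V} {c : ℕ}
    (hA : StablePencil A c) (hc : 3 ≤ c) (hF : 1 < Nat.card F) :
    Nat.card F ^ r * commonZeroCount A * Nat.card F ^ (c / 2 + 1) ≤
      strataConst 0 (r - 1) * Nat.card F ^ (Module.finrank F V + c) := by
  have := Fintype.ofFinite F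
  set q := Nat.card F with hq
  have h1 := sum_natAbs_zeroDev_le A Finset.univ 0 0 ((c - 1) / 2) (by
    intro b _ e he hbq
    refine ⟨Nat.zero_le _, ?_⟩
    by_cases hT : quadVanishing A (polarRad (pencil A b)) = ⊥
    · rw [hT, finrank_bot]; lia
    · have h2 := hA _ _ hT (fun b' hb' x hx => hb' x hx)
      have h3 := polarRank_add_finrank_polarRad (pencil A b)
      lia)
  have h2 := sum_card_mul_zeroCount_sub A
  have h3 : (q : ℤ) ^ r * (q - 1) * commonZeroCount A ≤
      ((∑ b : Fin r → F, (zeroDev (pencil A b)).natAbs : ℕ) : ℤ) := by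
    rw [← h2]
    push_cast
    exact Finset.sum_le_sum fun b _ => le_abs_self _
  have h4 : q ^ r * (q - 1) * commonZeroCount A ≤
      ∑ b : Fin r → F, (zeroDev (pencil A b)).natAbs := by
    zify [hF.le]
    push_cast at h3
    exact h3
  have h5 : strataConst 0 (r + 0 - (c - 1) / 2) ≤ strataConst 0 (r - 1) :=
    strataConst_mono 0 (by lia)
  rw [pow_zero, mul_one, ← hq] at h1
  have h6 : (q - 1) * (q ^ r * commonZeroCount A) ≤
      (q - 1) * (strataConst 0 (r - 1) * q ^ (Module.finrank F V + (c - 1) / 2)) := by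
    calc (q - 1) * (q ^ r * commonZeroCount A) = q ^ r * (q - 1) * commonZeroCount A := by ring
      _ ≤ _ := h4.trans h1
      _ ≤ strataConst 0 (r - 1) * ((q - 1) * q ^ (Module.finrank F V + (c - 1) / 2)) :=
        Nat.mul_le_mul_right _ h5
      _ = _ := by ring
  have h7 := Nat.le_of_mul_le_mul_left h6 (by lia)
  calc q ^ r * commonZeroCount A * q ^ (c / 2 + 1)
      ≤ strataConst 0 (r - 1) * q ^ (Module.finrank F V + (c - 1) / 2) * q ^ (c / 2 + 1) :=
        Nat.mul_le_mul_right _ h7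
    _ = strataConst 0 (r - 1) * q ^ (Module.finrank F V + (c - 1) / 2 + (c / 2 + 1)) := by
        rw [pow_add q (_ + _)]; ring
    _ = _ := by rw [show Module.finrank F V + (c - 1) / 2 + (c / 2 + 1) =
      Module.finrank F V + c by lia]

/-- Lower bound for the number of zeros of a stable system. The zero form contributes the main term
`(q - 1) q ^ n`. -/
theorem le_commonZeroCount [Finite F] [FiniteDimensional F V] {A : Fin r → BilinForm F V}
    (hA : StablePencil A 0) (hF : 1 < Nat.card F) :
    (Nat.card F : ℤ) ^ Module.finrank F V * (Nat.card F - strataConst 2 (r + 1)) ≤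
      (Nat.card F : ℤ) ^ (r + 1) * commonZeroCount A := by
  classical
  have := Fintype.ofFinite F
  set q := Nat.card F with hq
  have h1 := sum_natAbs_zeroDev_le A (Finset.univ.erase 0) 2 1 0 (by
    intro b hb e he hbq
    have hb0 : b ≠ 0 := (Finset.mem_erase.mp hb).1
    have hbT : b ∈ quadVanishing A (polarRad (pencil A b)) := fun w hw => hbq w hw
    have hT : quadVanishing A (polarRad (pencil A b)) ≠ ⊥ := by
      intro h
      rw [h, Submodule.mem_bot] at hbT
      exact hb0 hbT
    have h2 := hA _ _ hT (fun b' hb' x hx => hb' x hx)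
    have h3 := polarRank_add_finrank_polarRad (pencil A b)
    have h4 : 1 ≤ Module.finrank F (quadVanishing A (polarRad (pencil A b))) :=
      Submodule.one_le_finrank_iff.mpr hT
    exact ⟨by lia, by lia⟩)
  have h2 := sum_card_mul_zeroCount_sub A
  rw [← Finset.add_sum_erase _ _ (Finset.mem_univ (0 : Fin r → F))] at h2
  have h0 : zeroDev (pencil A 0) = (q - 1) * (q : ℤ) ^ Module.finrank F V := by
    have e1 : zeroCount (pencil A 0) = Nat.card V :=
      Nat.card_congr (Equiv.subtypeUnivEquiv fun x => by simp [pencil_apply])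
    rw [zeroDev, e1, Module.natCard_eq_pow_finrank (K := F) (V := V)]
    push_cast
    ring
  have h3 : -((∑ b ∈ Finset.univ.erase (0 : Fin r → F), (zeroDev (pencil A b)).natAbs : ℕ) : ℤ) ≤
      ∑ b ∈ Finset.univ.erase (0 : Fin r → F), zeroDev (pencil A b) := by
    push_cast
    rw [← Finset.sum_neg_distrib]
    exact Finset.sum_le_sum fun b _ => neg_abs_le _
  change zeroDev (pencil A 0) +
    ∑ b ∈ Finset.univ.erase (0 : Fin r → F), zeroDev (pencil A b) = _ at h2
  rw [h0] at h2
  rw [pow_one, add_zero, ← hq, Nat.sub_zero] at h1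
  zify [hF.le] at h1 hF
  set E := ∑ b ∈ Finset.univ.erase (0 : Fin r → F), zeroDev (pencil A b)
  push_cast at h1 h3
  set E' := ∑ b ∈ Finset.univ.erase (0 : Fin r → F), |zeroDev (pencil A b)|
  set n := Module.finrank F V
  have hq1 : (0 : ℤ) < q - 1 := by linarith
  refine le_of_mul_le_mul_left ?_ hq1
  calc ((q : ℤ) - 1) * (q ^ n * (q - strataConst 2 (r + 1)))
      = ((q - 1) * q ^ n) * q - strataConst 2 (r + 1) * ((q - 1) * q ^ n) := by ring
    _ ≤ ((q - 1) * q ^ n) * q - E' * q := by linarith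
    _ ≤ ((q - 1) * q ^ n) * q + E * q := by nlinarith
    _ = ((q - 1) * q ^ n + E) * q := by ring
    _ = _ := by rw [h2]; ring

/-- The vectors of the radical at `b` where all members of the tangent space at `b` vanish. Every
singular zero lies in one of these subspaces. -/
def singularSubspace (A : Fin r → BilinForm F V) (b : Fin r → F) : Submodule F V where
  carrier := {x | x ∈ polarRad (pencil A b) ∧
    ∀ a ∈ polarVanishing A (polarRad (pencil A b)), pencil A a x x = 0}
  zero_mem' := ⟨zero_mem _, by simp⟩
  add_mem' := fun {x y} hx hy => ⟨add_mem hx.1 hy.1, fun a ha => by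
    rw [quad_add, hx.2 a ha, hy.2 a ha, ha x hx.1 y hy.1, add_zero, add_zero]⟩
  smul_mem' := fun c x hx => ⟨Submodule.smul_mem _ _ hx.1, fun a ha => by
    rw [quad_smul, hx.2 a ha, mul_zero]⟩

theorem two_mul_finrank_polarVanishing_lt [FiniteDimensional F V] {A : Fin r → BilinForm F V}
    (hA : StablePencil A 0) (b : Fin r → F) (hb : b ≠ 0) :
    2 * Module.finrank F (polarVanishing A (polarRad (pencil A b))) <
      Module.finrank F V - Module.finrank F (singularSubspace A b) ∧
    1 ≤ Module.finrank F (polarVanishing A (polarRad (pencil A b))) := by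
  have hT : polarVanishing A (polarRad (pencil A b)) ≠ ⊥ := by
    intro h
    have hbT : b ∈ polarVanishing A (polarRad (pencil A b)) :=
      fun w hw v _ => mem_polarRad.mp hw v
    rw [h, Submodule.mem_bot] at hbT
    exact hb hbT
  have h1 := hA _ (singularSubspace A b) hT (fun a ha x hx => hx.2 a ha)
  exact ⟨by lia, Submodule.one_le_finrank_iff.mpr hT⟩

/-- Estimate of the number of pairs of a singular zero and a form of the pencil exhibiting the
singularity. -/
theorem sum_commonZeroCount_singularSubspace_le [Fintype F] [DecidableEq F] [FiniteDimensional F V]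
    {A : Fin r → BilinForm F V} (hA : StablePencil A 0) (hF : 1 < Nat.card F) :
    (∑ b ∈ Finset.univ.erase (0 : Fin r → F),
      commonZeroCount fun i => (A i).restrict (singularSubspace A b)) * Nat.card F ^ (r + 1) ≤
      singularConst r * (strataConst 0 (r - 1) * Nat.card F ^ Module.finrank F V) := by
  classical
  set q := Nat.card F with hq
  set n := Module.finrank F V with hn
  rw [Finset.sum_mul, singularConst, Finset.sum_sigma']
  let codim : (Fin r → F) → ℕ := fun b => n - Module.finrank F (singularSubspace A b)
  let M := strataConst 0 (r - 1) * q ^ n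
  have hbound : ∀ b ≠ 0, (commonZeroCount fun i => (A i).restrict (singularSubspace A b)) * q ^ r *
      q ^ (codim b / 2 + 1) ≤ M := by
    intro b hb
    have h1 := two_mul_finrank_polarVanishing_lt hA b hb
    have h2 := commonZeroCount_le (hA.restrict (singularSubspace A b)) (by lia) hF
    have h3 := Submodule.finrank_le (singularSubspace A b)
    rw [Nat.add_sub_cancel' h3] at h2
    rw [mul_comm (commonZeroCount _)]
    exact h2
  refine sum_le_of_fiberwise _ (fun b => (⟨codim b, polarRank (pencil A b)⟩ : Σ _ : ℕ, ℕ))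
    ((Finset.Icc 3 (2 * r)).sigma fun c => Finset.range (c + 1)) _
    (fun x => (x.2 + 1) ^ (r - (x.1 - 1) / 2)) (q ^ r) M ?_ ?_ ?_
  · refine (Finset.card_le_univ _).trans (le_of_eq ?_)
    rw [← Nat.card_eq_fintype_card, Nat.card_fun, Nat.card_fin]
  · rintro ⟨c, m⟩ hcm b hb hbcm
    simp only [Finset.mem_sigma, Finset.mem_Icc, Finset.mem_range] at hcm
    have hb0 : b ≠ 0 := (Finset.mem_erase.mp hb).1
    have hcard := card_polarRank_stratum_le A ((Finset.univ.erase (0 : Fin r → F)).filter fun b =>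
      (⟨codim b, polarRank (pencil A b)⟩ : Σ _ : ℕ, ℕ) = ⟨c, m⟩) m ((c - 1) / 2) (by lia) (by
        intro ξ hξ
        obtain ⟨hξ1, hξ2⟩ := Finset.mem_filter.mp hξ
        have h1 := two_mul_finrank_polarVanishing_lt hA ξ (Finset.mem_erase.mp hξ1).1
        obtain ⟨h2, h3⟩ := Sigma.mk.inj_iff.mp hξ2
        have h3' := eq_of_heq h3
        simp only [codim] at h2
        exact ⟨h3', by lia⟩)
    have h2 : codim b = c := congrArg Sigma.fst hbcm
    have hbd := hbound b hb0
    rw [h2] at hbd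
    set k := (Finset.filter (fun b => (⟨codim b, polarRank (pencil A b)⟩ : Σ _ : ℕ, ℕ) = ⟨c, m⟩)
      (Finset.univ.erase (0 : Fin r → F))).card
    set z := commonZeroCount fun i => (A i).restrict (singularSubspace A b)
    have hq1 : 1 ≤ q := hF.le
    calc k * (z * q ^ (r + 1)) ≤ ((m + 1) ^ (r - (c - 1) / 2) * q ^ ((c - 1) / 2)) *
          (z * q ^ (r + 1)) := Nat.mul_le_mul_right _ hcard
      _ = (m + 1) ^ (r - (c - 1) / 2) * (z * q ^ r * q ^ ((c - 1) / 2 + 1)) := by ring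
      _ ≤ (m + 1) ^ (r - (c - 1) / 2) * (z * q ^ r * q ^ (c / 2 + 1)) := by
          gcongr
          lia
      _ ≤ (m + 1) ^ (r - (c - 1) / 2) * M := Nat.mul_le_mul_left _ hbd
  · intro b hb hbJ
    have hb0 : b ≠ 0 := (Finset.mem_erase.mp hb).1
    have h1 := two_mul_finrank_polarVanishing_lt hA b hb0
    have h4 : polarRank (pencil A b) ≤ codim b := by
      have h5 : singularSubspace A b ≤ polarRad (pencil A b) := fun x hx => hx.1
      have h6 := Submodule.finrank_mono h5
      have h7 := polarRank_add_finrank_polarRad (pencil A b)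
      simp only [codim]
      lia
    have h8 : r + 1 ≤ codim b / 2 + 1 := by
      simp only [Finset.mem_sigma, Finset.mem_Icc, Finset.mem_range] at hbJ
      have h9 : 3 ≤ codim b := by simp only [codim]; lia
      lia
    have hbd := hbound b hb0
    set z := commonZeroCount fun i => (A i).restrict (singularSubspace A b)
    calc q ^ r * (z * q ^ (r + 1)) = z * q ^ r * q ^ (r + 1) := by ring
      _ ≤ z * q ^ r * q ^ (codim b / 2 + 1) :=
        Nat.mul_le_mul_left _ (Nat.pow_le_pow_right hF.le h8)
      _ ≤ M := hbd

/-- A stable system of `r` quadratic forms over a finite field with more than `(2 * r) ^ r`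
elements has a nonsingular common zero. -/
theorem exists_nonsingular_zero [Finite F] [FiniteDimensional F V] (hr : 0 < r)
    {A : Fin r → BilinForm F V} (hA : StablePencil A 0) (hF : (2 * r) ^ r < Nat.card F) :
    ∃ x : V, (∀ i, A i x x = 0) ∧ ∀ b ≠ 0, x ∉ polarRad (pencil A b) := by
  classical
  have := Fintype.ofFinite F
  have := Module.finite_of_finite F (M := V)
  have := Fintype.ofFinite V
  have hF1 : 1 < Nat.card F := Finite.one_lt_card
  by_contra! hsing
  -- each singular zero is counted for all nonzero multiples of a form
  have h1 : (Nat.card F - 1) * commonZeroCount A ≤ ∑ b ∈ Finset.univ.erase (0 : Fin r → F),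
      commonZeroCount fun i => (A i).restrict (singularSubspace A b) := by
    have e1 : ∀ b, (commonZeroCount fun i => (A i).restrict (singularSubspace A b)) =
        ∑ x : V, if (∀ i, A i x x = 0) ∧ x ∈ polarRad (pencil A b) then 1 else 0 := by
      intro b
      rw [Finset.sum_boole, Nat.cast_id, ← Fintype.card_subtype, ← Nat.card_eq_fintype_card]
      refine Nat.card_congr
        { toFun := fun x => ⟨x.1.1, x.2, x.1.2.1⟩
          invFun := fun x => ⟨⟨x.1, x.2.2, fun a _ => by
            simp [pencil_apply, x.2.1]⟩, x.2.1⟩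
          left_inv := fun x => rfl
          right_inv := fun x => rfl }
    have e2 : commonZeroCount A = ∑ x : V, if (∀ i, A i x x = 0) then 1 else 0 := by
      rw [Finset.sum_boole, Nat.cast_id, ← Fintype.card_subtype, ← Nat.card_eq_fintype_card]
      rfl
    simp only [e1]
    rw [Finset.sum_comm, e2, Finset.mul_sum]
    refine Finset.sum_le_sum fun x _ => ?_
    by_cases hx : ∀ i, A i x x = 0
    · obtain ⟨b, hb, hxb⟩ := hsing x hx
      rw [if_pos hx, mul_one, Finset.sum_boole, Nat.cast_id]
      have e3 : Nat.card F - 1 = ((Finset.univ.erase (0 : F)).image fun c => c • b).card := by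
        rw [Finset.card_image_of_injective _ (smul_left_injective F hb), Finset.card_erase_of_mem
          (Finset.mem_univ _), Finset.card_univ, Nat.card_eq_fintype_card]
      rw [e3]
      refine Finset.card_le_card fun b' hb' => ?_
      obtain ⟨c, hc, rfl⟩ := Finset.mem_image.mp hb'
      have hc0 : c ≠ 0 := (Finset.mem_erase.mp hc).1
      refine Finset.mem_filter.mpr ⟨Finset.mem_erase.mpr ⟨smul_ne_zero hc0 hb, Finset.mem_univ _⟩,
        hx, mem_polarRad.mpr fun y => ?_⟩
      have := mem_polarRad.mp hxb y
      rw [polarForm_pencil_apply] at this ⊢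
      simp only [Pi.smul_apply, smul_eq_mul, mul_assoc, ← Finset.mul_sum, this, mul_zero]
    · rw [if_neg hx, mul_zero]
      exact Nat.zero_le _
  have h2 := sum_commonZeroCount_singularSubspace_le hA hF1
  have h3 := le_commonZeroCount hA hF1
  have h4 := singularConst_mul_strataConst_lt r (Nat.card F) hr hF
  have h5 := (Nat.mul_le_mul_right (Nat.card F ^ (r + 1)) h1).trans h2
  zify [hF1.le] at h5 hF1
  set q : ℤ := (Nat.card F : ℤ)
  set n := Module.finrank F V
  have hqn : 0 < q ^ n := by positivity
  have h6 : (q - 1) * (q ^ n * (q - strataConst 2 (r + 1))) ≤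
      (q - 1) * (q ^ (r + 1) * commonZeroCount A) :=
    mul_le_mul_of_nonneg_left h3 (by linarith)
  have h7 : q ^ n * ((q - 1) * (q - strataConst 2 (r + 1))) ≤
      q ^ n * (singularConst r * strataConst 0 (r - 1)) := by linarith
  exact absurd (le_of_mul_le_mul_left h7 hqn) (not_le.mpr h4)

end FiniteFieldZeros

/-! ### Lattices over a discrete valuation ring -/

section Lattices

open Matrix

variable {O K : Type*} [CommRing O] [Field K] [Algebra O K] {π : O}

/-- The element `z` of `K` is a unit of `O` times `π ^ k`. For a uniformizer `π` this says that
`z` is nonzero of valuation `k`. -/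
def HasVal (π : O) (z : K) (k : ℤ) : Prop := ∃ u : Oˣ, z = algebraMap O K u * algebraMap O K π ^ k

theorem hasVal_unit {u : O} (hu : IsUnit u) : HasVal π (algebraMap O K u) 0 := by
  obtain ⟨v, rfl⟩ := hu
  exact ⟨v, by simp⟩

theorem hasVal_zpow (k : ℤ) : HasVal π (algebraMap O K π ^ k) k := ⟨1, by simp⟩

/-- The embedding of `O ^ n` in `K ^ n`. -/
def latticeEmb (K : Type*) [Field K] [Algebra O K] {n : ℕ} (x : Fin n → O) : Fin n → K :=
  fun i => algebraMap O K (x i)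

theorem map_mulVec_latticeEmb {m n : ℕ} (P : Matrix (Fin m) (Fin n) O) (x : Fin n → O) :
    P.map (algebraMap O K) *ᵥ latticeEmb K x = latticeEmb K (P *ᵥ x) := by
  funext i
  exact (RingHom.map_mulVec (algebraMap O K) P x i).symm

theorem det_map_algebraMap {n : ℕ} (P : Matrix (Fin n) (Fin n) O) :
    (P.map (algebraMap O K)).det = algebraMap O K P.det :=
  (RingHom.map_det (algebraMap O K) P).symm

theorem isUnit_det_inv_mul {n : ℕ} (P : Matrix (Fin n) (Fin n) O) (hP : IsUnit P.det) :
    P * P⁻¹ = 1 ∧ P⁻¹ * P = 1 ∧ IsUnit P⁻¹.det :=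
  ⟨Matrix.mul_nonsing_inv P hP, Matrix.nonsing_inv_mul P hP, Matrix.isUnit_nonsing_inv_det P hP⟩

variable [IsFractionRing O K]

theorem algebraMap_irreducible_ne_zero (hπ : Irreducible π) : algebraMap O K π ≠ 0 := by
  rw [Ne, FaithfulSMul.algebraMap_eq_zero_iff]
  exact hπ.ne_zero

theorem HasVal.mul (hπ : Irreducible π) {z w : K} {k l : ℤ} (hz : HasVal π z k)
    (hw : HasVal π w l) : HasVal π (z * w) (k + l) := by
  obtain ⟨u, rfl⟩ := hz
  obtain ⟨v, rfl⟩ := hw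
  refine ⟨u * v, ?_⟩
  rw [zpow_add₀ (algebraMap_irreducible_ne_zero hπ), Units.val_mul, map_mul]
  ring

theorem hasVal_prod_zpow (hπ : Irreducible π) {ι : Type*} (s : Finset ι) (f : ι → ℤ) :
    HasVal π (∏ i ∈ s, algebraMap O K π ^ f i) (∑ i ∈ s, f i) := by
  classical
  induction s using Finset.induction_on with
  | empty => simpa using hasVal_zpow (K := K) (π := π) 0
  | insert i s hi ih =>
    rw [Finset.prod_insert hi, Finset.sum_insert hi]
    exact (hasVal_zpow _).mul hπ ih

/-- A unit times a negative power of the uniformizer is not integral. -/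
theorem HasVal.nonneg (hπ : Irreducible π) {a : O} {k : ℤ} (h : HasVal π (algebraMap O K a) k) :
    0 ≤ k := by
  obtain ⟨u, hu⟩ := h
  by_contra! hk
  obtain ⟨m, hm⟩ : ∃ m : ℕ, k = -(m + 1 : ℕ) := ⟨(-k - 1).toNat, by lia⟩
  have h1 := algebraMap_irreducible_ne_zero (K := K) hπ
  rw [hm, _root_.zpow_neg, zpow_natCast, eq_mul_inv_iff_mul_eq₀ (pow_ne_zero _ h1), ← map_pow,
    ← map_mul] at hu
  have h2 := IsFractionRing.injective O K hu
  apply hπ.not_isUnit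
  apply isUnit_of_dvd_unit _ u.isUnit
  rw [← h2, pow_succ]
  exact Dvd.intro_left (a * π ^ m) (by ring)

variable [IsDomain O]

theorem algebraMap_unit_ne_zero (u : Oˣ) : algebraMap O K u ≠ 0 := by
  rw [Ne, FaithfulSMul.algebraMap_eq_zero_iff]
  exact u.ne_zero

theorem HasVal.ne_zero (hπ : Irreducible π) {z : K} {k : ℤ} (h : HasVal π z k) : z ≠ 0 := by
  obtain ⟨u, rfl⟩ := h
  exact mul_ne_zero (algebraMap_unit_ne_zero u) (zpow_ne_zero _ (algebraMap_irreducible_ne_zero hπ))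

theorem HasVal.unique (hπ : Irreducible π) {z : K} {k l : ℤ} (hk : HasVal π z k)
    (hl : HasVal π z l) : k = l := by
  have h1 := algebraMap_irreducible_ne_zero (K := K) hπ
  have key : ∀ {k l : ℤ}, HasVal π z k → HasVal π z l → l ≤ k := by
    rintro k l ⟨u, rfl⟩ ⟨v, hv⟩
    have h2 : HasVal π (algebraMap O K (v * u⁻¹ : Oˣ)) (k - l) := by
      refine ⟨1, ?_⟩
      have h3 := algebraMap_unit_ne_zero (K := K) u
      have h4 : algebraMap O K u * algebraMap O K (u⁻¹ : Oˣ) = 1 := by rw [← map_mul]; simp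
      rw [zpow_sub₀ h1, Units.val_one, map_one, one_mul, Units.val_mul, map_mul,
        eq_div_iff (zpow_ne_zero _ h1)]
      linear_combination (-(algebraMap O K (u⁻¹ : Oˣ))) * hv + algebraMap O K π ^ k * h4
    have := h2.nonneg hπ
    lia
  exact le_antisymm (key hl hk) (key hk hl)

variable [IsDiscreteValuationRing O]

theorem exists_hasVal (hπ : Irreducible π) {z : K} (hz : z ≠ 0) : ∃ k, HasVal π z k := by
  obtain ⟨a, b, hb, rfl⟩ := IsFractionRing.div_surjective (A := O) z
  have hb0 : b ≠ 0 := nonZeroDivisors.ne_zero hb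
  have ha0 : a ≠ 0 := by rintro rfl; simp at hz
  obtain ⟨m, u, rfl⟩ := IsDiscreteValuationRing.eq_unit_mul_pow_irreducible ha0 hπ
  obtain ⟨l, v, rfl⟩ := IsDiscreteValuationRing.eq_unit_mul_pow_irreducible hb0 hπ
  refine ⟨m - l, u * v⁻¹, ?_⟩
  have h1 := algebraMap_irreducible_ne_zero (K := K) hπ
  have h2 := algebraMap_unit_ne_zero (K := K) v
  have h3 : algebraMap O K v * algebraMap O K (v⁻¹ : Oˣ) = 1 := by rw [← map_mul]; simp
  rw [zpow_sub₀ h1, zpow_natCast, zpow_natCast, Units.val_mul]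
  simp only [map_mul, map_pow]
  field_simp
  exact h3.symm

/-- Smith normal form of an integral matrix with nonzero determinant. -/
theorem exists_smith_integral {n : ℕ} (M : Matrix (Fin n) (Fin n) O) (hM : M.det ≠ 0) :
    ∃ (P R : Matrix (Fin n) (Fin n) O) (a : Fin n → O), IsUnit P.det ∧ IsUnit R.det ∧
      M = P * diagonal a * R := by
  have hinj : Function.Injective M.mulVecLin := by
    rw [← LinearMap.ker_eq_bot, LinearMap.ker_eq_bot']
    intro x hx
    exact Matrix.eq_zero_of_mulVec_eq_zero hM hx
  let e : (Fin n → O) ≃ₗ[O] LinearMap.range M.mulVecLin := LinearEquiv.ofInjective _ hinj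
  let c : Module.Basis (Fin n) O (LinearMap.range M.mulVecLin) := (Pi.basisFun O (Fin n)).map e
  have hrank : Module.finrank O (LinearMap.range M.mulVecLin) = Module.finrank O (Fin n → O) :=
    (LinearEquiv.finrank_eq e).symm
  obtain ⟨b, a, ab, hab⟩ :=
    Submodule.exists_smith_normal_form_of_rank_eq (Pi.basisFun O (Fin n)) hrank
  refine ⟨(Pi.basisFun O (Fin n)).toMatrix b, ab.toMatrix c, a, ?_, ?_, ?_⟩
  · exact isUnit_det_of_right_inverse
      (Module.Basis.toMatrix_mul_toMatrix_flip (Pi.basisFun O (Fin n)) b)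
  · exact isUnit_det_of_right_inverse (Module.Basis.toMatrix_mul_toMatrix_flip ab c)
  · ext i j
    have h1 : (c j : Fin n → O) = ∑ k, ab.toMatrix c k j • (a k • b k) := by
      have h2 := ab.sum_repr (c j)
      have h3 := congrArg (LinearMap.range M.mulVecLin).subtype h2
      rw [map_sum] at h3
      rw [← Submodule.subtype_apply, ← h3]
      refine Finset.sum_congr rfl fun k _ => ?_
      rw [map_smul, Submodule.subtype_apply, hab]
      rfl
    have h4 : (c j : Fin n → O) i = M i j := by
      simp [c, e]
    rw [← h4, h1, Matrix.mul_apply, Finset.sum_apply]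
    refine Finset.sum_congr rfl fun k _ => ?_
    rw [Matrix.mul_diagonal, Module.Basis.toMatrix_apply (Pi.basisFun O (Fin n))]
    simp only [Pi.smul_apply, smul_eq_mul, Pi.basisFun_repr]
    ring

/-- Smith normal form over the fraction field of a discrete valuation ring: an invertible matrix is
a diagonal matrix of powers of the uniformizer, up to invertible integral matrices. -/
theorem exists_smith (hπ : Irreducible π) {n : ℕ} (g : Matrix (Fin n) (Fin n) K) (hg : g.det ≠ 0) :
    ∃ (P R : Matrix (Fin n) (Fin n) O) (α : Fin n → ℤ), IsUnit P.det ∧ IsUnit R.det ∧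
      g = P.map (algebraMap O K) * diagonal (fun i => algebraMap O K π ^ α i) *
        R.map (algebraMap O K) := by
  obtain ⟨b, hb⟩ := IsLocalization.exist_integer_multiples_of_finite (nonZeroDivisors O)
    fun x : Fin n × Fin n => g x.1 x.2
  choose M hM using fun i j => hb (i, j)
  have hb0 : algebraMap O K b ≠ 0 := by
    rw [Ne, FaithfulSMul.algebraMap_eq_zero_iff]
    exact nonZeroDivisors.ne_zero b.2
  have hMg : (Matrix.of M).map (algebraMap O K) = algebraMap O K b • g := by
    ext i j
    have := hM i j
    rw [Algebra.smul_def] at this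
    simpa using this
  have hdet : (Matrix.of M).det ≠ 0 := by
    intro h
    have h1 := det_map_algebraMap (K := K) (Matrix.of M)
    rw [h, map_zero, hMg, det_smul] at h1
    exact mul_ne_zero (pow_ne_zero _ hb0) hg h1
  obtain ⟨P, R, a, hP, hR, hPR⟩ := exists_smith_integral (Matrix.of M) hdet
  have ha : ∀ i, a i ≠ 0 := by
    intro i hi
    apply hdet
    rw [hPR, det_mul, det_mul, det_diagonal, Finset.prod_eq_zero (Finset.mem_univ i) hi]
    simp
  have hval : ∀ i, ∃ k, HasVal π (algebraMap O K (a i) / algebraMap O K b) k := fun i =>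
    exists_hasVal hπ (div_ne_zero (by rw [Ne, FaithfulSMul.algebraMap_eq_zero_iff]; exact ha i) hb0)
  choose α u hu using hval
  refine ⟨P * diagonal (fun i => (u i : O)), R, α, ?_, hR, ?_⟩
  · rw [det_mul, det_diagonal]
    exact hP.mul (by
      rw [← Units.coe_prod]
      exact Units.isUnit _)
  · have h1 : g = (algebraMap O K b)⁻¹ • (Matrix.of M).map (algebraMap O K) := by
      rw [hMg, smul_smul, inv_mul_cancel₀ hb0, one_smul]
    have h2 : (P * diagonal (fun i => (u i : O))).map (algebraMap O K) *
        diagonal (fun i => algebraMap O K π ^ α i) = P.map (algebraMap O K) *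
        ((algebraMap O K b)⁻¹ • diagonal (fun i => algebraMap O K (a i))) := by
      rw [Matrix.map_mul, Matrix.mul_assoc, diagonal_map (map_zero _), diagonal_mul_diagonal]
      congr 1
      rw [← diagonal_smul]
      congr 1
      funext i
      rw [Pi.smul_apply, smul_eq_mul, inv_mul_eq_div, hu i]
    rw [h2, h1, hPR, Matrix.map_mul, Matrix.map_mul, diagonal_map (map_zero _)]
    simp

/-- Invertible matrices preserve primitive vectors. -/
theorem exists_isUnit_mulVec {n : ℕ} (P : Matrix (Fin n) (Fin n) O) (hP : IsUnit P.det)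
    (x : Fin n → O) (hx : ∃ i, IsUnit (x i)) : ∃ i, IsUnit ((P *ᵥ x) i) := by
  by_contra! h
  obtain ⟨i, hi⟩ := hx
  have h1 : x = P⁻¹ *ᵥ (P *ᵥ x) := by
    rw [Matrix.mulVec_mulVec, (isUnit_det_inv_mul P hP).2.1, Matrix.one_mulVec]
  have h2 : x i ∈ IsLocalRing.maximalIdeal O := by
    rw [h1]
    change ∑ j, P⁻¹ i j * (P *ᵥ x) j ∈ _
    exact sum_mem fun j _ => Ideal.mul_mem_left _ _ ((IsLocalRing.mem_maximalIdeal _).mpr (h j))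
  exact (IsLocalRing.mem_maximalIdeal _).mp h2 hi

/-- Every nonzero vector is proportional to a primitive vector. -/
theorem exists_primitive (hπ : Irreducible π) {n : ℕ} (x : Fin n → K) (hx : x ≠ 0) :
    ∃ (c : K) (y : Fin n → O), c ≠ 0 ∧ x = c • latticeEmb K y ∧ ∃ i, IsUnit (y i) := by
  classical
  have hval : ∀ i, ∃ k, x i ≠ 0 → HasVal π (x i) k := fun i => by
    by_cases h : x i = 0
    · exact ⟨0, fun h' => absurd h h'⟩
    · obtain ⟨k, hk⟩ := exists_hasVal hπ h
      exact ⟨k, fun _ => hk⟩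
  choose k hk using hval
  obtain ⟨i₀, hi₀⟩ := Function.ne_iff.mp hx
  obtain ⟨i, hi, hmin⟩ := Finset.exists_min_image (Finset.univ.filter fun i => x i ≠ 0) k
    ⟨i₀, Finset.mem_filter.mpr ⟨Finset.mem_univ _, hi₀⟩⟩
  have hi' := (Finset.mem_filter.mp hi).2
  have hπ0 := algebraMap_irreducible_ne_zero (K := K) hπ
  have hy : ∀ j, ∃ y : O, x j = algebraMap O K π ^ k i * algebraMap O K y ∧ (j = i → IsUnit y) := by
    intro j
    by_cases hj : x j = 0
    · exact ⟨0, by simp [hj], fun h => absurd (h ▸ hj) hi'⟩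
    · obtain ⟨u, hu⟩ := hk j hj
      have hle := hmin j (Finset.mem_filter.mpr ⟨Finset.mem_univ _, hj⟩)
      refine ⟨u * π ^ (k j - k i).toNat, ?_, ?_⟩
      · rw [hu, map_mul, map_pow, ← zpow_natCast, Int.toNat_of_nonneg (by lia), zpow_sub₀ hπ0]
        field_simp
      · rintro rfl
        simp
  choose y hy1 hy2 using hy
  refine ⟨algebraMap O K π ^ k i, y, zpow_ne_zero _ hπ0, ?_, i, hy2 i rfl⟩
  funext j
  rw [hy1 j]
  rfl

end Lattices

/-! ### Minimization of systems of quadratic forms -/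

section Minimization

open Matrix
open LinearMap (BilinForm)

section FracPow

variable {O : Type*} (K : Type*) [CommRing O] [Field K] [Algebra O K]

/-- The fractional ideal generated by `π ^ k`. -/
def fracPow (π : O) (k : ℤ) : Submodule O K := Submodule.span O {algebraMap O K π ^ k}

variable {K} {π : O}

theorem mem_fracPow {k : ℤ} {z : K} :
    z ∈ fracPow K π k ↔ ∃ y : O, z = algebraMap O K y * algebraMap O K π ^ k := by
  rw [fracPow, Submodule.mem_span_singleton]
  simp only [Algebra.smul_def, eq_comm]

theorem mem_fracPow_zero {z : K} : z ∈ fracPow K π 0 ↔ ∃ y : O, z = algebraMap O K y := by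
  simp [mem_fracPow]

theorem algebraMap_mem_fracPow_zero (y : O) : algebraMap O K y ∈ fracPow K π 0 :=
  mem_fracPow_zero.mpr ⟨y, rfl⟩

theorem zpow_mem_fracPow (k : ℤ) : algebraMap O K π ^ k ∈ fracPow K π k :=
  Submodule.subset_span rfl

theorem algebraMap_mul_mem_fracPow (y : O) {z : K} {k : ℤ} (hz : z ∈ fracPow K π k) :
    algebraMap O K y * z ∈ fracPow K π k := by
  rw [← Algebra.smul_def]
  exact Submodule.smul_mem _ _ hz

variable [IsFractionRing O K]

theorem mul_mem_fracPow (hπ : Irreducible π) {z w : K} {k l : ℤ} (hz : z ∈ fracPow K π k)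
    (hw : w ∈ fracPow K π l) : z * w ∈ fracPow K π (k + l) := by
  obtain ⟨a, rfl⟩ := mem_fracPow.mp hz
  obtain ⟨b, rfl⟩ := mem_fracPow.mp hw
  rw [mem_fracPow]
  refine ⟨a * b, ?_⟩
  rw [zpow_add₀ (algebraMap_irreducible_ne_zero hπ), map_mul]
  ring

theorem zpow_mul_mem_fracPow (hπ : Irreducible π) {z : K} {k l : ℤ} (hz : z ∈ fracPow K π k) :
    algebraMap O K π ^ l * z ∈ fracPow K π (l + k) :=
  mul_mem_fracPow hπ (zpow_mem_fracPow l) hz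

theorem fracPow_mono (hπ : Irreducible π) {k l : ℤ} (h : l ≤ k) :
    fracPow K π k ≤ fracPow K π l := by
  intro z hz
  obtain ⟨y, rfl⟩ := mem_fracPow.mp hz
  rw [mem_fracPow]
  refine ⟨y * π ^ (k - l).toNat, ?_⟩
  rw [map_mul, map_pow, ← zpow_natCast, Int.toNat_of_nonneg (by lia), mul_assoc,
    ← zpow_add₀ (algebraMap_irreducible_ne_zero hπ), sub_add_cancel]

end FracPow

section Action

variable {K : Type*} [Field K] {r n : ℕ}

/-- The system of quadratic forms obtained from `A` by the substitution `g` in the variables and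
the linear combinations `h` of the forms. -/
def actSystem (A : Fin r → BilinForm K (Fin n → K)) (h : Matrix (Fin r) (Fin r) K)
    (g : Matrix (Fin n) (Fin n) K) (i : Fin r) : BilinForm K (Fin n → K) :=
  ∑ j, h i j • (A j).compl₁₂ (Matrix.toLin' g) (Matrix.toLin' g)

theorem actSystem_apply (A : Fin r → BilinForm K (Fin n → K)) (h : Matrix (Fin r) (Fin r) K)
    (g : Matrix (Fin n) (Fin n) K) (i : Fin r) (x y : Fin n → K) :
    actSystem A h g i x y = ∑ j, h i j * A j (g *ᵥ x) (g *ᵥ y) := by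
  simp [actSystem, LinearMap.sum_apply]

theorem actSystem_apply_eq_mulVec (A : Fin r → BilinForm K (Fin n → K))
    (h : Matrix (Fin r) (Fin r) K) (g : Matrix (Fin n) (Fin n) K) (x y : Fin n → K) :
    (fun i => actSystem A h g i x y) = h *ᵥ fun j => A j (g *ᵥ x) (g *ᵥ y) := by
  funext i
  rw [actSystem_apply]
  rfl

theorem actSystem_actSystem (A : Fin r → BilinForm K (Fin n → K))
    (h h' : Matrix (Fin r) (Fin r) K) (g g' : Matrix (Fin n) (Fin n) K) :
    actSystem (actSystem A h g) h' g' = actSystem A (h' * h) (g * g') := by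
  have key : ∀ x y, (fun i => actSystem (actSystem A h g) h' g' i x y) =
      fun i => actSystem A (h' * h) (g * g') i x y := by
    intro x y
    rw [actSystem_apply_eq_mulVec, actSystem_apply_eq_mulVec, actSystem_apply_eq_mulVec,
      Matrix.mulVec_mulVec, Matrix.mulVec_mulVec, Matrix.mulVec_mulVec]
  funext i
  ext x y
  exact congrFun (key _ _) i

/-- The forms have no common zero other than the origin. -/
def IsAnisotropic {V : Type*} [AddCommGroup V] [Module K V] (A : Fin r → BilinForm K V) : Prop :=
  ∀ x, x ≠ 0 → ∃ i, A i x x ≠ 0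

theorem IsAnisotropic.actSystem {A : Fin r → BilinForm K (Fin n → K)} (hA : IsAnisotropic A)
    {h : Matrix (Fin r) (Fin r) K} {g : Matrix (Fin n) (Fin n) K} (hh : h.det ≠ 0)
    (hg : g.det ≠ 0) : IsAnisotropic (actSystem A h g) := by
  intro x hx
  by_contra! hc
  obtain ⟨i, hi⟩ := hA (g *ᵥ x) fun h0 => hx (Matrix.eq_zero_of_mulVec_eq_zero hg h0)
  have h1 : h *ᵥ (fun j => A j (g *ᵥ x) (g *ᵥ x)) = 0 := by
    rw [← actSystem_apply_eq_mulVec]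
    exact funext hc
  exact hi (congrFun (Matrix.eq_zero_of_mulVec_eq_zero hh h1) i)

/-- If systems of `s` forms in `4 s + 1` variables have common zeros, then `s` of the forms of a
system have one with support in a given set of `4 s + 1` coordinates. -/
theorem exists_zero_of_support {s : ℕ}
    (hs : ∀ B : Fin s → BilinForm K (Fin (4 * s + 1) → K), ¬ IsAnisotropic B)
    (A : Fin r → BilinForm K (Fin n → K)) (ι : Fin (4 * s + 1) → Fin n)
    (hι : Function.Injective ι) (κ : Fin s → Fin r) :
    ∃ x, x ≠ 0 ∧ (∀ k, x k ≠ 0 → k ∈ Set.range ι) ∧ ∀ j, A (κ j) x x = 0 := by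
  let E : (Fin (4 * s + 1) → K) →ₗ[K] (Fin n → K) := Function.ExtendByZero.linearMap K ι
  have hE : ∀ y, E y = Function.extend ι y 0 := fun y => rfl
  have h1 := hs fun j => (A (κ j)).compl₁₂ E E
  unfold IsAnisotropic at h1
  push Not at h1
  obtain ⟨y, hy, h2⟩ := h1
  refine ⟨E y, ?_, ?_, h2⟩
  · intro h0
    apply hy
    funext m
    have := congrFun h0 (ι m)
    rwa [hE, hι.extend_apply] at this
  · intro k hk
    by_contra hc
    apply hk
    rw [hE, Function.extend_apply' _ _ _ hc]
    rfl

end Action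

/-- Every fourth term of an antitone sequence, compared with all of its terms. -/
theorem sum_every_fourth_le (f : ℕ → ℤ) (hf : Antitone f) (r : ℕ) :
    (4 * r + 1) * ∑ j ∈ Finset.range r, f (4 * j + 4) ≤
      r * ∑ i ∈ Finset.range (4 * r + 1), f i := by
  have h1 : ∀ r : ℕ, f 0 + 4 * ∑ j ∈ Finset.range r, f (4 * j + 4) ≤
      ∑ i ∈ Finset.range (4 * r + 1), f i := by
    intro r
    induction r with
    | zero => simp
    | succ r ih =>
      rw [Finset.sum_range_succ, show 4 * (r + 1) + 1 = 4 * r + 1 + 1 + 1 + 1 + 1 by ring,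
        Finset.sum_range_succ, Finset.sum_range_succ, Finset.sum_range_succ,
        Finset.sum_range_succ]
      have := hf (show 4 * r + 1 ≤ 4 * r + 4 by lia)
      have := hf (show 4 * r + 1 + 1 ≤ 4 * r + 4 by lia)
      have := hf (show 4 * r + 1 + 1 + 1 ≤ 4 * r + 4 by lia)
      have := hf (show 4 * r + 1 + 1 + 1 + 1 ≤ 4 * r + 4 by lia)
      linarith
  have h2 : ∑ j ∈ Finset.range r, f (4 * j + 4) ≤ r * f 0 := by
    calc ∑ j ∈ Finset.range r, f (4 * j + 4) ≤ ∑ j ∈ Finset.range r, f 0 :=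
          Finset.sum_le_sum fun j _ => hf (Nat.zero_le _)
      _ = r * f 0 := by simp
  have h3 := mul_le_mul_of_nonneg_left (h1 r) (Int.natCast_nonneg r)
  linarith

/-- A tuple of integers can be put in decreasing order. -/
theorem exists_perm_antitone {n : ℕ} (α : Fin n → ℤ) :
    ∃ σ : Equiv.Perm (Fin n), Antitone (α ∘ σ) :=
  ⟨Tuple.sort fun i => -α i, fun _ _ hij =>
    neg_le_neg_iff.mp (Tuple.monotone_sort (fun i => -α i) hij)⟩

section Bound

variable {O K : Type*} [CommRing O] [Field K] [Algebra O K]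

/-- The values of an anisotropic system on primitive vectors are not all divisible by a high power
of the uniformizer. Over a complete discretely valued field with finite residue field this holds
for every anisotropic system by compactness. -/
def HasPrimitiveBound (K : Type*) [Field K] [Algebra O K] (π : O) : Prop :=
  ∀ (r n : ℕ) (A : Fin r → BilinForm K (Fin n → K)), IsAnisotropic A →
    ∃ N : ℕ, ∀ x : Fin n → O, (∃ i, IsUnit (x i)) →
      ∃ j, A j (latticeEmb K x) (latticeEmb K x) ∉ fracPow K π N

/-- The values of the forms on integral vectors are integral. -/
def IsIntegralSystem (π : O) {r n : ℕ} (A : Fin r → BilinForm K (Fin n → K)) : Prop :=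
  ∀ (x : Fin n → O) (i : Fin r), A i (latticeEmb K x) (latticeEmb K x) ∈ fracPow K π 0

variable {π : O}

theorem mulVec_mem_fracPow {m n : ℕ} (P : Matrix (Fin m) (Fin n) O) {x : Fin n → K} {k : ℤ}
    (hx : ∀ i, x i ∈ fracPow K π k) (i : Fin m) :
    (P.map (algebraMap O K) *ᵥ x) i ∈ fracPow K π k := by
  change ∑ j, algebraMap O K (P i j) * x j ∈ _
  exact sum_mem fun j _ => algebraMap_mul_mem_fracPow _ (hx j)

theorem map_inv_mulVec_mulVec {n : ℕ} {P : Matrix (Fin n) (Fin n) O} (hP : IsUnit P.det)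
    (x : Fin n → K) : P⁻¹.map (algebraMap O K) *ᵥ (P.map (algebraMap O K) *ᵥ x) = x := by
  rw [Matrix.mulVec_mulVec, ← Matrix.map_mul, (isUnit_det_inv_mul P hP).2.1,
    Matrix.map_one _ (map_zero _) (map_one _), Matrix.one_mulVec]

variable [IsFractionRing O K] [IsDomain O] [IsDiscreteValuationRing O]

/-- Comparison of the elementary divisors of the transformations that make an anisotropic system
integral, after ordering. A violation would make the last forms of the system vanish, by induction,
at a vector in the last coordinates where the first forms are highly divisible. -/
theorem le_of_diagonal_integral (hπ : Irreducible π) {r : ℕ}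
    (IH : ∀ s < r, ∀ B : Fin s → BilinForm K (Fin (4 * s + 1) → K), ¬ IsAnisotropic B)
    {A : Fin r → BilinForm K (Fin (4 * r + 1) → K)} {N : ℕ}
    (hN : ∀ x : Fin (4 * r + 1) → O, (∃ i, IsUnit (x i)) →
      ∃ j, A j (latticeEmb K x) (latticeEmb K x) ∉ fracPow K π N)
    {P : Matrix (Fin (4 * r + 1)) (Fin (4 * r + 1)) O} {L : Matrix (Fin r) (Fin r) O}
    (hP : IsUnit P.det) (hL : IsUnit L.det) {α : Fin (4 * r + 1) → ℤ} {β : Fin r → ℤ}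
    (hint : ∀ (x : Fin (4 * r + 1) → O) (i : Fin r),
      actSystem A (L.map (algebraMap O K)) (P.map (algebraMap O K)) i
        (fun k => algebraMap O K π ^ α k * algebraMap O K (x k))
        (fun k => algebraMap O K π ^ α k * algebraMap O K (x k)) ∈ fracPow K π (β i))
    {σ : Equiv.Perm (Fin (4 * r + 1))} (hσ : Antitone (α ∘ σ)) {τ : Equiv.Perm (Fin r)}
    (hτ : Antitone (β ∘ τ)) (j : Fin r) :
    β (τ j) ≤ 2 * α (σ ⟨4 * j + 4, by lia⟩) + N := by
  by_contra! hlt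
  set A' := actSystem A (L.map (algebraMap O K)) (P.map (algebraMap O K)) with hA'
  set a := α (σ ⟨4 * j + 4, by lia⟩) with ha
  obtain ⟨x, hx0, hxs, hxz⟩ := exists_zero_of_support (IH (r - 1 - j) (by lia)) A'
    (fun m => σ ⟨4 * j + 4 + m, by lia⟩)
    (fun m m' h => by
      have := congrArg Fin.val (σ.injective h)
      ext
      simpa using this)
    (fun i => τ ⟨j + 1 + i, by lia⟩)
  obtain ⟨c, y, hc, rfl, hy⟩ := exists_primitive hπ x hx0
  have hπ0 := algebraMap_irreducible_ne_zero (K := K) hπ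
  -- all the values of the transformed system at `y` are divisible by `π ^ N`
  have hval : ∀ i, A' i (latticeEmb K y) (latticeEmb K y) ∈ fracPow K π N := by
    intro i
    obtain ⟨i', rfl⟩ := τ.surjective i
    rcases lt_or_ge j i' with hji | hji
    · have h1 := hxz ⟨i' - (j + 1), by have := Fin.lt_def.mp hji; lia⟩
      rw [quad_smul] at h1
      have h2 : (⟨j + 1 + (i' - (j + 1)), by have := Fin.lt_def.mp hji; lia⟩ : Fin r) = i' := by
        ext
        have := Fin.lt_def.mp hji
        simp only
        lia
      simp only [h2] at h1
      rw [(mul_eq_zero.mp h1).resolve_left (pow_ne_zero _ hc)]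
      exact Submodule.zero_mem _
    · have hz : ∀ k, ∃ z : O, algebraMap O K π ^ α k * algebraMap O K z =
          algebraMap O K π ^ a * algebraMap O K (y k) := by
        intro k
        by_cases hk : y k = 0
        · exact ⟨0, by simp [hk]⟩
        · obtain ⟨m, rfl⟩ := hxs k (by
            have h3 : latticeEmb K y k ≠ 0 := by
              rw [latticeEmb, Ne, FaithfulSMul.algebraMap_eq_zero_iff]
              exact hk
            exact mul_ne_zero hc h3)
          have h4 : α (σ ⟨4 * j + 4 + m, by lia⟩) ≤ a := hσ (Fin.le_def.mpr (by simp))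
          refine ⟨π ^ (a - α (σ ⟨4 * j + 4 + m, by lia⟩)).toNat *
            y (σ ⟨4 * j + 4 + m, by lia⟩), ?_⟩
          rw [map_mul, map_pow, ← zpow_natCast, Int.toNat_of_nonneg (by lia), ← mul_assoc,
            ← zpow_add₀ hπ0, add_sub_cancel]
      choose z hz using hz
      have h5 := hint z (τ i')
      rw [show (fun k => algebraMap O K π ^ α k * algebraMap O K (z k)) =
        algebraMap O K π ^ a • latticeEmb K y from funext hz, quad_smul] at h5
      have h6 := zpow_mul_mem_fracPow hπ (l := -(2 * a)) h5
      have h8 : algebraMap O K π ^ (-(2 * a)) * (algebraMap O K π ^ a) ^ 2 = 1 := by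
        rw [← zpow_natCast, ← _root_.zpow_mul, ← zpow_add₀ hπ0]
        rw [show -(2 * a) + a * ((2 : ℕ) : ℤ) = 0 by push_cast; ring, zpow_zero]
      rw [← mul_assoc, h8, one_mul] at h6
      have h7 : β (τ j) ≤ β (τ i') := hτ hji
      exact fracPow_mono hπ (by lia) h6
  obtain ⟨i, hi⟩ := hN (P *ᵥ y) (exists_isUnit_mulVec P hP y hy)
  apply hi
  have h9 := actSystem_apply_eq_mulVec A (L.map (algebraMap O K)) (P.map (algebraMap O K))
    (latticeEmb K y) (latticeEmb K y)
  rw [map_mulVec_latticeEmb] at h9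
  have h10 := map_inv_mulVec_mulVec hL fun j =>
    A j (latticeEmb K (P *ᵥ y)) (latticeEmb K (P *ᵥ y))
  rw [← congrFun h10 i, ← h9]
  exact mulVec_mem_fracPow _ hval i

/-- Summation of the comparison of elementary divisors. -/
theorem sum_le_of_diagonal_integral (hπ : Irreducible π) {r : ℕ}
    (IH : ∀ s < r, ∀ B : Fin s → BilinForm K (Fin (4 * s + 1) → K), ¬ IsAnisotropic B)
    {A : Fin r → BilinForm K (Fin (4 * r + 1) → K)} {N : ℕ}
    (hN : ∀ x : Fin (4 * r + 1) → O, (∃ i, IsUnit (x i)) →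
      ∃ j, A j (latticeEmb K x) (latticeEmb K x) ∉ fracPow K π N)
    {P : Matrix (Fin (4 * r + 1)) (Fin (4 * r + 1)) O} {L : Matrix (Fin r) (Fin r) O}
    (hP : IsUnit P.det) (hL : IsUnit L.det) {α : Fin (4 * r + 1) → ℤ} {β : Fin r → ℤ}
    (hint : ∀ (x : Fin (4 * r + 1) → O) (i : Fin r),
      actSystem A (L.map (algebraMap O K)) (P.map (algebraMap O K)) i
        (fun k => algebraMap O K π ^ α k * algebraMap O K (x k))
        (fun k => algebraMap O K π ^ α k * algebraMap O K (x k)) ∈ fracPow K π (β i)) :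
    (4 * r + 1) * ∑ i, β i - 2 * r * ∑ k, α k ≤ (4 * r + 1) * (r * N) := by
  obtain ⟨σ, hσ⟩ := exists_perm_antitone α
  obtain ⟨τ, hτ⟩ := exists_perm_antitone β
  let f : ℕ → ℤ := fun i => α (σ ⟨min i (4 * r), by lia⟩)
  have hf : Antitone f := fun i j hij => hσ (Fin.le_def.mpr (min_le_min_right _ hij))
  have h1 := sum_every_fourth_le f hf r
  have h2 : ∑ i ∈ Finset.range (4 * r + 1), f i = ∑ k, α k := by
    rw [← Fin.sum_univ_eq_sum_range, ← Equiv.sum_comp σ α]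
    refine Finset.sum_congr rfl fun i _ => ?_
    simp only [f]
    congr 2
    ext
    lia
  have h3 : ∑ i, β i ≤ 2 * ∑ j ∈ Finset.range r, f (4 * j + 4) + r * N := by
    rw [← Fin.sum_univ_eq_sum_range (fun j => f (4 * j + 4)), ← Equiv.sum_comp τ β, Finset.mul_sum]
    calc ∑ j, β (τ j) ≤ ∑ j : Fin r, (2 * f (4 * j + 4) + N) := by
          refine Finset.sum_le_sum fun j _ => ?_
          have := le_of_diagonal_integral hπ IH hN hP hL hint hσ hτ j
          have h4 : f (4 * j + 4) = α (σ ⟨4 * j + 4, by lia⟩) := by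
            simp only [f]
            congr 2
            ext
            simp only
            lia
          rwa [h4]
      _ = _ := by simp [Finset.sum_add_distrib]
  have h4 := mul_le_mul_of_nonneg_left h3 (show (0 : ℤ) ≤ 4 * r + 1 by positivity)
  rw [h2] at h1
  linarith

end Bound

end Minimization

section MinimalSystem

open Matrix
open LinearMap (BilinForm)

variable {O K : Type*} [CommRing O] [Field K] [Algebra O K] {π : O}

/-- Every system becomes integral after multiplication of the forms by a common denominator. -/
theorem exists_isIntegralSystem_actSystem [IsFractionRing O K] [IsDomain O] {r n : ℕ}
    (A : Fin r → BilinForm K (Fin n → K)) :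
    ∃ h : Matrix (Fin r) (Fin r) K, h.det ≠ 0 ∧ IsIntegralSystem π (actSystem A h 1) := by
  obtain ⟨b, hb⟩ := IsLocalization.exist_integer_multiples_of_finite (nonZeroDivisors O)
    fun x : Fin r × Fin n × Fin n => BilinForm.toMatrix' (A x.1) x.2.1 x.2.2
  choose M hM using fun i k l => hb (i, k, l)
  have hb0 : algebraMap O K b ≠ 0 := by
    rw [Ne, FaithfulSMul.algebraMap_eq_zero_iff]
    exact nonZeroDivisors.ne_zero b.2
  refine ⟨algebraMap O K b • 1, ?_, ?_⟩
  · rw [det_smul, det_one, mul_one]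
    exact pow_ne_zero _ hb0
  · intro x i
    have h1 : actSystem A (algebraMap O K b • 1) 1 i (latticeEmb K x) (latticeEmb K x) =
        ∑ k, ∑ l, algebraMap O K (x k * M i k l * x l) := by
      rw [actSystem_apply]
      simp only [Matrix.smul_apply, Matrix.one_apply, smul_eq_mul, mul_ite, mul_one, mul_zero,
        ite_mul, zero_mul, Finset.sum_ite_eq, Finset.mem_univ, if_true, Matrix.one_mulVec]
      conv_lhs => rw [← Matrix.toBilin'_toMatrix' (A i), Matrix.toBilin'_apply]
      rw [Finset.mul_sum]
      refine Finset.sum_congr rfl fun k _ => ?_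
      rw [Finset.mul_sum]
      refine Finset.sum_congr rfl fun l _ => ?_
      have h2 := hM i k l
      rw [Algebra.smul_def] at h2
      rw [map_mul, map_mul, h2, latticeEmb, latticeEmb]
      ring
    rw [h1]
    exact sum_mem fun k _ => sum_mem fun l _ => algebraMap_mem_fracPow_zero _

variable [IsFractionRing O K] [IsDomain O] [IsDiscreteValuationRing O]

/-- The transformations that make an anisotropic system integral cannot gain more than a bounded
amount. -/
theorem sum_le_of_isIntegralSystem (hπ : Irreducible π) {r : ℕ}
    (IH : ∀ s < r, ∀ B : Fin s → BilinForm K (Fin (4 * s + 1) → K), ¬ IsAnisotropic B)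
    {A : Fin r → BilinForm K (Fin (4 * r + 1) → K)} {N : ℕ}
    (hN : ∀ x : Fin (4 * r + 1) → O, (∃ i, IsUnit (x i)) →
      ∃ j, A j (latticeEmb K x) (latticeEmb K x) ∉ fracPow K π N)
    {h : Matrix (Fin r) (Fin r) K} {g : Matrix (Fin (4 * r + 1)) (Fin (4 * r + 1)) K} {a b : ℤ}
    (hg : HasVal π g.det a) (hh : HasVal π h.det b) (hint : IsIntegralSystem π (actSystem A h g)) :
    -((4 * r + 1) * b) - 2 * r * a ≤ (4 * r + 1) * (r * N) := by
  obtain ⟨P, R, α, hP, hR, hg'⟩ := exists_smith hπ g (hg.ne_zero hπ)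
  obtain ⟨S, L, γ, hS, hL, hh'⟩ := exists_smith hπ h (hh.ne_zero hπ)
  have hval : ∀ {m : ℕ} {P R : Matrix (Fin m) (Fin m) O} {α : Fin m → ℤ}, IsUnit P.det →
      IsUnit R.det → HasVal π (P.map (algebraMap O K) *
        diagonal (fun i => algebraMap O K π ^ α i) * R.map (algebraMap O K)).det (∑ i, α i) := by
    intro m P R α hP hR
    rw [det_mul, det_mul, det_diagonal, det_map_algebraMap, det_map_algebraMap]
    have := ((hasVal_unit (K := K) (π := π) hP).mul hπ (hasVal_prod_zpow hπ Finset.univ α)).mul hπ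
      (hasVal_unit hR)
    simpa using this
  have ha : a = ∑ i, α i := hg.unique hπ (hg' ▸ hval hP hR)
  have hb : b = ∑ i, γ i := hh.unique hπ (hh' ▸ hval hS hL)
  have hπ0 := algebraMap_irreducible_ne_zero (K := K) hπ
  have key := sum_le_of_diagonal_integral hπ IH hN hP hL (α := α) (β := fun i => -γ i) (by
    intro x i
    set w : Fin (4 * r + 1) → K := fun k => algebraMap O K π ^ α k * algebraMap O K (x k) with hw
    have h1 : g *ᵥ latticeEmb K (R⁻¹ *ᵥ x) = P.map (algebraMap O K) *ᵥ w := by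
      rw [hg', ← Matrix.mulVec_mulVec, ← Matrix.mulVec_mulVec, map_mulVec_latticeEmb,
        Matrix.mulVec_mulVec x R R⁻¹, (isUnit_det_inv_mul R hR).1, Matrix.one_mulVec]
      congr 1
      funext k
      rw [Matrix.mulVec_diagonal]
      rfl
    have h2 := actSystem_apply_eq_mulVec A h g (latticeEmb K (R⁻¹ *ᵥ x)) (latticeEmb K (R⁻¹ *ᵥ x))
    have h3 := mulVec_mem_fracPow (S⁻¹) (hint (R⁻¹ *ᵥ x)) i
    rw [h2, h1, hh', ← Matrix.mulVec_mulVec, ← Matrix.mulVec_mulVec, map_inv_mulVec_mulVec hS,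
      Matrix.mulVec_diagonal, ← actSystem_apply_eq_mulVec] at h3
    have h4 := zpow_mul_mem_fracPow hπ (l := -γ i) h3
    rwa [← mul_assoc, ← zpow_add₀ hπ0, neg_add_cancel, zpow_zero, one_mul, add_zero] at h4)
  rw [Finset.sum_neg_distrib, ← ha, ← hb] at key
  linarith

/-- An anisotropic system is equivalent to an integral one that is minimal: no transformation of
determinants of valuations `a` (variables) and `b` (forms) with `(4 r + 1) b + 2 r a < 0`
preserves integrality. -/
theorem exists_minimal_system (hπ : Irreducible π) (hK : HasPrimitiveBound K π) {r : ℕ}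
    (IH : ∀ s < r, ∀ B : Fin s → BilinForm K (Fin (4 * s + 1) → K), ¬ IsAnisotropic B)
    {A : Fin r → BilinForm K (Fin (4 * r + 1) → K)} (hA : IsAnisotropic A) :
    ∃ A' : Fin r → BilinForm K (Fin (4 * r + 1) → K), IsAnisotropic A' ∧ IsIntegralSystem π A' ∧
      ∀ (h : Matrix (Fin r) (Fin r) K) (g : Matrix (Fin (4 * r + 1)) (Fin (4 * r + 1)) K) (a b : ℤ),
        HasVal π g.det a → HasVal π h.det b → IsIntegralSystem π (actSystem A' h g) →
        0 ≤ (4 * r + 1) * b + 2 * r * a := by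
  obtain ⟨N, hN⟩ := hK _ _ A hA
  obtain ⟨_, ⟨h, g, a, b, hg, hh, hint, rfl⟩, hmax⟩ := Int.exists_greatest_of_bdd
    (P := fun z => ∃ (h : Matrix (Fin r) (Fin r) K)
      (g : Matrix (Fin (4 * r + 1)) (Fin (4 * r + 1)) K) (a b : ℤ), HasVal π g.det a ∧
        HasVal π h.det b ∧ IsIntegralSystem π (actSystem A h g) ∧
        z = -((4 * r + 1) * b) - 2 * r * a)
    ⟨(4 * r + 1) * (r * N), by
      rintro _ ⟨h, g, a, b, hg, hh, hint, rfl⟩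
      exact sum_le_of_isIntegralSystem hπ IH hN hg hh hint⟩
    (by
      obtain ⟨h, hh, hint⟩ := exists_isIntegralSystem_actSystem (π := π) A
      obtain ⟨b, hb⟩ := exists_hasVal hπ hh
      exact ⟨_, h, 1, 0, b, by simpa using hasVal_zpow (K := K) (π := π) 0, hb, hint, rfl⟩)
  refine ⟨actSystem A h g, hA.actSystem (hh.ne_zero hπ) (hg.ne_zero hπ), hint, ?_⟩
  intro h' g' a' b' hg' hh' hint'
  rw [actSystem_actSystem] at hint'
  have := hmax _ ⟨h' * h, g * g', a + a', b' + b, by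
    rw [det_mul]; exact hg.mul hπ hg', by rw [det_mul]; exact hh'.mul hπ hh, hint', rfl⟩
  linarith

end MinimalSystem

/-! ### Reduction of integral systems modulo the maximal ideal -/

section Reduction

open Matrix
open LinearMap (BilinForm)

section IntegralForm

variable {O K : Type*} [CommRing O] [Field K] [Algebra O K]

theorem latticeEmb_add {n : ℕ} (x y : Fin n → O) :
    latticeEmb K (x + y) = latticeEmb K x + latticeEmb K y := funext fun _ => map_add _ _ _

theorem latticeEmb_smul {n : ℕ} (c : O) (x : Fin n → O) :
    latticeEmb K (c • x) = algebraMap O K c • latticeEmb K x := funext fun _ => map_mul _ _ _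

variable [IsFractionRing O K]

/-- A quadratic form that is integral on integral vectors is given by an integral bilinear form,
which need not be symmetric. -/
theorem exists_integral_bilinForm {n : ℕ} (A : BilinForm K (Fin n → K))
    (hA : ∀ x : Fin n → O, ∃ y : O, A (latticeEmb K x) (latticeEmb K x) = algebraMap O K y) :
    ∃ C : BilinForm O (Fin n → O), ∀ x,
      algebraMap O K (C x x) = A (latticeEmb K x) (latticeEmb K x) := by
  choose q hq using hA
  have hinj := IsFractionRing.injective O K
  have hpol : ∀ x y, algebraMap O K (QuadraticMap.polar q x y) =
      polarForm A (latticeEmb K x) (latticeEmb K y) := by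
    intro x y
    rw [QuadraticMap.polar, map_sub, map_sub, ← hq, ← hq, ← hq, latticeEmb_add, quad_add]
    ring
  let Q : QuadraticForm O (Fin n → O) := QuadraticMap.ofPolar q
    (fun a x => hinj (by
      rw [← hq, latticeEmb_smul, quad_smul, hq, smul_eq_mul, map_mul, map_mul]
      ring))
    (fun x x' y => hinj (by
      rw [map_add, hpol, hpol, hpol, latticeEmb_add, map_add, LinearMap.add_apply]))
    (fun a x y => hinj (by
      rw [hpol, latticeEmb_smul, smul_eq_mul, map_mul, hpol, map_smul, LinearMap.smul_apply,
        smul_eq_mul]))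
  obtain ⟨C, hC⟩ := LinearMap.BilinMap.toQuadraticMap_surjective Q
  refine ⟨C, fun x => ?_⟩
  rw [hq x]
  congr 1
  exact congrArg (fun Q => Q x) hC

end IntegralForm

variable {O : Type*} [CommRing O] [IsLocalRing O]

open IsLocalRing

/-- Reduction of integral vectors modulo the maximal ideal. -/
noncomputable def residueVec {n : ℕ} (x : Fin n → O) : Fin n → ResidueField O :=
  fun i => residue O (x i)

theorem residueVec_surjective {n : ℕ} : Function.Surjective (residueVec (O := O) (n := n)) := by
  intro y
  choose x hx using fun i => residue_surjective (y i)
  exact ⟨x, funext hx⟩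

/-- Reduction of an integral bilinear form modulo the maximal ideal. -/
noncomputable def reduceForm {n : ℕ} (C : BilinForm O (Fin n → O)) :
    BilinForm (ResidueField O) (Fin n → ResidueField O) :=
  Matrix.toBilin' ((BilinForm.toMatrix' C).map (residue O))

theorem reduceForm_apply {n : ℕ} (C : BilinForm O (Fin n → O)) (x y : Fin n → O) :
    reduceForm C (residueVec x) (residueVec y) = residue O (C x y) := by
  conv_rhs => rw [← Matrix.toBilin'_toMatrix' C]
  simp only [reduceForm, Matrix.toBilin'_apply, residueVec, map_sum, map_mul, Matrix.map_apply]

/-- Every subspace over the residue field is spanned by the reductions of part of an integral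
basis, the columns of `P`. -/
theorem exists_adapted_basis {n : ℕ}
    (W : Submodule (ResidueField O) (Fin n → ResidueField O)) :
    ∃ (P : Matrix (Fin n) (Fin n) O) (I : Finset (Fin n)), IsUnit P.det ∧
      I.card = Module.finrank (ResidueField O) W ∧
      ∀ y : Fin n → O, (∀ k ∉ I, residue O (y k) = 0) → residueVec (P *ᵥ y) ∈ W := by
  obtain ⟨W', hW⟩ := W.exists_isCompl
  let e := Submodule.prodEquivOfIsCompl W W' hW
  let b₀ := ((Module.finBasis (ResidueField O) W).prod (Module.finBasis (ResidueField O) W')).map e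
  have hcard : Fintype.card (Fin (Module.finrank (ResidueField O) W) ⊕
      Fin (Module.finrank (ResidueField O) W')) = Fintype.card (Fin n) := by
    rw [Fintype.card_fin, ← Module.finrank_eq_card_basis b₀, Module.finrank_fin_fun]
  let f := Fintype.equivOfCardEq hcard
  let b := b₀.reindex f
  choose P hP using fun i k => residue_surjective (R := O) (b k i)
  refine ⟨Matrix.of P, Finset.univ.map (Function.Embedding.inl.trans f.toEmbedding), ?_, ?_, ?_⟩
  · rw [← isUnit_map_iff (residue O), RingHom.map_det]
    have h1 : (residue O).mapMatrix (Matrix.of P) =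
        (Pi.basisFun (ResidueField O) (Fin n)).toMatrix b := by
      ext i k
      simp [hP, Module.Basis.toMatrix_apply]
    rw [h1]
    exact isUnit_det_of_right_inverse (Module.Basis.toMatrix_mul_toMatrix_flip _ b)
  · simp
  · intro y hy
    have h2 : residueVec (Matrix.of P *ᵥ y) = ∑ k, residue O (y k) • b k := by
      funext i
      simp [residueVec, Matrix.mulVec, dotProduct, hP, mul_comm]
    rw [h2]
    refine sum_mem fun k _ => ?_
    obtain ⟨s, rfl⟩ := f.surjective k
    rcases s with s | s
    · refine Submodule.smul_mem _ _ ?_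
      simp [b, b₀, e]
    · rw [hy, zero_smul]
      · exact Submodule.zero_mem _
      · simp

end Reduction

section Lifting

open Matrix IsLocalRing
open LinearMap (BilinForm)

variable {O : Type*} [CommRing O] {π : O}

/-- Hensel's lemma at a nonsingular zero of the reduction, to finite precision. -/
theorem exists_approx_zero {r n : ℕ} {C : Fin r → BilinForm O (Fin n → O)}
    {x₀ : Fin n → O} {v : Fin r → Fin n → O} (hx₀ : ∀ i, π ∣ C i x₀ x₀)
    (hv : ∀ i j, π ∣ polarForm (C i) x₀ (v j) - if i = j then 1 else 0) (k : ℕ) :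
    ∃ x : Fin n → O, (∀ l, π ∣ x l - x₀ l) ∧ ∀ i, π ^ (k + 1) ∣ C i x x := by
  induction k with
  | zero => exact ⟨x₀, by simp, by simpa using hx₀⟩
  | succ k ih =>
    obtain ⟨x, hx, hCx⟩ := ih
    choose y hy using hx
    choose q hq using hCx
    have hxx : x = x₀ + π • y := by
      funext l
      rw [Pi.add_apply, Pi.smul_apply, smul_eq_mul, ← hy l]
      ring
    set w : Fin n → O := ∑ j, q j • v j with hw
    refine ⟨x + (-π ^ (k + 1)) • w, fun l => ?_, fun i => ?_⟩
    · rw [Pi.add_apply, Pi.smul_apply, smul_eq_mul, add_sub_right_comm, hy l]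
      exact dvd_add (Dvd.intro _ rfl) (Dvd.intro (-π ^ k * w l) (by ring))
    · rw [quad_add_smul, hq i]
      have h1 : π ∣ polarForm (C i) x w - q i := by
        have h2 : q i = ∑ j, q j * if i = j then 1 else 0 := by simp
        rw [h2, hw, map_sum, ← Finset.sum_sub_distrib]
        refine Finset.dvd_sum fun j _ => ?_
        obtain ⟨c, hc⟩ := hv i j
        rw [map_smul, smul_eq_mul, ← mul_sub, hxx, map_add, LinearMap.add_apply, map_smul,
          LinearMap.smul_apply, smul_eq_mul]
        refine Dvd.intro (q j * (c + polarForm (C i) y (v j))) ?_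
        linear_combination (-q j) * hc
      obtain ⟨c, hc⟩ := h1
      refine Dvd.intro (-c + π ^ k * C i w w) ?_
      linear_combination (π ^ (k + 1)) * hc

variable [IsDomain O] [IsDiscreteValuationRing O]

theorem residue_eq_zero_iff_dvd (hπ : Irreducible π) {x : O} : residue O x = 0 ↔ π ∣ x := by
  rw [residue_eq_zero_iff, hπ.maximalIdeal_eq, Ideal.mem_span_singleton]

/-- The reduction of a minimal integral system satisfies the condition needed for the existence of
nonsingular zeros: if a `t`-dimensional space of forms in the reduction vanished on a subspace of
codimension at most `2 t`, the system could be shrunk by a substitution of determinant valuation at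
most `2 t`, after which `t` of the forms are divisible by the uniformizer. -/
theorem stablePencil_reduceForm {K : Type*} [Field K] [Algebra O K] [IsFractionRing O K]
    (hπ : Irreducible π) {r : ℕ} {A : Fin r → BilinForm K (Fin (4 * r + 1) → K)}
    (hmin : ∀ (h : Matrix (Fin r) (Fin r) K)
      (g : Matrix (Fin (4 * r + 1)) (Fin (4 * r + 1)) K) (a b : ℤ),
        HasVal π g.det a → HasVal π h.det b → IsIntegralSystem π (actSystem A h g) →
        0 ≤ (4 * r + 1) * b + 2 * r * a)
    {C : Fin r → BilinForm O (Fin (4 * r + 1) → O)}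
    (hC : ∀ i x, algebraMap O K (C i x x) = A i (latticeEmb K x) (latticeEmb K x)) :
    StablePencil (fun i => reduceForm (C i)) 0 := by
  intro T U hT hTU
  by_contra! hle
  obtain ⟨P, I, hP, hI, hPU⟩ := exists_adapted_basis U
  obtain ⟨S, J, hS, hJ, hST⟩ := exists_adapted_basis T
  have hπ0 := algebraMap_irreducible_ne_zero (K := K) hπ
  let d : Fin (4 * r + 1) → O := fun k => if k ∈ I then 1 else π
  let e : Fin r → ℤ := fun j => if j ∈ J then -1 else 0
  have hd : HasVal π (algebraMap O K (∏ k, d k)) ((4 * r + 1) - I.card : ℤ) := by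
    have h1 : ∀ k, algebraMap O K (d k) = algebraMap O K π ^ (if k ∈ I then (0 : ℤ) else 1) := by
      intro k
      by_cases hk : k ∈ I <;> simp [d, hk]
    rw [map_prod, Finset.prod_congr rfl fun k _ => h1 k]
    have h2 : ∀ k : Fin (4 * r + 1), (if k ∈ I then (0 : ℤ) else 1) = 1 - if k ∈ I then 1 else 0 :=
      fun k => by split_ifs <;> rfl
    have h3 : ∑ k : Fin (4 * r + 1), (if k ∈ I then (0 : ℤ) else 1) = 4 * r + 1 - I.card := by
      simp [h2]
    rw [← h3]
    exact hasVal_prod_zpow hπ _ _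
  have he : HasVal π (∏ j, algebraMap O K π ^ e j) (-(J.card : ℤ)) := by
    have h2 : ∀ j : Fin r, e j = -if j ∈ J then 1 else 0 := fun j => by
      simp only [e]
      split_ifs <;> rfl
    have h3 : ∑ j, e j = -(J.card : ℤ) := by simp [h2]
    rw [← h3]
    exact hasVal_prod_zpow hπ _ _
  have key := hmin (diagonal (fun j => algebraMap O K π ^ e j) * Sᵀ.map (algebraMap O K))
    ((P * diagonal d).map (algebraMap O K)) _ _
    (by
      rw [det_map_algebraMap, det_mul, det_diagonal, map_mul]
      exact (hasVal_unit hP).mul hπ hd)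
    (by
      rw [det_mul, det_diagonal, det_map_algebraMap, det_transpose]
      exact he.mul hπ (hasVal_unit hS))
    (by
      intro x j
      have h1 := congrFun (actSystem_apply_eq_mulVec A
        (diagonal (fun j => algebraMap O K π ^ e j) * Sᵀ.map (algebraMap O K))
        ((P * diagonal d).map (algebraMap O K)) (latticeEmb K x) (latticeEmb K x)) j
      rw [h1, map_mulVec_latticeEmb, ← Matrix.mulVec_mulVec, Matrix.mulVec_diagonal]
      set z := (P * diagonal d) *ᵥ x with hz
      have h2 : (Sᵀ.map (algebraMap O K) *ᵥ fun i => A i (latticeEmb K z) (latticeEmb K z)) j =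
          algebraMap O K (∑ i, S i j * C i z z) := by
        simp only [Matrix.mulVec, dotProduct, map_sum, map_mul, hC, Matrix.map_apply,
          Matrix.transpose_apply]
      rw [h2]
      by_cases hj : j ∈ J
      · have hzU : residueVec z ∈ U := by
          rw [hz, ← Matrix.mulVec_mulVec]
          refine hPU _ fun k hk => ?_
          rw [residue_eq_zero_iff_dvd hπ, Matrix.mulVec_diagonal]
          simp [d, hk]
        have hbT : residueVec (S *ᵥ Pi.single j 1) ∈ T := by
          refine hST _ fun k hk => ?_
          rw [Pi.single_eq_of_ne (by rintro rfl; exact hk hj), map_zero]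
        have h3 := hTU _ hbT _ hzU
        rw [pencil_apply] at h3
        have h4 : residue O (∑ i, S i j * C i z z) = 0 := by
          rw [← h3, map_sum]
          refine Finset.sum_congr rfl fun i _ => ?_
          rw [reduceForm_apply, Matrix.mulVec_single_one, map_mul]
          rfl
        obtain ⟨w, hw⟩ := (residue_eq_zero_iff_dvd hπ).mp h4
        rw [hw, map_mul, ← mul_assoc]
        simp only [e, hj, if_true, _root_.zpow_neg_one, inv_mul_cancel₀ hπ0, one_mul]
        exact algebraMap_mem_fracPow_zero w
      · simp only [e, hj, if_false, zpow_zero, one_mul]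
        exact algebraMap_mem_fracPow_zero _)
  rw [Module.finrank_fin_fun, ← hI, ← hJ, add_zero] at hle
  have hJ0 : 0 < J.card := by
    rw [hJ, Nat.pos_iff_ne_zero, Ne, Submodule.finrank_eq_zero]
    exact hT
  have h5 : (4 * (r : ℤ) + 1) - I.card ≤ 2 * J.card := by
    have : ((4 * r + 1 : ℕ) : ℤ) ≤ ((2 * J.card + I.card : ℕ) : ℤ) := by exact_mod_cast hle
    push_cast at this
    linarith
  have h6 := mul_le_mul_of_nonneg_left h5 (show (0 : ℤ) ≤ 2 * r by positivity)
  have h7 : (0 : ℤ) < J.card := by exact_mod_cast hJ0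
  linarith

/-- At a nonsingular zero the differentials of the forms are linearly independent. -/
theorem exists_dual_vectors {F V : Type*} [Field F] [AddCommGroup V] [Module F V] {r : ℕ}
    {A : Fin r → BilinForm F V} {x : V} (hx : ∀ b ≠ 0, x ∉ polarRad (pencil A b)) :
    ∃ v : Fin r → V, ∀ i j, polarForm (A i) x (v j) = if i = j then 1 else 0 := by
  have hsurj : Function.Surjective (LinearMap.pi fun i => polarForm (A i) x) := by
    rw [← LinearMap.range_eq_top]
    by_contra hne
    obtain ⟨f, hf, hle⟩ := Submodule.exists_le_ker_of_lt_top _ (lt_top_iff_ne_top.mpr hne)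
    refine hx (fun i => f (Pi.single i 1)) ?_ ?_
    · intro h0
      apply hf
      ext i
      exact congrFun h0 i
    · rw [mem_polarRad]
      intro y
      rw [polarForm_pencil_apply]
      have h1 : f (LinearMap.pi (fun i => polarForm (A i) x) y) = 0 := hle ⟨y, rfl⟩
      rw [← h1]
      conv_rhs => rw [LinearMap.pi_apply_eq_sum_univ f]
      refine Finset.sum_congr rfl fun i _ => ?_
      rw [smul_eq_mul, mul_comm]
      congr 2
      funext j
      simp [Pi.single_apply, eq_comm]
  choose v hv using fun j : Fin r => hsurj (Pi.single j 1)
  refine ⟨v, fun i j => ?_⟩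
  have := congrFun (hv j) i
  rw [LinearMap.pi_apply] at this
  rw [this, Pi.single_apply]

/-- If every anisotropic system has a primitive bound, then a large residue
field forces a zero of systems of `r` forms in `4 r + 1` variables. -/
theorem not_isAnisotropic {K : Type*} [Field K] [Algebra O K] [IsFractionRing O K]
    (hπ : Irreducible π) (hK : HasPrimitiveBound K π) (r : ℕ)
    (hF : (2 * r) ^ r < Nat.card (ResidueField O))
    (A : Fin r → BilinForm K (Fin (4 * r + 1) → K)) : ¬ IsAnisotropic A := by
  induction r using Nat.strong_induction_on with
  | _ r IH =>
    intro hA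
    rcases Nat.eq_zero_or_pos r with rfl | hr
    · obtain ⟨i, _⟩ := hA 1 one_ne_zero
      exact i.elim0
    have : Finite (ResidueField O) := Nat.finite_of_card_ne_zero (by lia)
    have IH' : ∀ s < r, ∀ B : Fin s → BilinForm K (Fin (4 * s + 1) → K), ¬ IsAnisotropic B :=
      fun s hs B => IH s hs (lt_of_le_of_lt
        (calc (2 * s) ^ s ≤ (2 * r) ^ s := Nat.pow_le_pow_left (by lia) s
          _ ≤ (2 * r) ^ r := Nat.pow_le_pow_right (by lia) hs.le) hF) B
    obtain ⟨A', hA', hint, hmin⟩ := exists_minimal_system hπ hK IH' hA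
    choose C hC using fun i => exists_integral_bilinForm (A' i)
      fun x => mem_fracPow_zero.mp (hint x i)
    obtain ⟨x, hx, hns⟩ := exists_nonsingular_zero hr
      (stablePencil_reduceForm hπ hmin hC) hF
    obtain ⟨v, hv⟩ := exists_dual_vectors hns
    obtain ⟨x₀, rfl⟩ := residueVec_surjective x
    choose v₀ hv₀ using fun j => residueVec_surjective (v j)
    obtain ⟨N, hN⟩ := hK _ _ A' hA'
    obtain ⟨y, hyx, hy⟩ := exists_approx_zero (C := C) (x₀ := x₀) (v := v₀)
      (fun i => by
        rw [← residue_eq_zero_iff_dvd hπ, ← reduceForm_apply]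
        exact hx i)
      (fun i j => by
        rw [← residue_eq_zero_iff_dvd hπ, map_sub, polarForm_apply, map_add, ← reduceForm_apply,
          ← reduceForm_apply, ← polarForm_apply, hv₀, hv]
        split_ifs <;> simp) N
    have hy_prim : ∃ l, IsUnit (y l) := by
      by_contra! hc
      refine hns (Pi.single ⟨0, hr⟩ 1) (by simp) ?_
      have h0 : residueVec x₀ = 0 := by
        funext l
        have h1 : residue O (y l) = 0 := by
          rw [residue_eq_zero_iff, mem_maximalIdeal]
          exact hc l
        have h2 := (residue_eq_zero_iff_dvd hπ).mpr (hyx l)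
        rw [map_sub, h1, zero_sub, neg_eq_zero] at h2
        exact h2
      rw [h0]
      exact Submodule.zero_mem _
    obtain ⟨j, hj⟩ := hN y hy_prim
    apply hj
    rw [← hC, mem_fracPow]
    obtain ⟨c, hc⟩ := hy j
    refine ⟨π * c, ?_⟩
    rw [hc, zpow_natCast, ← map_pow, ← map_mul]
    congr 1
    ring

end Lifting

/-! ### Locally compact fields -/

section LocallyCompact

open LinearMap (BilinForm)

variable {L : Type*} [NontriviallyNormedField L] {S : ValuationSubring L}

theorem isUnit_iff_norm_eq_one (hS : ∀ x, x ∈ S ↔ ‖x‖ ≤ 1) {x : S} :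
    IsUnit x ↔ ‖(x : L)‖ = 1 := by
  constructor
  · rintro ⟨u, rfl⟩
    have h1 : ‖((u : S) : L)‖ * ‖((u⁻¹ : Sˣ) : S).val‖ = 1 := by
      have h2 : ((u : S) : L) * ((u⁻¹ : Sˣ) : S).val = 1 := congrArg Subtype.val u.mul_inv
      rw [← norm_mul, h2, norm_one]
    have h3 := (hS _).mp (u : S).2
    have h4 := (hS _).mp ((u⁻¹ : Sˣ) : S).2
    nlinarith [norm_nonneg ((u : S) : L)]
  · intro h
    have hx : (x : L) ≠ 0 := norm_ne_zero_iff.mp (by rw [h]; exact one_ne_zero)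
    refine IsUnit.of_mul_eq_one ⟨(x : L)⁻¹, (hS _).mpr (by rw [norm_inv, h, inv_one])⟩ ?_
    ext
    exact mul_inv_cancel₀ hx

theorem continuous_bilinForm_self {n : ℕ} (A : BilinForm L (Fin n → L)) :
    Continuous fun x => A x x := by
  have h : ∀ x, A x x = ∑ i, ∑ j, x i * BilinForm.toMatrix' A i j * x j := fun x => by
    conv_lhs => rw [← Matrix.toBilin'_toMatrix' A, Matrix.toBilin'_apply]
  simp only [h]
  fun_prop

variable [ProperSpace L]

/-- The closed unit ball of a locally compact nonarchimedean field is a discrete valuation ring: an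
element of maximal absolute value less than one is a uniformizer. -/
theorem isDiscreteValuationRing_of_properSpace [IsUltrametricDist L]
    (hS : ∀ x, x ∈ S ↔ ‖x‖ ≤ 1) :
    IsDiscreteValuationRing S := by
  have hcomp : IsCompact (Metric.ball (0 : L) 1) :=
    Metric.isCompact_of_isClosed_isBounded (IsUltrametricDist.isClosed_ball _ _)
      Metric.isBounded_ball
  obtain ⟨ϖ, hϖ, hmax⟩ := hcomp.exists_isMaxOn ⟨0, by simp⟩ continuous_norm.continuousOn
  rw [mem_ball_zero_iff] at hϖ
  have hmax' : ∀ x : L, ‖x‖ < 1 → ‖x‖ ≤ ‖ϖ‖ := fun x hx => hmax (mem_ball_zero_iff.mpr hx)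
  have hpos : 0 < ‖ϖ‖ := by
    obtain ⟨c, hc0, hc1⟩ := NormedField.exists_norm_lt_one L
    exact hc0.trans_le (hmax' c hc1)
  have hnu : ∀ x : S, ¬ IsUnit x → ‖(x : L)‖ ≤ ‖ϖ‖ := fun x hx =>
    hmax' _ (lt_of_le_of_ne ((hS _).mp x.2) fun h => hx ((isUnit_iff_norm_eq_one hS).mpr h))
  refine IsDiscreteValuationRing.ofHasUnitMulPowIrreducibleFactorization
    ⟨⟨ϖ, (hS _).mpr hϖ.le⟩, ⟨?_, ?_⟩, ?_⟩
  · rw [isUnit_iff_norm_eq_one hS]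
    exact hϖ.ne
  · intro a b hab
    by_contra! h
    have h1 : ϖ = a * b := congrArg Subtype.val hab
    have h2 : ‖ϖ‖ ≤ ‖ϖ‖ * ‖ϖ‖ := by
      conv_lhs => rw [h1, norm_mul]
      exact mul_le_mul (hnu a h.1) (hnu b h.2) (norm_nonneg _) hpos.le
    nlinarith
  · intro x hx
    have hx0 : (x : L) ≠ 0 := fun h => hx (Subtype.ext h)
    obtain ⟨n, hn1, hn2⟩ := exists_nat_pow_near_of_lt_one (norm_pos_iff.mpr hx0)
      ((hS _).mp x.2) hpos hϖ
    have hz : ‖(x : L) / ϖ ^ n‖ = 1 := by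
      apply le_antisymm
      · rw [norm_div, norm_pow]
        exact div_le_one_of_le₀ hn2 (by positivity)
      · by_contra! h
        have h1 := hmax' _ h
        rw [norm_div, norm_pow, div_le_iff₀ (by positivity), ← pow_succ'] at h1
        exact absurd h1 (not_le.mpr hn1)
    have hu : IsUnit (⟨(x : L) / ϖ ^ n, (hS _).mpr hz.le⟩ : S) :=
      (isUnit_iff_norm_eq_one hS).mpr hz
    refine ⟨n, hu.unit, ?_⟩
    ext
    exact mul_div_cancel₀ _ (pow_ne_zero _ (norm_pos_iff.mp hpos))

/-- The primitive vectors are the compact unit sphere, on which the values of an anisotropic system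
are bounded away from zero. -/
theorem hasPrimitiveBound_of_properSpace (hS : ∀ x, x ∈ S ↔ ‖x‖ ≤ 1) {π : S}
    (hπ : Irreducible π) : HasPrimitiveBound L π := by
  intro r n A hA
  have hπ1 : ‖(π : L)‖ < 1 := lt_of_le_of_ne ((hS _).mp π.2) fun h =>
    hπ.not_isUnit ((isUnit_iff_norm_eq_one hS).mpr h)
  have hcont : Continuous fun x : Fin n → L => ‖fun i => A i x x‖ :=
    (continuous_pi fun i => continuous_bilinForm_self (A i)).norm
  have hprim : ∀ x : Fin n → S, (∃ i, IsUnit (x i)) → latticeEmb L x ∈ Metric.sphere 0 1 := by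
    rintro x ⟨i, hi⟩
    rw [mem_sphere_zero_iff_norm]
    apply le_antisymm
    · exact (pi_norm_le_iff_of_nonneg zero_le_one).mpr fun j => (hS _).mp (x j).2
    · rw [← (isUnit_iff_norm_eq_one hS).mp hi]
      exact norm_le_pi_norm (latticeEmb L x) i
  rcases (Metric.sphere (0 : Fin n → L) 1).eq_empty_or_nonempty with he | hne
  · refine ⟨0, fun x hx => ?_⟩
    have := hprim x hx
    rw [he] at this
    exact this.elim
  · obtain ⟨x₀, hx₀, hmin⟩ := (isCompact_sphere (0 : Fin n → L) 1).exists_isMinOn hne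
      hcont.continuousOn
    have hpos : 0 < ‖fun i => A i x₀ x₀‖ := by
      rw [norm_pos_iff]
      intro h0
      obtain ⟨i, hi⟩ := hA x₀ (by
        rintro rfl
        simp at hx₀)
      exact hi (congrFun h0 i)
    obtain ⟨N, hN⟩ := exists_pow_lt_of_lt_one hpos hπ1
    refine ⟨N, fun x hx => ?_⟩
    by_contra! hc
    have h1 : ‖fun i => A i (latticeEmb L x) (latticeEmb L x)‖ ≤ ‖(π : L)‖ ^ N := by
      refine (pi_norm_le_iff_of_nonneg (by positivity)).mpr fun i => ?_
      obtain ⟨y, hy⟩ := mem_fracPow.mp (hc i)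
      rw [hy, norm_mul, zpow_natCast, norm_pow]
      exact mul_le_of_le_one_left (by positivity) ((hS _).mp y.2)
    exact absurd (hmin (hprim x hx)) (not_le.mpr (h1.trans_lt hN))

end LocallyCompact

/-! ### Anisotropic systems in `4 r` variables -/

section LowerBound

open LinearMap (BilinForm)
open IsLocalRing

/-- Over a finite field the form `x ^ 2 - x y - c y ^ 2` is anisotropic for some `c`, since
`t ↦ t ^ 2 - t` is not injective and hence not surjective. -/
theorem exists_anisotropic_binary (F : Type*) [Field F] [Finite F] :
    ∃ c : F, ∀ x y : F, x ^ 2 - x * y - c * y ^ 2 = 0 → x = 0 ∧ y = 0 := by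
  have h1 : ¬ Function.Surjective fun t : F => t ^ 2 - t := by
    rw [← Finite.injective_iff_surjective]
    intro h
    exact zero_ne_one (h (show (0 : F) ^ 2 - 0 = 1 ^ 2 - 1 by ring))
  unfold Function.Surjective at h1
  push Not at h1
  obtain ⟨c, hc⟩ := h1
  refine ⟨c, fun x y h => ?_⟩
  have hy : y = 0 := by
    by_contra hy
    apply hc (x / y)
    field_simp
    linear_combination h
  subst hy
  simpa using h

variable {O : Type*} [CommRing O] [IsDomain O] [IsDiscreteValuationRing O]

/-- The form `N(x, y) + π N(z, w)` is anisotropic if the binary form `N` is anisotropic modulo the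
uniformizer. -/
theorem exists_anisotropic_quaternary (K : Type*) [Field K] [Algebra O K] [IsFractionRing O K]
    [Finite (ResidueField O)] : ∃ B : BilinForm K (Fin 4 → K), ∀ x, B x x = 0 → x = 0 := by
  obtain ⟨π, hπ⟩ := IsDiscreteValuationRing.exists_irreducible O
  obtain ⟨c₀, hc₀⟩ := exists_anisotropic_binary (ResidueField O)
  obtain ⟨c, rfl⟩ := residue_surjective c₀
  have hN : ∀ x y : O, π ∣ x ^ 2 - x * y - c * y ^ 2 → π ∣ x ∧ π ∣ y := by
    intro x y h
    rw [← residue_eq_zero_iff_dvd hπ] at h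
    have := hc₀ (residue O x) (residue O y) (by simpa using h)
    exact ⟨(residue_eq_zero_iff_dvd hπ).mp this.1, (residue_eq_zero_iff_dvd hπ).mp this.2⟩
  -- the matrix of `N(x, y) + π N(z, w)` for `N(x, y) = x ^ 2 - x y - c y ^ 2`
  let M : Matrix (Fin 4) (Fin 4) O :=
    !![1, -1, 0, 0; 0, -c, 0, 0; 0, 0, π, -π; 0, 0, 0, -(π * c)]
  have hB : ∀ y : Fin 4 → O, Matrix.toBilin' (M.map (algebraMap O K)) (latticeEmb K y)
      (latticeEmb K y) = algebraMap O K ((y 0 ^ 2 - y 0 * y 1 - c * y 1 ^ 2) +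
        π * (y 2 ^ 2 - y 2 * y 3 - c * y 3 ^ 2)) := by
    intro y
    simp only [Matrix.toBilin'_apply, Matrix.map_apply, latticeEmb, ← map_mul, ← map_sum]
    congr 1
    simp [M, Fin.sum_univ_four]
    ring
  refine ⟨Matrix.toBilin' (M.map (algebraMap O K)), fun x hx => ?_⟩
  by_contra hx0
  obtain ⟨a, y, ha, rfl, i, hi⟩ := exists_primitive hπ x hx0
  rw [quad_smul, mul_eq_zero, or_iff_right (pow_ne_zero _ ha), hB,
    FaithfulSMul.algebraMap_eq_zero_iff] at hx
  obtain ⟨⟨s, hs⟩, ⟨t, ht⟩⟩ := hN (y 0) (y 1)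
    ⟨-(y 2 ^ 2 - y 2 * y 3 - c * y 3 ^ 2), by linear_combination hx⟩
  have h1 := hN (y 2) (y 3) ⟨-(s ^ 2 - s * t - c * t ^ 2), by
    rw [hs, ht] at hx
    apply mul_left_cancel₀ hπ.ne_zero
    linear_combination hx⟩
  refine hπ.not_isUnit (isUnit_of_dvd_unit ?_ hi)
  fin_cases i
  · exact ⟨s, hs⟩
  · exact ⟨t, ht⟩
  · exact h1.1
  · exact h1.2

/-- Disjoint copies of an anisotropic form in four variables. -/
theorem not_hasCommonZeros {K : Type*} [Field K] {B : BilinForm K (Fin 4 → K)}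
    (hB : ∀ x, B x x = 0 → x = 0) (r : ℕ) : ¬ HasCommonZeros K r (4 * r) := by
  intro h
  obtain ⟨x, hx, hz⟩ := h fun i => (LinearMap.BilinMap.toQuadraticMap
    (B.compl₁₂ (LinearMap.funLeft K K fun j => finProdFinEquiv (j, i))
      (LinearMap.funLeft K K fun j => finProdFinEquiv (j, i))))
  apply hx
  funext k
  obtain ⟨⟨j, i⟩, rfl⟩ := finProdFinEquiv.surjective k
  exact congrFun (hB _ (hz i)) j

end LowerBound

/-! ### Systems of quadratic forms over `p`-adic fields -/

section Padic

variable (p : ℕ) [Fact p.Prime] (K : Type*) [Field K] [Algebra ℚ_[p] K] [FiniteDimensional ℚ_[p] K]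

theorem isDiscreteValuationRing_padicRingOfIntegers :
    IsDiscreteValuationRing (padicRingOfIntegers p K) := by
  let := spectralNorm.nontriviallyNormedField ℚ_[p] K
  let := spectralNorm.normedAlgebra ℚ_[p] K
  have : IsUltrametricDist K :=
    IsUltrametricDist.isUltrametricDist_of_isNonarchimedean_norm isNonarchimedean_spectralNorm
  have : ProperSpace K := FiniteDimensional.proper ℚ_[p] K
  exact isDiscreteValuationRing_of_properSpace fun x => Iff.rfl

theorem hasPrimitiveBound_padicRingOfIntegers {π : padicRingOfIntegers p K} (hπ : Irreducible π) :
    HasPrimitiveBound K π := by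
  let := spectralNorm.nontriviallyNormedField ℚ_[p] K
  let := spectralNorm.normedAlgebra ℚ_[p] K
  have : ProperSpace K := FiniteDimensional.proper ℚ_[p] K
  exact hasPrimitiveBound_of_properSpace (fun x => Iff.rfl) hπ

end Padic

theorem mainTheorem1 (p : ℕ) [Fact p.Prime] (K : Type*) [Field K] [Algebra ℚ_[p] K]
    [FiniteDimensional ℚ_[p] K] (r : ℕ)
    (hq : (2 * r) ^ r < Nat.card (PadicResidueField p K)) :
    (∀ n : ℕ, 4 * r < n → ∀ Q : Fin r → QuadraticForm K (Fin n → K),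
      ∃ x : Fin n → K, x ≠ 0 ∧ ∀ i, Q i x = 0) ∧
    quadraticBeta r K = ((4 * r : ℕ) : ℕ∞) := by
  have := isDiscreteValuationRing_padicRingOfIntegers p K
  have : Finite (PadicResidueField p K) := Nat.finite_of_card_ne_zero (by lia)
  obtain ⟨π, hπ⟩ := IsDiscreteValuationRing.exists_irreducible (padicRingOfIntegers p K)
  have hupper : ∀ n : ℕ, 4 * r < n → HasCommonZeros K r n := by
    intro n hn Q
    choose A hA using fun i => LinearMap.BilinMap.toQuadraticMap_surjective (Q i)
    obtain ⟨x, hx, -, hz⟩ := exists_zero_of_support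
      (not_isAnisotropic hπ (hasPrimitiveBound_padicRingOfIntegers p K hπ) r hq) A
      (Fin.castLE hn) (Fin.castLE_injective hn) id
    refine ⟨x, hx, fun i => ?_⟩
    rw [← hA]
    exact hz i
  refine ⟨hupper, le_antisymm (sInf_le ⟨4 * r, hupper, rfl⟩) (le_sInf ?_)⟩
  rintro _ ⟨m, hm, rfl⟩
  rw [Nat.cast_le]
  by_contra! hlt
  obtain ⟨B, hB⟩ := exists_anisotropic_quaternary (O := padicRingOfIntegers p K) K
  exact not_hasCommonZeros hB r (hm _ hlt)
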